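/- **Theorem.** Let $M$ be a compact connected smooth manifold without boundary and let $\mu$ be a volume form (a smooth positive density) on $M$, for example the Riemannian volume of a Riemannian metric. Spaces of smooth functions on $M$ carry their Fréchet topology (uniform convergence of all derivatives on compact subsets of charts), and smoothness of maps between open subsets of such spaces is meant in the sense of Michal–Bastiani–Hamilton. * Let $\mathrm{Dens}(M)=\{\varrho=\rho\mu : \rho\in C^\infty(M,\mathbb R),\ \rho>0,\ \int_M\rho\,\mu=1\}$, and let $T^*\mathrm{Dens}(M)=\mathrm{Dens}(M)\times C^\infty(M,\mathbb R)/\mathbb R$ be the (smooth part of its) cotangent bundle, a Fréchet manifold with tangent spaces $\{\dot\rho:\int_M\dot\rho\,\mu=0\}\times C^\infty(M,\mathbb R)/\mathbb R$ and canonical symplectic form $$\omega\big((\dot\rho_1,[\dot\theta_1]),(\dot\rho_2,[\dot\theta_2])\big)=\int_M(\dot\rho_1\dot\theta_2-\dot\rho_2\dot\theta_1)\,\mu .$$ * Let $\langle\phi,\psi\rangle=\int_M\bar\phi\,\psi\,\mu$, and let $PC^\infty(M,\mathbb C)$ be the quotient of the unit sphere $\{\psi\in C^\infty(M,\mathbb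 C):\langle\psi,\psi\rangle=1\}$ by $\psi\sim e^{i\alpha}\psi$, $\alpha\in\mathbb R$, with the quotient topology and the smooth structure given by the affine charts $[\psi]\mapsto\langle\phi,\psi\rangle^{-1}\psi-\phi\in\phi^\perp$. Its Fubini–Study symplectic form is $$\Omega_{[\psi]}(u,v)=\mathrm{Im}\left(\frac{\langle u,v\rangle}{\langle\psi,\psi\rangle}-\frac{\langle u,\psi\rangle\langle\psi,v\rangle}{\langle\psi,\psi\rangle^2}\right).$$ Let $PC^\infty(M,\mathbb C\setminus\{0\})\subset PC^\infty(M,\mathbb C)$ be the set of classes of nowhere vanishing functions. Then $PC^\infty(M,\mathbb C\setminus\{0\})$ is open in $PC^\infty(M,\mathbb C)$, and the Madelung transform $(\rho,\theta)\mapsto\sqrt{\rho e^{i\theta}}:=\sqrt\rho\,e^{i\theta/2}$ induces a well-defined map $$\Phi\colon T^*\mathrm{Dens}(M)\to PC^\infty(M,\mathbb C\setminus\{0\}),\qquad \Phi(\rho,[\theta])=[\sqrt\rho\,e^{i\theta/2}],$$ which is a symplectomorphism from $(T^*\mathrm{Dens}(M),\omega)$ onto an open subset of $(PC^\infty(M,\mathbb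 C\setminus\{0\}),4\,\Omega)$: it is injective, its image is open, it is smooth with smooth inverse defined on its image, and $\Phi^*(4\,\Omega)=\omega$. The image consists of the classes of those nowhere vanishing $\psi$ that are null-homotopic as maps $M\to\mathbb C\setminus\{0\}$. In particular, if $M$ is simply connected, then $\Phi$ is a symplectomorphism of $(T^*\mathrm{Dens}(M),\omega)$ onto all of $(PC^\infty(M,\mathbb C\setminus\{0\}),4\,\Omega)$. -/

import Mathlib

open scoped Manifold ContDiff Topology ComplexConjugate
open MeasureTheory Set Filter

noncomputable section

namespace Madelung

/-! ### Smooth maps between topological vector spaces (Michal–Bastiani–Hamilton calculus) -/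

/-- `f` has directional derivative `f'` at `x` in the direction `v`. -/
def HasDirDeriv {V W : Type*} [AddCommGroup V] [Module ℝ V] [AddCommGroup W] [Module ℝ W]
    [TopologicalSpace W] (f : V → W) (f' : W) (x v : V) : Prop :=
  Tendsto (fun t : ℝ => t⁻¹ • (f (x + t • v) - f x)) (𝓝[≠] 0) (𝓝 f')

/-- `f` is of class `C^k` on `U` (an open set in all uses): it is continuous on `U`, and, if
`k > 0`, all directional derivatives exist at the points of `U` and
`(x, v) ↦ Df(x) v` is of class `C^(k-1)` on `U × V`. -/
def CkOn {W : Type*} [AddCommGroup W] [Module ℝ W] [TopologicalSpace W] :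
    (k : ℕ) → {V : Type*} → [AddCommGroup V] → [Module ℝ V] → [TopologicalSpace V] →
      (V → W) → Set V → Prop
  | 0, _, _, _, _, f, U => ContinuousOn f U
  | k + 1, V, _, _, _, f, U => ContinuousOn f U ∧ ∃ f' : V × V → W,
      (∀ x ∈ U, ∀ v, HasDirDeriv f (f' (x, v)) x v) ∧ CkOn k f' (U ×ˢ univ)

/-- `f` is smooth on the open set `U`. -/
def SmoothOn {V W : Type*} [AddCommGroup V] [Module ℝ V] [TopologicalSpace V] [AddCommGroup W]
    [Module ℝ W] [TopologicalSpace W] (f : V → W) (U : Set V) : Prop :=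
  ∀ k, CkOn k f U

section Calculus

set_option linter.unusedSectionVars false

variable {V V₁ W W₁ W₂ : Type*}
  [AddCommGroup V] [Module ℝ V] [TopologicalSpace V]
  [AddCommGroup V₁] [Module ℝ V₁] [TopologicalSpace V₁]
  [AddCommGroup W] [Module ℝ W] [TopologicalSpace W]
  [AddCommGroup W₁] [Module ℝ W₁] [TopologicalSpace W₁]
  [AddCommGroup W₂] [Module ℝ W₂] [TopologicalSpace W₂]

theorem HasDirDeriv.unique [T2Space W] {f : V → W} {a b : W} {x v : V}
    (ha : HasDirDeriv f a x v) (hb : HasDirDeriv f b x v) : a = b :=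
  tendsto_nhds_unique ha hb

theorem HasDirDeriv.tendsto [IsTopologicalAddGroup W] [ContinuousSMul ℝ W] {f : V → W} {a : W}
    {x v : V} (h : HasDirDeriv f a x v) :
    Tendsto (fun t : ℝ => f (x + t • v)) (𝓝[≠] 0) (𝓝 (f x)) := by
  have h0 : Tendsto (fun t : ℝ => t) (𝓝[≠] 0) (𝓝 0) := tendsto_nhdsWithin_of_tendsto_nhds tendsto_id
  have h1 := (tendsto_const_nhds (x := f x)).add (h0.smul h)
  rw [zero_smul, add_zero] at h1
  refine h1.congr' ?_
  filter_upwards [self_mem_nhdsWithin] with t ht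
  rw [smul_inv_smul₀ ht]; abel

theorem HasDirDeriv.congr {f g : V → W} {a : W} {x v : V} (h : HasDirDeriv f a x v)
    (hx : f x = g x) (hfg : ∀ᶠ t : ℝ in 𝓝[≠] 0, f (x + t • v) = g (x + t • v)) :
    HasDirDeriv g a x v := by
  refine Tendsto.congr' ?_ h
  filter_upwards [hfg] with t ht
  rw [ht, hx]

theorem eventually_mem_line [ContinuousAdd V] [ContinuousSMul ℝ V] {U : Set V} (hU : IsOpen U)
    {x : V} (hx : x ∈ U) (v : V) : ∀ᶠ t : ℝ in 𝓝[≠] 0, x + t • v ∈ U := by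
  have h : Continuous fun t : ℝ => x + t • v :=
    continuous_const.add (continuous_id.smul continuous_const)
  have h0 : Tendsto (fun t : ℝ => x + t • v) (𝓝 0) (𝓝 x) := by
    simpa using h.tendsto 0
  exact tendsto_nhdsWithin_of_tendsto_nhds h0 (hU.mem_nhds hx)

theorem hasDirDeriv_affine (b : W) (L : V →ₗ[ℝ] W) (x v : V) :
    HasDirDeriv (fun y => b + L y) (L v) x v := by
  refine Tendsto.congr' ?_ tendsto_const_nhds
  filter_upwards [self_mem_nhdsWithin] with t ht
  have : (b + L (x + t • v)) - (b + L x) = t • L v := by rw [map_add, map_smul]; abel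
  rw [this, inv_smul_smul₀ ht]

theorem hasDirDeriv_const (b : W) (x v : V) : HasDirDeriv (fun _ => b) 0 x v := by
  simpa using hasDirDeriv_affine b (0 : V →ₗ[ℝ] W) x v

theorem HasDirDeriv.add [IsTopologicalAddGroup W] {f g : V → W} {a b : W} {x v : V}
    (hf : HasDirDeriv f a x v) (hg : HasDirDeriv g b x v) :
    HasDirDeriv (fun y => f y + g y) (a + b) x v := by
  refine (Tendsto.add hf hg).congr fun t => ?_
  rw [← smul_add, add_sub_add_comm]

theorem HasDirDeriv.clm {f : V → W₁} {a : W₁} {x v : V} (hf : HasDirDeriv f a x v)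
    (L : W₁ →L[ℝ] W) : HasDirDeriv (fun y => L (f y)) (L a) x v := by
  refine ((L.continuous.tendsto a).comp hf).congr fun t => ?_
  simp only [Function.comp, map_smul, map_sub]

theorem hasDirDeriv_iff_hasDerivAt {E : Type*} [NormedAddCommGroup E] [NormedSpace ℝ E]
    {f : V → E} {a : E} {x v : V} :
    HasDirDeriv f a x v ↔ HasDerivAt (fun t : ℝ => f (x + t • v)) a 0 := by
  rw [hasDerivAt_iff_tendsto_slope_zero]
  simp [HasDirDeriv]

theorem HasDirDeriv.bilin [IsTopologicalAddGroup W] [IsTopologicalAddGroup W₂]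
    [ContinuousSMul ℝ W₂] (B : W₁ →ₗ[ℝ] W₂ →ₗ[ℝ] W)
    (hB : Continuous fun p : W₁ × W₂ => B p.1 p.2) {f : V → W₁} {g : V → W₂} {a : W₁} {b : W₂}
    {x v : V} (hf : HasDirDeriv f a x v) (hg : HasDirDeriv g b x v) :
    HasDirDeriv (fun y => B (f y) (g y)) (B a (g x) + B (f x) b) x v := by
  have h1 := (hB.tendsto (a, g x)).comp (Tendsto.prodMk_nhds hf hg.tendsto)
  have h2 := (hB.tendsto (f x, b)).comp
    (Tendsto.prodMk_nhds (tendsto_const_nhds (x := f x) (f := 𝓝[≠] (0 : ℝ))) hg)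
  refine (h1.add h2).congr fun t => ?_
  simp only [Function.comp, map_smul, LinearMap.smul_apply, map_sub, LinearMap.sub_apply]
  rw [← smul_add]; congr 1; abel

theorem HasDirDeriv.inv {f : V → ℝ} {a : ℝ} {x v : V} (hf : HasDirDeriv f a x v) (h0 : f x ≠ 0) :
    HasDirDeriv (fun y => (f y)⁻¹) (-(a * ((f x)⁻¹ * (f x)⁻¹))) x v := by
  have h1 := ((hf.mul ((hf.tendsto.inv₀ h0).mul_const (f x)⁻¹))).neg
  refine h1.congr' ?_
  filter_upwards [hf.tendsto.eventually_ne h0] with t ht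
  simp only [smul_eq_mul]
  field_simp
  ring

theorem CkOn.continuousOn {k : ℕ} {f : V → W} {U : Set V} (h : CkOn k f U) : ContinuousOn f U := by
  cases k with
  | zero => exact h
  | succ k => exact h.1

theorem CkOn.pred {W : Type*} [AddCommGroup W] [Module ℝ W] [TopologicalSpace W] :
    ∀ (k : ℕ) {V : Type*} [AddCommGroup V] [Module ℝ V] [TopologicalSpace V]
      {f : V → W} {U : Set V}, CkOn (k + 1) f U → CkOn k f U
  | 0, _, _, _, _, _, _, h => h.1
  | k + 1, _, _, _, _, _, _, ⟨h, f', h1, h2⟩ => ⟨h, f', h1, CkOn.pred k h2⟩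

theorem CkOn.affine {W : Type*} [AddCommGroup W] [Module ℝ W] [TopologicalSpace W]
    [ContinuousAdd W] :
    ∀ (k : ℕ) {V : Type*} [AddCommGroup V] [Module ℝ V] [TopologicalSpace V]
      (b : W) (L : V →L[ℝ] W) (U : Set V), CkOn k (fun y => b + L y) U
  | 0, _, _, _, _, b, L, _ => (continuous_const.add L.continuous).continuousOn
  | k + 1, V, _, _, _, b, L, _ => by
    refine ⟨(continuous_const.add L.continuous).continuousOn, fun p => L p.2,
      fun x _ v => hasDirDeriv_affine b L.toLinearMap x v, ?_⟩
    simpa using CkOn.affine k 0 (L.comp (ContinuousLinearMap.snd ℝ V V)) _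

theorem CkOn.comp_clm {W : Type*} [AddCommGroup W] [Module ℝ W] [TopologicalSpace W] :
    ∀ (k : ℕ) {V V₁ : Type*} [AddCommGroup V] [Module ℝ V] [TopologicalSpace V]
      [AddCommGroup V₁] [Module ℝ V₁] [TopologicalSpace V₁]
      {f : V → W} {U : Set V} (L : V₁ →L[ℝ] V) {U₁ : Set V₁},
      MapsTo L U₁ U → CkOn k f U → CkOn k (fun y => f (L y)) U₁
  | 0, _, _, _, _, _, _, _, _, _, _, L, _, hU, h => h.comp L.continuous.continuousOn hU
  | k + 1, _, _, _, _, _, _, _, _, _, _, L, _, hU, ⟨h, f', h1, h2⟩ => by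
    refine ⟨h.comp L.continuous.continuousOn hU, fun p => f' (L p.1, L p.2), fun x hx v => ?_, ?_⟩
    · have := h1 _ (hU hx) (L v)
      simpa only [HasDirDeriv, map_add, map_smul] using this
    · exact CkOn.comp_clm k (L.prodMap L) (fun _ hp => And.intro (hU hp.1) trivial) h2

theorem CkOn.mono {k : ℕ} {f : V → W} {U U' : Set V} (h : CkOn k f U) (hU : U' ⊆ U) :
    CkOn k f U' :=
  CkOn.comp_clm k (ContinuousLinearMap.id ℝ V) hU h

theorem CkOn.congr [ContinuousAdd V] [ContinuousSMul ℝ V] {k : ℕ} {f g : V → W} {U : Set V}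
    (hU : IsOpen U) (h : CkOn k f U) (hfg : EqOn f g U) : CkOn k g U := by
  cases k with
  | zero => exact ContinuousOn.congr h hfg.symm
  | succ k =>
    obtain ⟨c, f', h1, h2⟩ := h
    refine ⟨c.congr hfg.symm, f', fun x hx v => (h1 x hx v).congr (hfg hx) ?_, h2⟩
    exact (eventually_mem_line hU hx v).mono fun t ht => hfg ht

theorem CkOn.add {W : Type*} [AddCommGroup W] [Module ℝ W] [TopologicalSpace W]
    [IsTopologicalAddGroup W] :
    ∀ (k : ℕ) {V : Type*} [AddCommGroup V] [Module ℝ V] [TopologicalSpace V]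
      {f g : V → W} {U : Set V}, CkOn k f U → CkOn k g U → CkOn k (fun y => f y + g y) U
  | 0, _, _, _, _, _, _, _, hf, hg => ContinuousOn.add hf hg
  | k + 1, _, _, _, _, _, _, _, ⟨hf, f', hf1, hf2⟩, ⟨hg, g', hg1, hg2⟩ =>
    ⟨hf.add hg, fun p => f' p + g' p, fun x hx v => (hf1 x hx v).add (hg1 x hx v),
      CkOn.add k hf2 hg2⟩

theorem CkOn.bilin {W W₁ W₂ : Type*} [AddCommGroup W] [Module ℝ W] [TopologicalSpace W]
    [AddCommGroup W₁] [Module ℝ W₁] [TopologicalSpace W₁]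
    [AddCommGroup W₂] [Module ℝ W₂] [TopologicalSpace W₂]
    [IsTopologicalAddGroup W] [IsTopologicalAddGroup W₂]
    [ContinuousSMul ℝ W₂] (B : W₁ →ₗ[ℝ] W₂ →ₗ[ℝ] W)
    (hB : Continuous fun p : W₁ × W₂ => B p.1 p.2) :
    ∀ (k : ℕ) {V : Type*} [AddCommGroup V] [Module ℝ V] [TopologicalSpace V]
      {f : V → W₁} {g : V → W₂} {U : Set V}, CkOn k f U → CkOn k g U →
      CkOn k (fun y => B (f y) (g y)) U
  | 0, _, _, _, _, _, _, _, hf, hg => hB.comp_continuousOn (ContinuousOn.prodMk hf hg)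
  | k + 1, V, _, _, _, f, g, U, hf, hg => by
    have hf0 := CkOn.pred k hf
    have hg0 := CkOn.pred k hg
    obtain ⟨cf, f', hf1, hf2⟩ := hf
    obtain ⟨cg, g', hg1, hg2⟩ := hg
    refine ⟨hB.comp_continuousOn (ContinuousOn.prodMk cf cg),
      fun p => B (f' p) (g p.1) + B (f p.1) (g' p),
      fun x hx v => (hf1 x hx v).bilin B hB (hg1 x hx v), ?_⟩
    have m : MapsTo (ContinuousLinearMap.fst ℝ V V) (U ×ˢ univ) U := fun p hp => hp.1
    exact CkOn.add k (CkOn.bilin B hB k hf2 (CkOn.comp_clm k (.fst ℝ V V) m hg0))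
      (CkOn.bilin B hB k (CkOn.comp_clm k (.fst ℝ V V) m hf0) hg2)

theorem CkOn.smul {W : Type*} [AddCommGroup W] [Module ℝ W] [TopologicalSpace W]
    [IsTopologicalAddGroup W] [ContinuousSMul ℝ W] (k : ℕ) {c : V → ℝ} {f : V → W} {U : Set V}
    (hc : CkOn k c U) (hf : CkOn k f U) : CkOn k (fun y => c y • f y) U :=
  CkOn.bilin (LinearMap.lsmul ℝ W) continuous_smul k hc hf

theorem CkOn.mul (k : ℕ) {c f : V → ℝ} {U : Set V}
    (hc : CkOn k c U) (hf : CkOn k f U) : CkOn k (fun y => c y * f y) U :=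
  CkOn.smul k hc hf

theorem CkOn.inv : ∀ (k : ℕ) {V : Type*} [AddCommGroup V] [Module ℝ V] [TopologicalSpace V]
      {f : V → ℝ} {U : Set V}, (∀ x ∈ U, f x ≠ 0) → CkOn k f U → CkOn k (fun y => (f y)⁻¹) U
  | 0, _, _, _, _, _, _, h0, hf => ContinuousOn.inv₀ hf h0
  | k + 1, V, _, _, _, f, U, h0, hf => by
    have hi := CkOn.inv k h0 (CkOn.pred k hf)
    obtain ⟨cf, f', hf1, hf2⟩ := hf
    refine ⟨cf.inv₀ h0, fun p => -(f' p * ((f p.1)⁻¹ * (f p.1)⁻¹)),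
      fun x hx v => (hf1 x hx v).inv (h0 x hx), ?_⟩
    have m : MapsTo (ContinuousLinearMap.fst ℝ V V) (U ×ˢ univ) U := fun p hp => hp.1
    have hi' := CkOn.comp_clm k (.fst ℝ V V) m hi
    have := CkOn.mul k (CkOn.affine k (-1 : ℝ) 0 _) (CkOn.mul k hf2 (CkOn.mul k hi' hi'))
    simpa using this

end Calculus

/-! ### Manifolds modelled on topological vector spaces, symplectic forms -/

/-- A smooth atlas on the topological space `X`: charts are homeomorphisms from open subsets of `X`
onto open subsets of topological vector spaces, and the changes of charts are smooth. -/
structure SmoothAtlas (X : Type*) [TopologicalSpace X] {ι : Type*} (V : ι → Type*)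
    [∀ i, AddCommGroup (V i)] [∀ i, Module ℝ (V i)] [∀ i, TopologicalSpace (V i)] where
  chart : ∀ i, OpenPartialHomeomorph X (V i)
  cover : ∀ x, ∃ i, x ∈ (chart i).source
  compat : ∀ i j, SmoothOn (fun y => chart j ((chart i).symm y))
    {y | y ∈ (chart i).target ∧ (chart i).symm y ∈ (chart j).source}

section Manifold

variable {X : Type*} [TopologicalSpace X] {ι : Type*} {V : ι → Type*}
  [∀ i, AddCommGroup (V i)] [∀ i, Module ℝ (V i)] [∀ i, TopologicalSpace (V i)]
  {Y : Type*} [TopologicalSpace Y] {κ : Type*} {W : κ → Type*}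
  [∀ j, AddCommGroup (W j)] [∀ j, Module ℝ (W j)] [∀ j, TopologicalSpace (W j)]

/-- The map `F` between manifolds is smooth on the open set `U`: it is continuous on `U` and smooth
in all charts. -/
def SmoothMapOn (A : SmoothAtlas X V) (B : SmoothAtlas Y W) (F : X → Y) (U : Set X) : Prop :=
  ContinuousOn F U ∧ ∀ i j, SmoothOn (fun y => B.chart j (F ((A.chart i).symm y)))
    {y | y ∈ (A.chart i).target ∧ (A.chart i).symm y ∈ U ∧
      F ((A.chart i).symm y) ∈ (B.chart j).source}

/-- A (weak) symplectic form: a smooth closed 2-form, given by its expressions `form i x v w` in the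
charts, with trivial kernel at every point. -/
structure SymplecticForm (A : SmoothAtlas X V) where
  form : ∀ i, V i → V i → V i → ℝ
  add_left : ∀ i x u v w, form i x (u + v) w = form i x u w + form i x v w
  smul_left : ∀ i x (c : ℝ) v w, form i x (c • v) w = c * form i x v w
  skew : ∀ i x v w, form i x w v = - form i x v w
  smooth : ∀ i, SmoothOn (fun p : V i × V i × V i => form i p.1 p.2.1 p.2.2)
    ((A.chart i).target ×ˢ univ)
  compat : ∀ i j, ∀ x ∈ (A.chart i).target, (A.chart i).symm x ∈ (A.chart j).source →
    ∀ v w v' w', HasDirDeriv (fun y => A.chart j ((A.chart i).symm y)) v' x v →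
      HasDirDeriv (fun y => A.chart j ((A.chart i).symm y)) w' x w →
      form j (A.chart j ((A.chart i).symm x)) v' w' = form i x v w
  closed : ∀ i, ∀ x ∈ (A.chart i).target, ∀ u v w (a b c : ℝ),
    HasDirDeriv (fun y => form i y v w) a x u → HasDirDeriv (fun y => form i y w u) b x v →
      HasDirDeriv (fun y => form i y u v) c x w → a + b + c = 0
  nondegenerate : ∀ i, ∀ x ∈ (A.chart i).target, ∀ v, (∀ w, form i x v w = 0) → v = 0

/-- The multiple `c σ` of a symplectic form. -/
def SymplecticForm.scale {A : SmoothAtlas X V} (c : ℝ) (hc : c ≠ 0) (σ : SymplecticForm A) :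
    SymplecticForm A where
  form i x v w := c * σ.form i x v w
  add_left i x u v w := by rw [σ.add_left]; ring
  smul_left i x d v w := by rw [σ.smul_left]; ring
  skew i x v w := by rw [σ.skew]; ring
  smooth i k := by
    have := CkOn.mul k (CkOn.affine k c (0 : V i × V i × V i →L[ℝ] ℝ)
      ((A.chart i).target ×ˢ univ)) (σ.smooth i k)
    simpa using this
  compat i j x hx hx' v w v' w' hv hw := by rw [σ.compat i j x hx hx' v w v' w' hv hw]
  closed i x hx u v w a b d ha hb hd := by
    have key : ∀ {p q r : V i} {e : ℝ}, HasDirDeriv (fun y => c * σ.form i y p q) e x r →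
        HasDirDeriv (fun y => σ.form i y p q) (c⁻¹ * e) x r := by
      intro p q r e h
      refine (Tendsto.const_mul c⁻¹ h).congr fun t => ?_
      simp only [smul_eq_mul]; field_simp
    have := σ.closed i x hx u v w _ _ _ (key ha) (key hb) (key hd)
    rw [← mul_add, ← mul_add] at this
    exact (mul_eq_zero.1 this).resolve_left (inv_ne_zero hc)
  nondegenerate i x hx v h := σ.nondegenerate i x hx v fun w =>
    (mul_eq_zero.1 (h w)).resolve_left hc

/-- `F` is a symplectomorphism from `(X, σ)` onto the open subset `U` of `(Y, Ω)`: a diffeomorphism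
of `X` onto `U` such that the pull-back of `Ω` is `σ`. -/
structure IsSymplectomorphismOnto {A : SmoothAtlas X V} (σ : SymplecticForm A)
    {B : SmoothAtlas Y W} (Ω : SymplecticForm B) (F : X → Y) (U : Set Y) : Prop where
  isOpen : IsOpen U
  range_eq : range F = U
  smooth : SmoothMapOn A B F univ
  smooth_inverse : ∃ G : Y → X, (∀ x, G (F x) = x) ∧ SmoothMapOn B A G U
  pullback : ∀ i j, ∀ x ∈ (A.chart i).target, F ((A.chart i).symm x) ∈ (B.chart j).source →
    ∀ v w v' w', HasDirDeriv (fun y => B.chart j (F ((A.chart i).symm y))) v' x v →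
      HasDirDeriv (fun y => B.chart j (F ((A.chart i).symm y))) w' x w →
      Ω.form j (B.chart j (F ((A.chart i).symm x))) v' w' = σ.form i x v w

end Manifold

/-! ### The Fréchet space of smooth functions -/

/-- The model space `ℝⁿ`. -/
abbrev Euc (n : ℕ) := EuclideanSpace ℝ (Fin n)

/-- `C^∞(M, F)`. -/
abbrev SmoothFn (n : ℕ) (M F : Type*) [TopologicalSpace M] [ChartedSpace (Euc n) M]
    [NormedAddCommGroup F] [NormedSpace ℝ F] :=
  C^∞⟮𝓡 n, M; 𝓘(ℝ, F), F⟯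

section FunctionSpace

variable {n : ℕ} {M : Type*} [TopologicalSpace M] [ChartedSpace (Euc n) M]
  [IsManifold (𝓡 n) ∞ M] {F G : Type*} [NormedAddCommGroup F] [NormedSpace ℝ F]
  [NormedAddCommGroup G] [NormedSpace ℝ G]

theorem contDiffAt_chart (f : SmoothFn n M F) (x : M) {y : Euc n}
    (hy : y ∈ (extChartAt (𝓡 n) x).target) :
    ContDiffAt ℝ ∞ (f ∘ (extChartAt (𝓡 n) x).symm) y := by
  have h : ContMDiffOn 𝓘(ℝ, Euc n) 𝓘(ℝ, F) ∞ (f ∘ (extChartAt (𝓡 n) x).symm)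
      (extChartAt (𝓡 n) x).target :=
    f.contMDiff.comp_contMDiffOn (contMDiffOn_extChartAt_symm x)
  exact (contMDiffOn_iff_contDiffOn.1 h).contDiffAt ((isOpen_extChartAt_target x).mem_nhds hy)

/-- The `k`-th derivative of the expression of `f` in the chart around `x`, as a continuous
function on the image of the chart. -/
def chartDeriv (F : Type*) [NormedAddCommGroup F] [NormedSpace ℝ F] (x : M) (k : ℕ) :
    SmoothFn n M F →ₗ[ℝ] C((extChartAt (𝓡 n) x).target, Euc n [×k]→L[ℝ] F) where
  toFun f :=
    { toFun := fun y => iteratedFDeriv ℝ k (f ∘ (extChartAt (𝓡 n) x).symm) y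
      continuous_toFun := continuous_iff_continuousAt.2 fun y =>
        ((contDiffAt_chart f x y.2).continuousAt_iteratedFDeriv
          (mod_cast le_top)).comp continuous_subtype_val.continuousAt }
  map_add' f g := by
    ext1 y
    exact iteratedFDeriv_add_apply ((contDiffAt_chart f x y.2).of_le (mod_cast le_top))
      ((contDiffAt_chart g x y.2).of_le (mod_cast le_top))
  map_smul' c f := by
    ext1 y
    exact iteratedFDeriv_const_smul_apply ((contDiffAt_chart f x y.2).of_le (mod_cast le_top))

/-- The Fréchet topology of `C^∞(M, F)`: uniform convergence of all derivatives on the compact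
subsets of the charts. -/
instance frechetTopology : TopologicalSpace (SmoothFn n M F) :=
  ⨅ p : M × ℕ, TopologicalSpace.induced (chartDeriv F p.1 p.2) inferInstance

instance : IsTopologicalAddGroup (SmoothFn n M F) :=
  topologicalAddGroup_iInf fun p => topologicalAddGroup_induced (chartDeriv F p.1 p.2)

instance : ContinuousSMul ℝ (SmoothFn n M F) :=
  continuousSMul_iInf fun p => continuousSMul_induced (chartDeriv F p.1 p.2)

theorem continuous_chartDeriv (x : M) (k : ℕ) : Continuous (chartDeriv (n := n) F x k) :=
  continuous_iInf_dom (i := (x, k)) continuous_induced_dom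

theorem continuous_iff_chartDeriv {Z : Type*} [TopologicalSpace Z] {f : Z → SmoothFn n M F} :
    Continuous f ↔ ∀ x k, Continuous fun z => chartDeriv F x k (f z) := by
  rw [continuous_iInf_rng]
  exact ⟨fun h x k => continuous_induced_rng.1 (h (x, k)),
    fun h p => continuous_induced_rng.2 (h p.1 p.2)⟩

/-- The inclusion `C^∞(M, F) → C(M, F)`. -/
def toCont : SmoothFn n M F →ₗ[ℝ] C(M, F) where
  toFun f := ⟨f, f.contMDiff.continuous⟩
  map_add' _ _ := rfl
  map_smul' _ _ := rfl

theorem continuous_toCont : Continuous (toCont : SmoothFn n M F → C(M, F)) := by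
  have : LocallyCompactSpace M := ChartedSpace.locallyCompactSpace (Euc n) M
  refine continuous_iff_continuousAt.2 fun f => ContinuousMap.tendsto_iff_tendstoLocallyUniformly.2 ?_
  rw [Metric.tendstoLocallyUniformly_iff]
  intro ε hε x
  have hx : extChartAt (𝓡 n) x x ∈ (extChartAt (𝓡 n) x).target := mem_extChartAt_target x
  have : LocallyCompactSpace (extChartAt (𝓡 n) x).target :=
    (isOpen_extChartAt_target x).locallyCompactSpace
  have h0 := (continuous_chartDeriv (F := F) (n := n) x 0).tendsto f
  rw [ContinuousMap.tendsto_iff_tendstoLocallyUniformly,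
    Metric.tendstoLocallyUniformly_iff] at h0
  obtain ⟨t, ht, hT⟩ := h0 ε hε ⟨_, hx⟩
  refine ⟨{y | ∃ h : y ∈ (extChartAt (𝓡 n) x).source,
    (⟨_, (extChartAt (𝓡 n) x).map_source h⟩ : (extChartAt (𝓡 n) x).target) ∈ t}, ?_, ?_⟩
  · rw [nhds_subtype_eq_comap, mem_comap] at ht
    obtain ⟨s, hs, hst⟩ := ht
    filter_upwards [extChartAt_source_mem_nhds (I := 𝓡 n) x,
      (continuousAt_extChartAt (I := 𝓡 n) x) hs] with y hy hy'
    exact ⟨hy, hst hy'⟩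
  · filter_upwards [hT] with g hg
    rintro y ⟨hy, hyt⟩
    have := hg _ hyt
    rw [dist_eq_norm] at this ⊢
    rw [← ContinuousMap.sub_apply, ← map_sub] at this
    simp only [chartDeriv, LinearMap.coe_mk, AddHom.coe_mk, ContinuousMap.coe_mk,
      norm_iteratedFDeriv_zero, Function.comp, PartialEquiv.left_inv _ hy] at this
    exact this

instance : T2Space (SmoothFn n M F) :=
  T2Space.of_injective_continuous (f := (toCont : SmoothFn n M F → C(M, F)))
    (fun _ _ h => ContMDiffMap.ext fun x => DFunLike.congr_fun h x) continuous_toCont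

/-- `f ↦ L ∘ f` for a continuous linear map `L`. -/
def postcomp (L : F →L[ℝ] G) : SmoothFn n M F →L[ℝ] SmoothFn n M G where
  toFun f := ⟨fun x => L (f x), L.contDiff.contMDiff.comp f.contMDiff⟩
  map_add' f g := by ext x; exact map_add L _ _
  map_smul' c f := by ext x; exact map_smul L _ _
  cont := by
    refine continuous_iff_chartDeriv.2 fun x k => ?_
    have h := (ContinuousMap.continuous_postcomp (X := (extChartAt (𝓡 n) x).target)
      (⟨fun A => L.compContinuousMultilinearMap A, by
        exact (ContinuousLinearMap.compContinuousMultilinearMapL ℝ (fun _ : Fin k => Euc n) F G L).continuous⟩ :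
        C(Euc n [×k]→L[ℝ] F, Euc n [×k]→L[ℝ] G))).comp (continuous_chartDeriv (n := n) (F := F) x k)
    convert h using 1
    funext f
    ext1 y
    exact L.iteratedFDeriv_comp_left (contDiffAt_chart f x y.2) (mod_cast le_top)

@[simp] theorem postcomp_apply (L : F →L[ℝ] G) (f : SmoothFn n M F) (x : M) :
    postcomp L f x = L (f x) := rfl

/-- The function `x ↦ c ψ(x)`. -/
def cmul (c : ℂ) (ψ : SmoothFn n M ℂ) : SmoothFn n M ℂ :=
  postcomp (ContinuousLinearMap.mul ℝ ℂ c) ψ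

@[simp] theorem cmul_apply (c : ℂ) (ψ : SmoothFn n M ℂ) (x : M) : cmul c ψ x = c * ψ x := rfl

theorem cmul_eq (c : ℂ) (ψ : SmoothFn n M ℂ) :
    cmul c ψ = c.re • ψ + c.im • cmul Complex.I ψ := by
  ext x
  simp only [cmul_apply, ContMDiffMap.coe_add, ContMDiffMap.coe_smul, Pi.add_apply, Pi.smul_apply,
    Complex.real_smul]
  nth_rewrite 1 [← Complex.re_add_im c]
  ring

theorem continuous_cmul : Continuous fun p : ℂ × SmoothFn n M ℂ => cmul p.1 p.2 := by
  have e : (fun p : ℂ × SmoothFn n M ℂ => cmul p.1 p.2) =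
      fun p => p.1.re • p.2 + p.1.im • cmul Complex.I p.2 := funext fun p => cmul_eq p.1 p.2
  rw [e]
  have : Continuous fun ψ : SmoothFn n M ℂ => cmul Complex.I ψ := (postcomp _).continuous
  exact ((Complex.continuous_re.comp continuous_fst).smul continuous_snd).add
    ((Complex.continuous_im.comp continuous_fst).smul (this.comp continuous_snd))

end FunctionSpace

/-! ### Volume and the `L²` inner product -/

/-- The measure `μ` on `M` is given by a volume form (a smooth positive density): in the chart
around any point it is `d(y) dy` with `d` smooth and positive. The Riemannian volume of a smooth
Riemannian metric, for which `d = √(det g_ij)`, is of this kind. -/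
class IsSmoothVolume (n : ℕ) {M : Type*} [TopologicalSpace M] [ChartedSpace (Euc n) M]
    [MeasurableSpace M] (μ : Measure M) : Prop where
  exists_density : ∀ x : M, ∃ d : Euc n → ℝ, ContDiffOn ℝ ∞ d (extChartAt (𝓡 n) x).target ∧
    (∀ y ∈ (extChartAt (𝓡 n) x).target, 0 < d y) ∧
    ∀ A ⊆ (extChartAt (𝓡 n) x).target, MeasurableSet A →
      μ ((extChartAt (𝓡 n) x).source ∩ extChartAt (𝓡 n) x ⁻¹' A)
        = ∫⁻ y in A, ENNReal.ofReal (d y)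

section Volume

variable (n : ℕ) {M : Type*} [TopologicalSpace M] [ChartedSpace (Euc n) M]
  [MeasurableSpace M] (μ : Measure M)

theorem isFiniteMeasure [IsSmoothVolume n μ] [CompactSpace M] : IsFiniteMeasure μ := by
  have : IsLocallyFiniteMeasure μ := by
    refine ⟨fun x => ?_⟩
    obtain ⟨d, hd, -, hA⟩ := IsSmoothVolume.exists_density (n := n) (μ := μ) x
    have hx : (extChartAt (𝓡 n) x).target ∈ 𝓝 (extChartAt (𝓡 n) x x) :=
      extChartAt_target_mem_nhds x
    obtain ⟨K, hK, hKt, hKc⟩ := local_compact_nhds hx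
    refine ⟨_, inter_mem (extChartAt_source_mem_nhds (I := 𝓡 n) x)
      (continuousAt_extChartAt (I := 𝓡 n) x hK), ?_⟩
    rw [hA K hKt hKc.measurableSet]
    have := ((hd.continuousOn.mono hKt).integrableOn_compact (μ := volume) hKc).lintegral_lt_top
    exact this
  infer_instance

theorem isOpenPosMeasure [IsSmoothVolume n μ] : μ.IsOpenPosMeasure := by
  refine ⟨fun U hU hne h0 => ?_⟩
  obtain ⟨x, hxU⟩ := hne
  obtain ⟨d, hd, hpos, hA⟩ := IsSmoothVolume.exists_density (n := n) (μ := μ) x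
  set e := extChartAt (𝓡 n) x with he
  have ho : IsOpen (e.target ∩ e.symm ⁻¹' U) :=
    (continuousOn_extChartAt_symm x).isOpen_inter_preimage (isOpen_extChartAt_target x) hU
  have hx : e x ∈ e.target ∩ e.symm ⁻¹' U :=
    ⟨mem_extChartAt_target x, by simpa [he, extChartAt_to_inv] using hxU⟩
  have h1 := hA _ inter_subset_left ho.measurableSet
  have h2 : μ (e.source ∩ e ⁻¹' (e.target ∩ e.symm ⁻¹' U)) = 0 := by
    refine measure_mono_null ?_ h0
    rintro y ⟨hy, -, hyU⟩
    rwa [mem_preimage, e.left_inv hy] at hyU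
  rw [h2] at h1
  have hm : AEMeasurable (fun y => ENNReal.ofReal (d y))
      (volume.restrict (e.target ∩ e.symm ⁻¹' U)) :=
    ((hd.continuousOn.mono inter_subset_left).aemeasurable ho.measurableSet).ennreal_ofReal
  have h3 := (lintegral_eq_zero_iff' hm).1 h1.symm
  rw [EventuallyEq, ae_restrict_iff' ho.measurableSet] at h3
  have h4 : volume (e.target ∩ e.symm ⁻¹' U) = 0 := by
    refine measure_mono_null (fun y hy => ?_) h3
    simp only [mem_compl_iff, mem_ofPred_eq, Pi.zero_apply, ENNReal.ofReal_eq_zero, not_forall,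
      not_le]
    exact ⟨hy, hpos y hy.1⟩
  exact (ho.measure_pos volume ⟨_, hx⟩).ne' h4

end Volume

section InnerProduct

set_option linter.unusedSectionVars false

variable {n : ℕ} {M : Type*} [TopologicalSpace M] [ChartedSpace (Euc n) M]
  [IsManifold (𝓡 n) ∞ M] [CompactSpace M] [MeasurableSpace M] [BorelSpace M]
  (μ : Measure M) {F : Type*} [NormedAddCommGroup F] [NormedSpace ℝ F]

theorem integrable_cont [IsFiniteMeasure μ] (f : C(M, F)) : Integrable f μ := by
  have : IsFiniteMeasureOnCompacts μ := inferInstance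
  exact f.continuous.integrable_of_hasCompactSupport (HasCompactSupport.of_compactSpace f)

theorem integrable_smooth [IsFiniteMeasure μ] (f : SmoothFn n M F) : Integrable f μ :=
  integrable_cont μ (toCont f)

/-- The integral as a continuous linear form on `C(M, F)`. -/
def integralCLM [IsFiniteMeasure μ] : C(M, F) →L[ℝ] F :=
  LinearMap.mkContinuous
    { toFun := fun f => ∫ x, f x ∂μ
      map_add' := fun f g => integral_add (integrable_cont μ f) (integrable_cont μ g)
      map_smul' := fun c f => integral_smul c f } (μ.real univ) fun f => by
    rw [mul_comm]
    exact norm_integral_le_of_norm_le_const (.of_forall f.norm_coe_le_norm)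

/-- The Hermitian `L²` inner product `⟨φ, ψ⟩ = ∫ φ̄ ψ dμ`. -/
def ip (φ ψ : SmoothFn n M ℂ) : ℂ := ∫ x, conj (φ x) * ψ x ∂μ

theorem integrable_ip [IsFiniteMeasure μ] (φ ψ : SmoothFn n M ℂ) :
    Integrable (fun x => conj (φ x) * ψ x) μ :=
  integrable_cont μ (star (toCont φ) * toCont ψ)

theorem continuous_ip [IsFiniteMeasure μ] :
    Continuous fun p : SmoothFn n M ℂ × SmoothFn n M ℂ => ip μ p.1 p.2 := by
  have h : Continuous fun p : SmoothFn n M ℂ × SmoothFn n M ℂ =>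
      integralCLM μ (star (toCont p.1) * toCont p.2) :=
    (integralCLM μ).continuous.comp ((continuous_star.comp
      (continuous_toCont.comp continuous_fst)).mul (continuous_toCont.comp continuous_snd))
  exact h

theorem ip_add_right [IsFiniteMeasure μ] (φ ψ χ : SmoothFn n M ℂ) :
    ip μ φ (ψ + χ) = ip μ φ ψ + ip μ φ χ := by
  simp only [ip, ContMDiffMap.coe_add, Pi.add_apply, mul_add]
  exact integral_add (integrable_ip μ _ _) (integrable_ip μ _ _)

theorem ip_cmul_right (c : ℂ) (φ ψ : SmoothFn n M ℂ) :
    ip μ φ (cmul c ψ) = c * ip μ φ ψ := by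
  simp only [ip, cmul_apply, mul_left_comm _ c]
  exact integral_const_mul _ _

theorem ip_conj (φ ψ : SmoothFn n M ℂ) : conj (ip μ φ ψ) = ip μ ψ φ := by
  simp only [ip, ← integral_conj, map_mul, Complex.conj_conj, mul_comm]

theorem ip_add_left [IsFiniteMeasure μ] (φ ψ χ : SmoothFn n M ℂ) :
    ip μ (φ + ψ) χ = ip μ φ χ + ip μ ψ χ := by
  rw [← ip_conj, ip_add_right, map_add, ip_conj, ip_conj]

theorem ip_cmul_left (c : ℂ) (φ ψ : SmoothFn n M ℂ) :
    ip μ (cmul c φ) ψ = conj c * ip μ φ ψ := by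
  rw [← ip_conj, ip_cmul_right, map_mul, ip_conj]

theorem smul_eq_cmul (r : ℝ) (ψ : SmoothFn n M ℂ) : r • ψ = cmul r ψ := by
  ext x; simp

/-- The inner product as a real bilinear map. -/
def ipBilin [IsFiniteMeasure μ] : SmoothFn n M ℂ →ₗ[ℝ] SmoothFn n M ℂ →ₗ[ℝ] ℂ :=
  LinearMap.mk₂ ℝ (ip μ) (ip_add_left μ)
    (fun r φ ψ => by rw [smul_eq_cmul, ip_cmul_left, Complex.conj_ofReal, Complex.real_smul])
    (ip_add_right μ) (fun r φ ψ => by rw [smul_eq_cmul, ip_cmul_right, Complex.real_smul])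

theorem eq_zero_of_integral_eq_zero [IsFiniteMeasure μ] [μ.IsOpenPosMeasure] {f : M → ℝ}
    (hf : Continuous f) (h0 : ∀ x, 0 ≤ f x) (h : ∫ x, f x ∂μ = 0) (x : M) : f x = 0 := by
  have h1 := (integral_eq_zero_iff_of_nonneg h0 (integrable_cont μ ⟨f, hf⟩)).1 h
  exact congrFun ((hf.ae_eq_iff_eq μ continuous_const).1 h1) x

theorem ip_self (ψ : SmoothFn n M ℂ) : ip μ ψ ψ = ((∫ x, ‖ψ x‖ ^ 2 ∂μ : ℝ) : ℂ) := by
  rw [ip, ← integral_complex_ofReal]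
  congr 1; funext x
  rw [mul_comm, Complex.mul_conj, Complex.normSq_eq_norm_sq]

theorem eq_zero_of_ip_self [IsFiniteMeasure μ] [μ.IsOpenPosMeasure] {ψ : SmoothFn n M ℂ}
    (h : ip μ ψ ψ = 0) : ψ = 0 := by
  rw [ip_self, Complex.ofReal_eq_zero] at h
  ext x
  have := eq_zero_of_integral_eq_zero μ
    ((continuous_norm.comp ψ.contMDiff.continuous).pow 2) (fun x => sq_nonneg _) h x
  simpa using this

theorem ip_zero_right (φ : SmoothFn n M ℂ) : ip μ φ 0 = 0 := by
  simp [ip]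

end InnerProduct

/-! ### The cotangent bundle of the space of densities -/

section Densities

set_option linter.unusedSectionVars false

variable (n : ℕ) {M : Type*} [TopologicalSpace M] [ChartedSpace (Euc n) M]
  [IsManifold (𝓡 n) ∞ M] [CompactSpace M] [ConnectedSpace M] [MeasurableSpace M] [BorelSpace M]
  (μ : Measure M) [IsSmoothVolume n μ]

/-- `Dens(M)`: the smooth positive densities `ϱ = ρ μ` of total mass one, represented by `ρ`. -/
def Dens := {ρ : SmoothFn n M ℝ // (∀ x, 0 < ρ x) ∧ ∫ x, ρ x ∂μ = 1}

instance : TopologicalSpace (Dens n μ) :=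
  inferInstanceAs (TopologicalSpace {ρ : SmoothFn n M ℝ // (∀ x, 0 < ρ x) ∧ ∫ x, ρ x ∂μ = 1})

/-- The tangent space of `Dens(M)` at every point: the functions with integral zero. -/
def zeroMean : Submodule ℝ (SmoothFn n M ℝ) where
  carrier := {f | ∫ x, f x ∂μ = 0}
  zero_mem' := by simp
  add_mem' {f g} hf hg := by
    have := isFiniteMeasure n μ
    have h := integral_add (integrable_smooth μ f) (integrable_smooth μ g)
    rw [mem_ofPred_eq] at hf hg
    rw [hf, hg, add_zero] at h
    exact h
  smul_mem' c f hf := by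
    have h := integral_smul (μ := μ) c (fun x => f x)
    rw [mem_ofPred_eq] at hf
    rw [hf, smul_zero] at h
    exact h

/-- The constant functions. -/
def constants (M : Type*) [TopologicalSpace M] [ChartedSpace (Euc n) M]
    [IsManifold (𝓡 n) ∞ M] : Submodule ℝ (SmoothFn n M ℝ) where
  carrier := {f | ∃ c, ∀ x, f x = c}
  zero_mem' := ⟨0, fun _ => rfl⟩
  add_mem' := by
    rintro f g ⟨c, hc⟩ ⟨d, hd⟩
    exact ⟨c + d, fun x => by simp [hc, hd]⟩
  smul_mem' := by
    rintro r f ⟨c, hc⟩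
    exact ⟨r * c, fun x => by simp [hc]⟩

/-- The cotangent space `C^∞(M)/ℝ` of `Dens(M)` at every point. -/
abbrev Cotangent (M : Type*) [TopologicalSpace M] [ChartedSpace (Euc n) M]
    [IsManifold (𝓡 n) ∞ M] := SmoothFn n M ℝ ⧸ constants n M

/-- The (smooth part of the) cotangent bundle `T*Dens(M) = Dens(M) × C^∞(M)/ℝ`. -/
abbrev CotangentDens := Dens n μ × Cotangent n M

/-- The model space of `T*Dens(M)`, which is also its tangent space at every point. -/
abbrev CotangentDensModel := zeroMean n μ × Cotangent n M

instance isClosed_constants : IsClosed (constants n M : Set (SmoothFn n M ℝ)) := by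
  have h : (constants n M : Set (SmoothFn n M ℝ)) = ⋂ (x : M) (y : M), {f | f x = f y} := by
    ext f
    simp only [mem_iInter, mem_ofPred_eq]
    constructor
    · rintro ⟨c, hc⟩ x y
      rw [hc, hc]
    · intro h
      obtain ⟨x⟩ : Nonempty M := inferInstance
      exact ⟨f x, fun y => h y x⟩
  have ev : ∀ x : M, Continuous fun f : SmoothFn n M ℝ => f x := fun x =>
    (continuous_eval_const (F := C(M, ℝ)) x).comp (continuous_toCont (n := n) (F := ℝ))
  rw [h]
  exact isClosed_iInter fun x => isClosed_iInter fun y => isClosed_eq (ev x) (ev y)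

/-- The pairing `∫ θ h dμ` of smooth functions. -/
def mulIntegral : SmoothFn n M ℝ →ₗ[ℝ] SmoothFn n M ℝ →ₗ[ℝ] ℝ :=
  have := isFiniteMeasure n μ
  LinearMap.mk₂ ℝ (fun θ h => ∫ x, θ x * h x ∂μ)
    (fun a b c => by
      simp only [ContMDiffMap.coe_add, Pi.add_apply, add_mul]
      exact integral_add (integrable_cont μ (toCont a * toCont c))
        (integrable_cont μ (toCont b * toCont c)))
    (fun r a b => by
      simp only [ContMDiffMap.coe_smul, Pi.smul_apply, smul_eq_mul, mul_assoc]
      exact integral_const_mul _ _)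
    (fun a b c => by
      simp only [ContMDiffMap.coe_add, Pi.add_apply, mul_add]
      exact integral_add (integrable_cont μ (toCont a * toCont b))
        (integrable_cont μ (toCont a * toCont c)))
    (fun r a b => by
      simp only [ContMDiffMap.coe_smul, Pi.smul_apply, smul_eq_mul, mul_left_comm _ r]
      exact integral_const_mul _ _)

theorem mulIntegral_apply (θ h : SmoothFn n M ℝ) :
    mulIntegral n μ θ h = ∫ x, θ x * h x ∂μ := rfl

theorem continuous_mulIntegral :
    Continuous fun p : SmoothFn n M ℝ × SmoothFn n M ℝ => mulIntegral n μ p.1 p.2 := by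
  have := isFiniteMeasure n μ
  have h : Continuous fun p : SmoothFn n M ℝ × SmoothFn n M ℝ =>
      integralCLM μ (toCont p.1 * toCont p.2) :=
    (integralCLM μ).continuous.comp ((continuous_toCont.comp continuous_fst).mul
      (continuous_toCont.comp continuous_snd))
  exact h

/-- The duality `⟨[θ], h⟩ = ∫ θ h dμ` between cotangent and tangent vectors of `Dens(M)`. -/
def pairing : Cotangent n M →ₗ[ℝ] zeroMean n μ →ₗ[ℝ] ℝ :=
  (constants n M).liftQ ((mulIntegral n μ).compl₂ (zeroMean n μ).subtype) <| by
    rintro θ ⟨c, hc⟩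
    rw [LinearMap.mem_ker]
    ext ⟨h, hh⟩
    have hh' : ∫ x, h x ∂μ = 0 := hh
    simp only [LinearMap.compl₂_apply, Submodule.subtype_apply, mulIntegral_apply, hc,
      integral_const_mul, hh', mul_zero, LinearMap.zero_apply]

theorem pairing_mk (θ : SmoothFn n M ℝ) (h : zeroMean n μ) :
    pairing n μ (Submodule.Quotient.mk θ) h = ∫ x, θ x * (h : SmoothFn n M ℝ) x ∂μ := rfl

theorem continuous_pairing :
    Continuous fun p : Cotangent n M × zeroMean n μ => pairing n μ p.1 p.2 := by
  have hq : IsOpenQuotientMap (Prod.map ((constants n M).mkQ) (id : zeroMean n μ → zeroMean n μ)) :=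
    IsOpenQuotientMap.prodMap ⟨Submodule.mkQ_surjective _, continuous_quot_mk,
      QuotientAddGroup.isOpenMap_coe⟩ IsOpenQuotientMap.id
  rw [hq.isQuotientMap.continuous_iff]
  exact (continuous_mulIntegral n μ).comp
    (continuous_fst.prodMk (continuous_subtype_val.comp continuous_snd))

/-- The constant function `c`. -/
def constFn (M : Type*) [TopologicalSpace M] [ChartedSpace (Euc n) M]
    [IsManifold (𝓡 n) ∞ M] (c : ℝ) : SmoothFn n M ℝ := ⟨fun _ => c, contMDiff_const⟩

theorem measure_univ_pos (_ : IsSmoothVolume n μ) : 0 < μ.real univ := by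
  have := isFiniteMeasure n μ
  have := isOpenPosMeasure n μ
  exact ENNReal.toReal_pos (isOpen_univ.measure_pos μ univ_nonempty).ne' (measure_ne_top _ _)

/-- The uniform density. -/
def uniformDens : Dens n μ :=
  ⟨constFn n M (μ.real univ)⁻¹, fun _ => inv_pos.2 (measure_univ_pos n μ inferInstance), by
    simp [constFn, (measure_univ_pos n μ inferInstance).ne']⟩

instance : Nonempty (Dens n μ) := ⟨uniformDens n μ⟩

/-- The global chart `(ρ, [θ]) ↦ (ρ - ρ₀, [θ])` of `T*Dens(M)`, with `ρ₀` the uniform density. -/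
def cotangentCoord (z : CotangentDens n μ) : CotangentDensModel n μ :=
  (⟨z.1.1 - (uniformDens n μ).1, by
    have := isFiniteMeasure n μ
    have h := integral_sub (integrable_smooth μ z.1.1) (integrable_smooth μ (uniformDens n μ).1)
    rw [z.1.2.2, (uniformDens n μ).2.2, sub_self] at h
    exact h⟩, z.2)

theorem isOpenEmbedding_cotangentCoord : Topology.IsOpenEmbedding (cotangentCoord n μ) := by
  have := isFiniteMeasure n μ
  set ρ₀ := (uniformDens n μ).1 with hρ₀
  let e : Dens n μ → zeroMean n μ := fun ρ => (cotangentCoord n μ (ρ, 0)).1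
  have he : Topology.IsEmbedding e := by
    have h1 : Topology.IsEmbedding fun ρ : Dens n μ => ρ.1 - ρ₀ :=
      (Homeomorph.subRight ρ₀).isEmbedding.comp Topology.IsEmbedding.subtypeVal
    have h2 : Continuous e := h1.continuous.subtype_mk _
    exact Topology.IsEmbedding.of_comp h2 continuous_subtype_val h1
  have ho : IsOpen (range e) := by
    have h1 : IsOpen {f : C(M, ℝ) | MapsTo f univ (Ioi 0)} :=
      ContinuousMap.isOpen_setOfPred_mapsTo isCompact_univ isOpen_Ioi
    have h2 : Continuous fun h : zeroMean n μ => toCont (ρ₀ + (h : SmoothFn n M ℝ)) :=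
      continuous_toCont.comp (continuous_const.add continuous_subtype_val)
    convert h1.preimage h2 using 1
    ext h
    constructor
    · rintro ⟨ρ, rfl⟩ x -
      change 0 < ρ₀ x + (ρ.1 x - ρ₀ x)
      rw [add_sub_cancel]
      exact ρ.2.1 x
    · intro hh
      refine ⟨⟨ρ₀ + h, fun x => hh (mem_univ x), ?_⟩, Subtype.ext (add_sub_cancel_left ρ₀ h.1)⟩
      have h3 := integral_add (integrable_smooth μ ρ₀) (integrable_smooth μ h.1)
      have h4 : ∫ x, h.1 x ∂μ = 0 := h.2
      rw [(uniformDens n μ).2.2, h4, add_zero] at h3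
      exact h3
  exact (Topology.IsOpenEmbedding.mk he ho).prodMap Topology.IsOpenEmbedding.id

/-- The smooth structure of `T*Dens(M)`, an open subset of an affine space. -/
def cotangentAtlas : SmoothAtlas (CotangentDens n μ) (fun _ : Unit => CotangentDensModel n μ) where
  chart _ := (isOpenEmbedding_cotangentCoord n μ).toOpenPartialHomeomorph _
  cover _ := ⟨(), trivial⟩
  compat _ _ k := by
    have h := CkOn.affine k 0 (ContinuousLinearMap.id ℝ (CotangentDensModel n μ))
      (range (cotangentCoord n μ))
    refine CkOn.mono (h.congr (isOpenEmbedding_cotangentCoord n μ).isOpen_range fun y hy => ?_)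
      fun y hy => by simpa using hy.1
    have := (isOpenEmbedding_cotangentCoord n μ).toOpenPartialHomeomorph_right_inv _ hy
    simpa using this.symm

theorem exists_zeroMean_representative (q : Cotangent n M) :
    ∃ h : zeroMean n μ, Submodule.Quotient.mk h.1 = q := by
  have := isFiniteMeasure n μ
  obtain ⟨θ, rfl⟩ := Submodule.Quotient.mk_surjective _ q
  set m := (μ.real univ)⁻¹ * ∫ x, θ x ∂μ
  refine ⟨⟨θ - constFn n M m, ?_⟩, ?_⟩
  · have h := integral_sub (integrable_smooth μ θ) (integrable_smooth μ (constFn n M m))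
    have h2 : ∫ x, constFn n M m x ∂μ = ∫ x, θ x ∂μ := by
      simp [constFn, m, (measure_univ_pos n μ inferInstance).ne']
    rw [h2, sub_self] at h
    exact h
  · rw [Submodule.Quotient.eq]
    exact ⟨-m, fun x => sub_sub_cancel_left (θ x) m⟩

theorem eq_zero_of_pairing_self {h : zeroMean n μ}
    (h0 : pairing n μ (Submodule.Quotient.mk h.1) h = 0) : h = 0 := by
  have := isFiniteMeasure n μ
  have := isOpenPosMeasure n μ
  rw [pairing_mk] at h0
  ext x
  have := eq_zero_of_integral_eq_zero μ (f := fun x => h.1 x * h.1 x)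
    (h.1.contMDiff.continuous.mul h.1.contMDiff.continuous) (fun x => mul_self_nonneg _) h0 x
  simpa using this

/-- The canonical symplectic form `dρ ∧ dθ = -dλ` of `T*Dens(M)`:
`ω((ρ̇₁, θ̇₁), (ρ̇₂, θ̇₂)) = ∫ (θ̇₂ ρ̇₁ - θ̇₁ ρ̇₂) dμ`. -/
def canonicalForm : SymplecticForm (cotangentAtlas n μ) where
  form _ _ v w := pairing n μ w.2 v.1 - pairing n μ v.2 w.1
  add_left _ _ u v w := by simp; ring
  smul_left _ _ c v w := by simp; ring
  skew _ _ v w := by ring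
  smooth _ k := by
    let N := CotangentDensModel n μ
    let π₁ : N →L[ℝ] zeroMean n μ := .fst ℝ _ _
    let π₂ : N →L[ℝ] Cotangent n M := .snd ℝ _ _
    let p₁ : N × N × N →L[ℝ] N := (ContinuousLinearMap.fst ℝ N N).comp (.snd ℝ N (N × N))
    let p₂ : N × N × N →L[ℝ] N := (ContinuousLinearMap.snd ℝ N N).comp (.snd ℝ N (N × N))
    have l1 : ∀ (L : N × N × N →L[ℝ] Cotangent n M) (L' : N × N × N →L[ℝ] zeroMean n μ) (U),
        CkOn k (fun p => pairing n μ (L p) (L' p)) U := by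
      intro L L' U
      have := CkOn.bilin (pairing n μ) (continuous_pairing n μ) k
        (CkOn.affine k 0 L U) (CkOn.affine k 0 L' U)
      simpa using this
    have h3 := CkOn.add k (l1 (π₂.comp p₂) (π₁.comp p₁)
      (((cotangentAtlas n μ).chart ()).target ×ˢ univ)) (l1 (π₂.comp (-p₁)) (π₁.comp p₂) _)
    convert h3 using 1
    funext p
    simp [N, π₁, π₂, p₁, p₂, sub_eq_add_neg]
  compat i j x hx hx' v w v' w' hv hw := by
    have key : ∀ {u u'}, HasDirDeriv (fun y => (cotangentAtlas n μ).chart j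
        (((cotangentAtlas n μ).chart i).symm y)) u' x u → u' = u := by
      intro u u' hu
      have h1 : HasDirDeriv (fun y : CotangentDensModel n μ => y) u x u := by
        simpa using hasDirDeriv_affine 0 (LinearMap.id : CotangentDensModel n μ →ₗ[ℝ] _) x u
      refine hu.unique (h1.congr (((cotangentAtlas n μ).chart i).right_inv hx).symm ?_)
      exact (eventually_mem_line ((cotangentAtlas n μ).chart i).open_target hx u).mono
        fun t ht => (((cotangentAtlas n μ).chart i).right_inv ht).symm
    rw [key hv, key hw]
  closed _ x _ u v w a b c ha hb hc := by
    rw [ha.unique (hasDirDeriv_const _ _ _), hb.unique (hasDirDeriv_const _ _ _),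
      hc.unique (hasDirDeriv_const _ _ _)]
    simp
  nondegenerate _ x _ v h := by
    obtain ⟨h1, q⟩ := v
    obtain ⟨h2, rfl⟩ := exists_zeroMean_representative n μ q
    have e1 := h (0, Submodule.Quotient.mk h1.1)
    have e2 := h (h2, 0)
    simp only [map_zero, sub_zero, LinearMap.zero_apply, zero_sub, neg_eq_zero] at e1 e2
    rw [eq_zero_of_pairing_self n μ e1, eq_zero_of_pairing_self n μ e2]
    simp

/-- The Liouville 1-form `λ_{(ρ, [θ])}(ρ̇, θ̇) = ∫ θ ρ̇ dμ` of `T*Dens(M)`, in the global chart. -/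
def liouvilleForm (z v : CotangentDensModel n μ) : ℝ := pairing n μ z.2 v.1

theorem canonicalForm_eq_neg_deriv_liouvilleForm (z v w : CotangentDensModel n μ) (a b : ℝ)
    (ha : HasDirDeriv (fun z => liouvilleForm n μ z w) a z v)
    (hb : HasDirDeriv (fun z => liouvilleForm n μ z v) b z w) :
    (canonicalForm n μ).form () z v w = -(a - b) := by
  have key : ∀ {u u' : CotangentDensModel n μ} {c : ℝ},
      HasDirDeriv (fun z => liouvilleForm n μ z u) c z u' → c = pairing n μ u'.2 u.1 := by
    intro u u' c hc
    have := hasDirDeriv_affine 0 (((pairing n μ).flip u.1).comp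
      (LinearMap.snd ℝ (zeroMean n μ) (Cotangent n M))) z u'
    simp only [zero_add] at this
    exact hc.unique this
  rw [key ha, key hb]
  change pairing n μ w.2 v.1 - pairing n μ v.2 w.1 = _
  ring

end Densities

/-! ### The complex projective space of smooth functions -/

section Projective

set_option linter.unusedSectionVars false

variable (n : ℕ) {M : Type*} [TopologicalSpace M] [ChartedSpace (Euc n) M]
  [IsManifold (𝓡 n) ∞ M] [CompactSpace M] [MeasurableSpace M] [BorelSpace M]
  (μ : Measure M) [IsSmoothVolume n μ]

/-- The unit sphere of `C^∞(M, ℂ)` for the `L²` norm. -/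
abbrev Sphere := {ψ : SmoothFn n M ℂ // ip μ ψ ψ = 1}

/-- `ψ' ∼ ψ` if `ψ' = e^{iα} ψ` for a real constant `α`. -/
instance phaseSetoid : Setoid (Sphere n μ) where
  r ψ ψ' := ∃ α : ℝ, ψ'.1 = cmul (Complex.exp (α * Complex.I)) ψ.1
  iseqv := by
    refine ⟨fun ψ => ⟨0, by ext x; simp⟩, ?_, ?_⟩
    · rintro ψ ψ' ⟨α, h⟩
      refine ⟨-α, ?_⟩
      ext x
      simp [h, ← mul_assoc, ← Complex.exp_add]
    · rintro ψ ψ' ψ'' ⟨α, h⟩ ⟨β, h'⟩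
      refine ⟨β + α, ?_⟩
      ext x
      simp [h, h', ← mul_assoc, ← Complex.exp_add, add_mul]

/-- The projective space `PC^∞(M, ℂ)`, with the quotient topology. -/
abbrev Proj := Quotient (phaseSetoid n μ)

variable {n}

/-- The (real) space of functions `L²`-orthogonal to `φ`, the model space at `[φ]`. -/
def orth (φ : Sphere n μ) : Submodule ℝ (SmoothFn n M ℂ) where
  carrier := {χ | ip μ φ.1 χ = 0}
  zero_mem' := ip_zero_right μ φ.1
  add_mem' {a b} ha hb := by
    have := isFiniteMeasure n μ
    rw [mem_ofPred_eq] at ha hb ⊢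
    rw [ip_add_right, ha, hb, add_zero]
  smul_mem' r a ha := by
    rw [mem_ofPred_eq] at ha ⊢
    rw [smul_eq_cmul, ip_cmul_right, ha, mul_zero]

variable {μ}

theorem mem_orth {φ : Sphere n μ} {χ : SmoothFn n M ℂ} : χ ∈ orth μ φ ↔ ip μ φ.1 χ = 0 := Iff.rfl

theorem continuous_ip' : Continuous fun p : SmoothFn n M ℂ × SmoothFn n M ℂ => ip μ p.1 p.2 :=
  have := isFiniteMeasure n μ
  continuous_ip μ

theorem continuous_ip_right (φ : SmoothFn n M ℂ) : Continuous fun ψ => ip μ φ ψ :=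
  continuous_ip'.comp (continuous_const.prodMk continuous_id)

theorem cmul_cmul (a b : ℂ) (ψ : SmoothFn n M ℂ) : cmul a (cmul b ψ) = cmul (a * b) ψ := by
  ext x; simp [mul_assoc]

theorem add_cmul_mem_orth (φ : Sphere n μ) (ψ : SmoothFn n M ℂ) :
    ψ + cmul (-ip μ φ.1 ψ) φ.1 ∈ orth μ φ := by
  have := isFiniteMeasure n μ
  rw [mem_orth, ip_add_right, ip_cmul_right, φ.2]
  ring

/-- The orthogonal projection `ψ ↦ ψ - ⟨φ, ψ⟩ φ`. -/
def orthProj (φ : Sphere n μ) : SmoothFn n M ℂ →L[ℝ] orth μ φ where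
  toFun ψ := ⟨ψ + cmul (-ip μ φ.1 ψ) φ.1, add_cmul_mem_orth φ ψ⟩
  map_add' a b := by
    have := isFiniteMeasure n μ
    refine Subtype.ext (ContMDiffMap.ext fun x => ?_)
    simp [ip_add_right]; ring
  map_smul' r a := by
    refine Subtype.ext (ContMDiffMap.ext fun x => ?_)
    simp [smul_eq_cmul r a, ip_cmul_right]; ring
  cont := (continuous_id.add (continuous_cmul.comp
    ((continuous_ip_right φ.1).neg.prodMk continuous_const))).subtype_mk _

theorem cmul_mem_orth {φ : Sphere n μ} (c : ℂ) {χ : SmoothFn n M ℂ} (h : χ ∈ orth μ φ) :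
    cmul c χ ∈ orth μ φ := by
  rw [mem_orth, ip_cmul_right, mem_orth.1 h, mul_zero]

/-- Multiplication by `i` on `φ^⊥`. -/
def orthI (φ : Sphere n μ) : orth μ φ →L[ℝ] orth μ φ where
  toFun χ := ⟨cmul Complex.I χ.1, cmul_mem_orth _ χ.2⟩
  map_add' a b := by
    refine Subtype.ext (ContMDiffMap.ext fun x => ?_)
    simp [mul_add]
  map_smul' r a := by
    refine Subtype.ext (ContMDiffMap.ext fun x => ?_)
    simp [mul_left_comm]
  cont := (continuous_cmul.comp (continuous_const.prodMk continuous_subtype_val)).subtype_mk _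

/-- Complex multiples of elements of `φ^⊥`. -/
def orthMul (φ : Sphere n μ) (c : ℂ) (χ : orth μ φ) : orth μ φ := c.re • χ + c.im • orthI φ χ

theorem coe_orthMul (φ : Sphere n μ) (c : ℂ) (χ : orth μ φ) :
    (orthMul φ c χ : SmoothFn n M ℂ) = cmul c χ.1 := (cmul_eq c χ.1).symm

theorem coe_orthProj (φ : Sphere n μ) (ψ : SmoothFn n M ℂ) :
    (orthProj φ ψ : SmoothFn n M ℂ) = ψ + cmul (-ip μ φ.1 ψ) φ.1 := rfl

theorem exp_mul_I_ne_zero (α : ℝ) : Complex.exp (α * Complex.I) ≠ 0 := Complex.exp_ne_zero _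

/-- The affine coordinate `[ψ] ↦ ⟨φ, ψ⟩⁻¹ ψ - φ ∈ φ^⊥`, written as
`⟨φ, ψ⟩⁻¹ (ψ - ⟨φ, ψ⟩ φ)`. -/
def affineCoord (φ : Sphere n μ) : Proj n μ → orth μ φ :=
  Quotient.lift (fun ψ => orthMul φ (ip μ φ.1 ψ.1)⁻¹ (orthProj φ ψ.1)) <| by
    rintro ψ ψ' ⟨α, h⟩
    ext x
    have h0 := exp_mul_I_ne_zero α
    simp only [coe_orthMul, coe_orthProj, h, ip_cmul_right, cmul_apply, ContMDiffMap.coe_add,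
      Pi.add_apply]
    field_simp

/-- The point `[ψ]` is not orthogonal to `[φ]`. -/
def NotOrthogonal (φ : Sphere n μ) : Proj n μ → Prop :=
  Quotient.lift (fun ψ => ip μ φ.1 ψ.1 ≠ 0) <| by
    rintro ψ ψ' ⟨α, h⟩
    simp [h, ip_cmul_right, exp_mul_I_ne_zero α]

theorem ip_self_re (ψ : SmoothFn n M ℂ) : ip μ ψ ψ = ((ip μ ψ ψ).re : ℂ) := by
  rw [ip_self]; simp

theorem ip_self_pos {ψ : SmoothFn n M ℂ} (h : ip μ ψ ψ ≠ 0) : 0 < (ip μ ψ ψ).re := by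
  have h1 : 0 ≤ (ip μ ψ ψ).re := by
    rw [ip_self, Complex.ofReal_re]
    exact integral_nonneg fun x => sq_nonneg _
  refine h1.lt_of_ne fun h2 => h ?_
  rw [ip_self_re, ← h2, Complex.ofReal_zero]

variable (μ) in
/-- `ψ / ‖ψ‖`. -/
def normalize (ψ : SmoothFn n M ℂ) (h : ip μ ψ ψ ≠ 0) : Sphere n μ :=
  ⟨cmul ((√(ip μ ψ ψ).re)⁻¹ : ℝ) ψ, by
    have h1 := ip_self_pos h
    have h2 : ((√(ip μ ψ ψ).re : ℝ) : ℂ) ^ 2 = ip μ ψ ψ := by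
      rw [← Complex.ofReal_pow, Real.sq_sqrt h1.le, ← ip_self_re]
    have h3 : ((√(ip μ ψ ψ).re : ℝ) : ℂ) ≠ 0 := by
      rw [Complex.ofReal_ne_zero]; positivity
    rw [ip_cmul_left, ip_cmul_right, Complex.conj_ofReal, Complex.ofReal_inv]
    field_simp
    exact h2.symm⟩

theorem ip_eq_zero_of_self {φ ψ : SmoothFn n M ℂ} (h : ip μ ψ ψ = 0) : ip μ φ ψ = 0 := by
  have := isFiniteMeasure n μ
  have := isOpenPosMeasure n μ
  rw [eq_zero_of_ip_self μ h, ip_zero_right]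

theorem ip_add_orth (φ : Sphere n μ) (χ : orth μ φ) : ip μ φ.1 (φ.1 + χ.1) = 1 := by
  have := isFiniteMeasure n μ
  rw [ip_add_right, φ.2, mem_orth.1 χ.2, add_zero]

theorem ip_self_add_orth_ne_zero (φ : Sphere n μ) (χ : orth μ φ) :
    ip μ (φ.1 + χ.1) (φ.1 + χ.1) ≠ 0 := fun h => by
  have := ip_eq_zero_of_self (φ := φ.1) h
  rw [ip_add_orth] at this
  exact one_ne_zero this

/-- The inverse `χ ↦ [φ + χ]` of the affine coordinate. -/
def affineCoordInv (φ : Sphere n μ) (χ : orth μ φ) : Proj n μ :=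
  ⟦normalize μ (φ.1 + χ.1) (ip_self_add_orth_ne_zero φ χ)⟧

theorem affineCoord_affineCoordInv (φ' φ : Sphere n μ) (χ : orth μ φ) :
    affineCoord φ' (affineCoordInv φ χ) =
      orthMul φ' (ip μ φ'.1 (φ.1 + χ.1))⁻¹ (orthProj φ' (φ.1 + χ.1)) := by
  have h1 := ip_self_pos (ip_self_add_orth_ne_zero φ χ)
  have h3 : ((√(ip μ (φ.1 + χ.1) (φ.1 + χ.1)).re : ℝ) : ℂ) ≠ 0 := by
    rw [Complex.ofReal_ne_zero]; positivity
  change orthMul φ' (ip μ φ'.1 (cmul _ _))⁻¹ (orthProj φ' (cmul _ _)) = _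
  ext x
  simp only [coe_orthMul, coe_orthProj, ip_cmul_right, cmul_apply, ContMDiffMap.coe_add,
    Pi.add_apply, Complex.ofReal_inv]
  field_simp

theorem notOrthogonal_affineCoordInv (φ' φ : Sphere n μ) (χ : orth μ φ) :
    NotOrthogonal φ' (affineCoordInv φ χ) ↔ ip μ φ'.1 (φ.1 + χ.1) ≠ 0 := by
  have h1 := ip_self_pos (ip_self_add_orth_ne_zero φ χ)
  have h3 : ((√(ip μ (φ.1 + χ.1) (φ.1 + χ.1)).re : ℝ) : ℂ) ≠ 0 := by
    rw [Complex.ofReal_ne_zero]; positivity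
  change ip μ φ'.1 (cmul _ _) ≠ 0 ↔ _
  rw [ip_cmul_right, Complex.ofReal_inv]
  simp [h3]

theorem affineCoordInv_affineCoord (φ : Sphere n μ) {p : Proj n μ} (hp : NotOrthogonal φ p) :
    affineCoordInv φ (affineCoord φ p) = p := by
  induction p using Quotient.inductionOn with
  | _ ψ =>
  replace hp : ip μ φ.1 ψ.1 ≠ 0 := hp
  set c := ip μ φ.1 ψ.1 with hc
  have e : φ.1 + (affineCoord φ ⟦ψ⟧).1 = cmul c⁻¹ ψ.1 := by
    change φ.1 + (orthMul φ (ip μ φ.1 ψ.1)⁻¹ (orthProj φ ψ.1)).1 = _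
    ext x
    simp only [coe_orthMul, coe_orthProj, cmul_apply, ContMDiffMap.coe_add, Pi.add_apply, ← hc]
    field_simp
    ring
  refine Quotient.sound ?_
  have hn : (ip μ (cmul c⁻¹ ψ.1) (cmul c⁻¹ ψ.1)).re = (‖c‖ ^ 2)⁻¹ := by
    rw [ip_cmul_left, ip_cmul_right, ψ.2, mul_one, mul_comm, Complex.mul_conj,
      Complex.normSq_eq_norm_sq, Complex.ofReal_re, norm_inv, inv_pow]
  refine ⟨Complex.arg c, ?_⟩
  have hnc : (‖c‖ : ℂ) ≠ 0 := by simpa using hp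
  have hpol : (‖c‖ : ℂ) * Complex.exp (Complex.arg c * Complex.I) = c :=
    Complex.norm_mul_exp_arg_mul_I c
  ext x
  simp only [normalize, e, hn, cmul_cmul, cmul_apply, Real.sqrt_inv,
    Real.sqrt_sq (norm_nonneg c), inv_inv]
  calc ψ.1 x = c * c⁻¹ * ψ.1 x := by rw [mul_inv_cancel₀ hp, one_mul]
    _ = (‖c‖ * Complex.exp (Complex.arg c * Complex.I)) * c⁻¹ * ψ.1 x := by rw [hpol]
    _ = _ := by ring

/-- The affine chart of `PC^∞(M, ℂ)` at `[φ]`. -/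
def affineChart (φ : Sphere n μ) : OpenPartialHomeomorph (Proj n μ) (orth μ φ) where
  toFun := affineCoord φ
  invFun := affineCoordInv φ
  source := {p | NotOrthogonal φ p}
  target := univ
  map_source' _ _ := mem_univ _
  map_target' χ _ := by
    rw [mem_ofPred_eq, notOrthogonal_affineCoordInv, ip_add_orth]
    exact one_ne_zero
  left_inv' _ hp := affineCoordInv_affineCoord φ hp
  right_inv' χ _ := by
    rw [affineCoord_affineCoordInv, ip_add_orth]
    ext x
    simp only [coe_orthMul, coe_orthProj, ip_add_orth, cmul_apply, ContMDiffMap.coe_add,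
      Pi.add_apply]
    ring
  open_source := by
    have h : IsOpen {ψ : Sphere n μ | ip μ φ.1 ψ.1 ≠ 0} :=
      isOpen_ne.preimage ((continuous_ip_right φ.1).comp continuous_subtype_val)
    exact (isQuotientMap_quot_mk.isOpen_preimage (s := {p | NotOrthogonal φ p})).1 h
  open_target := isOpen_univ
  continuousOn_toFun := by
    have h : IsOpen {ψ : Sphere n μ | ip μ φ.1 ψ.1 ≠ 0} :=
      isOpen_ne.preimage ((continuous_ip_right φ.1).comp continuous_subtype_val)
    have h' := (isQuotientMap_quot_mk.isOpen_preimage (s := {p : Proj n μ | NotOrthogonal φ p})).1 h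
    refine (isQuotientMap_quot_mk.continuousOn_isOpen_iff h').2 ?_
    have c1 : ContinuousOn (fun ψ : Sphere n μ => (ip μ φ.1 ψ.1)⁻¹) {ψ | ip μ φ.1 ψ.1 ≠ 0} :=
      ((continuous_ip_right φ.1).comp continuous_subtype_val).continuousOn.inv₀ fun _ h => h
    have c2 : Continuous fun ψ : Sphere n μ => orthProj φ ψ.1 :=
      (orthProj φ).continuous.comp continuous_subtype_val
    exact ((Complex.continuous_re.comp_continuousOn c1).smul c2.continuousOn).add
      ((Complex.continuous_im.comp_continuousOn c1).smul
        ((orthI φ).continuous.comp c2).continuousOn)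
  continuousOn_invFun := by
    refine Continuous.continuousOn (continuous_quot_mk.comp (Continuous.subtype_mk ?_ _))
    have c1 : Continuous fun χ : orth μ φ => φ.1 + χ.1 :=
      continuous_const.add continuous_subtype_val
    have c2 : Continuous fun χ : orth μ φ => √(ip μ (φ.1 + χ.1) (φ.1 + χ.1)).re :=
      Real.continuous_sqrt.comp (Complex.continuous_re.comp (continuous_ip'.comp (c1.prodMk c1)))
    exact continuous_cmul.comp ((Complex.continuous_ofReal.comp (c2.inv₀ fun χ =>
      (Real.sqrt_pos.2 (ip_self_pos (ip_self_add_orth_ne_zero φ χ))).ne')).prodMk c1)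

theorem CkOn.re_ip {V : Type*} [AddCommGroup V] [Module ℝ V] [TopologicalSpace V] {k : ℕ}
    {f g : V → SmoothFn n M ℂ} {U : Set V} (hf : CkOn k f U) (hg : CkOn k g U) :
    CkOn k (fun y => (ip μ (f y) (g y)).re) U :=
  have := isFiniteMeasure n μ
  CkOn.bilin ((ipBilin μ).compr₂ Complex.reLm)
    (Complex.continuous_re.comp continuous_ip') k hf hg

theorem CkOn.im_ip {V : Type*} [AddCommGroup V] [Module ℝ V] [TopologicalSpace V] {k : ℕ}
    {f g : V → SmoothFn n M ℂ} {U : Set V} (hf : CkOn k f U) (hg : CkOn k g U) :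
    CkOn k (fun y => (ip μ (f y) (g y)).im) U :=
  have := isFiniteMeasure n μ
  CkOn.bilin ((ipBilin μ).compr₂ Complex.imLm)
    (Complex.continuous_im.comp continuous_ip') k hf hg

variable (n μ) in
/-- The smooth structure of `PC^∞(M, ℂ)`, given by the affine charts. -/
def projAtlas : SmoothAtlas (Proj n μ) (fun φ : Sphere n μ => orth μ φ) where
  chart := affineChart
  cover p := by
    induction p using Quotient.inductionOn with
    | _ ψ =>
    refine ⟨ψ, ?_⟩
    change ip μ ψ.1 ψ.1 ≠ 0
    rw [ψ.2]
    exact one_ne_zero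
  compat φ φ' k := by
    have := isFiniteMeasure n μ
    have e : (fun χ => affineChart φ' ((affineChart φ).symm χ)) = fun χ =>
        orthMul φ' (ip μ φ'.1 (φ.1 + χ.1))⁻¹ (orthProj φ' (φ.1 + χ.1)) :=
      funext fun χ => affineCoord_affineCoordInv φ' φ χ
    rw [e]
    set U := {y | y ∈ (affineChart φ).target ∧ (affineChart φ).symm y ∈ (affineChart φ').source}
      with hU
    have hne : ∀ χ ∈ U, ip μ φ'.1 (φ.1 + χ.1) ≠ 0 := fun χ hχ =>
      (notOrthogonal_affineCoordInv φ' φ χ).1 hχ.2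
    have h0 : CkOn k (fun χ : orth μ φ => φ.1 + χ.1) U :=
      CkOn.affine k φ.1 (orth μ φ).subtypeL U
    have hc : CkOn k (fun _ : orth μ φ => φ'.1) U := by
      simpa using CkOn.affine k φ'.1 (0 : orth μ φ →L[ℝ] SmoothFn n M ℂ) U
    have h1 : CkOn k (fun χ : orth μ φ => orthProj φ' (φ.1 + χ.1)) U := by
      simpa using CkOn.affine k (orthProj φ' φ.1) ((orthProj φ').comp (orth μ φ).subtypeL) U
    have h2 : CkOn k (fun χ : orth μ φ => orthI φ' (orthProj φ' (φ.1 + χ.1))) U := by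
      simpa using CkOn.affine k (orthI φ' (orthProj φ' φ.1))
        ((orthI φ').comp ((orthProj φ').comp (orth μ φ).subtypeL)) U
    have hre := CkOn.re_ip (μ := μ) hc h0
    have him := CkOn.im_ip (μ := μ) hc h0
    have hn := CkOn.inv k (fun χ hχ => by
      have := Complex.normSq_pos.2 (hne χ hχ)
      rw [Complex.normSq_apply] at this
      exact this.ne') (CkOn.add k (CkOn.mul k hre hre) (CkOn.mul k him him))
    have hm : CkOn k (fun _ : orth μ φ => (-1 : ℝ)) U := by
      simpa using CkOn.affine k (-1 : ℝ) (0 : orth μ φ →L[ℝ] ℝ) U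
    have h3 := CkOn.add k (CkOn.smul k (CkOn.mul k hre hn) h1)
      (CkOn.smul k (CkOn.mul k (CkOn.mul k hm him) hn) h2)
    convert h3 using 1
    funext χ
    simp only [orthMul, Complex.inv_re, Complex.inv_im, Complex.normSq_apply, div_eq_mul_inv,
      neg_one_mul]

end Projective

/-! ### The symplectic form of the projective space -/

section FubiniStudy

set_option linter.unusedSectionVars false

variable {n : ℕ} {M : Type*} [TopologicalSpace M] [ChartedSpace (Euc n) M]
  [IsManifold (𝓡 n) ∞ M] [CompactSpace M] [MeasurableSpace M] [BorelSpace M]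
  (μ : Measure M) [IsSmoothVolume n μ]

/-- The Fubini–Study Hermitian form
`⟨u, v⟩ / ⟨ψ, ψ⟩ - ⟨u, ψ⟩ ⟨ψ, v⟩ / ⟨ψ, ψ⟩²` in homogeneous coordinates. -/
def fsHermitian (ψ u v : SmoothFn n M ℂ) : ℂ :=
  ip μ u v / ip μ ψ ψ - ip μ u ψ * ip μ ψ v / ip μ ψ ψ ^ 2

variable {μ}

theorem fsHermitian_add_left (ψ u v w : SmoothFn n M ℂ) :
    fsHermitian μ ψ (u + v) w = fsHermitian μ ψ u w + fsHermitian μ ψ v w := by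
  have := isFiniteMeasure n μ
  simp only [fsHermitian, ip_add_left]
  ring

theorem fsHermitian_smul_left (ψ : SmoothFn n M ℂ) (r : ℝ) (v w : SmoothFn n M ℂ) :
    fsHermitian μ ψ (r • v) w = r * fsHermitian μ ψ v w := by
  simp only [fsHermitian, smul_eq_cmul, ip_cmul_left, Complex.conj_ofReal]
  ring

theorem fsHermitian_conj (ψ v w : SmoothFn n M ℂ) :
    conj (fsHermitian μ ψ v w) = fsHermitian μ ψ w v := by
  simp only [fsHermitian, map_sub, map_div₀, map_mul, map_pow, ip_conj]
  ring

/-- The form is homogeneous and vanishes in the direction of the fibres. -/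
theorem fsHermitian_invariant {ψ : SmoothFn n M ℂ} (h : ip μ ψ ψ ≠ 0) {c : ℂ} (hc : c ≠ 0)
    (a b : ℂ) (u v : SmoothFn n M ℂ) :
    fsHermitian μ (cmul c ψ) (cmul a ψ + cmul c u) (cmul b ψ + cmul c v)
      = fsHermitian μ ψ u v := by
  have := isFiniteMeasure n μ
  have hc' : conj c ≠ 0 := (map_ne_zero _).2 hc
  simp only [fsHermitian, ip_add_left, ip_add_right, ip_cmul_left, ip_cmul_right]
  field_simp
  ring

theorem fsHermitian_im (ψ u v : SmoothFn n M ℂ) :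
    (fsHermitian μ ψ u v).im = (ip μ ψ ψ).re⁻¹ * (ip μ u v).im
      + (-1) * (((ip μ ψ ψ).re⁻¹ * (ip μ ψ ψ).re⁻¹)
        * ((ip μ u ψ).re * (ip μ ψ v).im + (ip μ u ψ).im * (ip μ ψ v).re)) := by
  rw [fsHermitian, ip_self_re ψ]
  simp only [Complex.ofReal_re, div_eq_mul_inv, ← Complex.ofReal_pow, ← Complex.ofReal_inv,
    Complex.sub_im, Complex.mul_im, Complex.ofReal_im]
  ring

theorem hasDerivAt_ip {f g : ℝ → SmoothFn n M ℂ} {f' g' : SmoothFn n M ℂ}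
    (hf : HasDirDeriv f f' 0 1) (hg : HasDirDeriv g g' 0 1) :
    HasDerivAt (fun t => ip μ (f t) (g t)) (ip μ f' (g 0) + ip μ (f 0) g') 0 := by
  have := isFiniteMeasure n μ
  have h := hf.bilin (ipBilin μ) continuous_ip' hg
  have h' := hasDirDeriv_iff_hasDerivAt.1 h
  simp only [zero_add, smul_eq_mul, mul_one] at h'
  rw [add_comm] at h'
  rw [add_comm]
  exact h'

theorem hasDirDeriv_fsHermitian_im {φ : Sphere n μ} (x u v w : orth μ φ) {a : ℝ}
    (h : HasDirDeriv (fun y : orth μ φ => (fsHermitian μ (φ.1 + y.1) v.1 w.1).im) a x u) :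
    a = (- ip μ v.1 w.1 * (ip μ u.1 (φ.1 + x.1) + ip μ (φ.1 + x.1) u.1)
          / ip μ (φ.1 + x.1) (φ.1 + x.1) ^ 2
        - (ip μ v.1 u.1 * ip μ (φ.1 + x.1) w.1 + ip μ v.1 (φ.1 + x.1) * ip μ u.1 w.1)
          / ip μ (φ.1 + x.1) (φ.1 + x.1) ^ 2
        + 2 * (ip μ v.1 (φ.1 + x.1) * ip μ (φ.1 + x.1) w.1
          * (ip μ u.1 (φ.1 + x.1) + ip μ (φ.1 + x.1) u.1))
          / ip μ (φ.1 + x.1) (φ.1 + x.1) ^ 3).im := by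
  set ψ := φ.1 + x.1 with hψ
  have hA : ip μ ψ ψ ≠ 0 := ip_self_add_orth_ne_zero φ x
  let c : ℝ → SmoothFn n M ℂ := fun t => ψ + t • u.1
  have hc0 : c 0 = ψ := by simp [c]
  have hc : HasDirDeriv c u.1 0 1 := by
    simpa using hasDirDeriv_affine ψ (LinearMap.toSpanSingleton ℝ (SmoothFn n M ℂ) u.1) 0 1
  have hk : ∀ z : SmoothFn n M ℂ, HasDirDeriv (fun _ : ℝ => z) 0 0 1 := fun z =>
    hasDirDeriv_const z 0 1
  have d1 := hasDerivAt_ip (μ := μ) hc hc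
  have d2 := hasDerivAt_ip (μ := μ) (hk v.1) hc
  have d3 := hasDerivAt_ip (μ := μ) hc (hk w.1)
  have hA0 : ip μ (c 0) (c 0) ≠ 0 := by rwa [hc0]
  have d := (((hasDerivAt_const (0 : ℝ) (ip μ v.1 w.1)).div d1 hA0).sub
    ((d2.mul d3).div (d1.pow 2) (pow_ne_zero 2 hA0)))
  have z1 : ∀ z : SmoothFn n M ℂ, ip μ 0 z = 0 := fun z => by simp [ip]
  rw [hasDirDeriv_iff_hasDerivAt] at h
  have e : (fun t : ℝ => (fsHermitian μ (φ.1 + (x + t • u).1) v.1 w.1).im) =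
      fun t => (fsHermitian μ (c t) v.1 w.1).im := by
    funext t
    have : φ.1 + (x + t • u).1 = c t := by
      simp [c, hψ, add_assoc]
    rw [this]
  rw [e] at h
  have d' := Complex.imCLM.hasFDerivAt.comp_hasDerivAt (0 : ℝ) d
  have hu := h.unique d'
  rw [hu, Complex.imCLM_apply]
  congr 1
  simp only [hc0, z1, ip_zero_right, Pi.mul_apply, Pi.pow_apply]
  field_simp
  ring

variable (n μ) in
/-- The Fubini–Study symplectic form of `PC^∞(M, ℂ)`: the imaginary part of the Fubini–Study
Hermitian form. On tangent vectors `u`, `v` of the unit sphere it is `Im ⟨u, v⟩`. -/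
def fubiniStudyForm : SymplecticForm (projAtlas n μ) where
  form φ χ u v := (fsHermitian μ (φ.1 + χ.1) u.1 v.1).im
  add_left φ χ u v w := by
    rw [Submodule.coe_add, fsHermitian_add_left, Complex.add_im]
  smul_left φ χ c v w := by
    rw [Submodule.coe_smul, fsHermitian_smul_left, Complex.im_ofReal_mul]
  skew φ χ v w := by
    rw [← fsHermitian_conj, Complex.conj_im]
  smooth φ k := by
    let E := orth μ φ
    let p₀ : E × E × E →L[ℝ] SmoothFn n M ℂ :=
      (orth μ φ).subtypeL.comp (ContinuousLinearMap.fst ℝ E (E × E))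
    let p₁ : E × E × E →L[ℝ] SmoothFn n M ℂ := (orth μ φ).subtypeL.comp
      ((ContinuousLinearMap.fst ℝ E E).comp (ContinuousLinearMap.snd ℝ E (E × E)))
    let p₂ : E × E × E →L[ℝ] SmoothFn n M ℂ := (orth μ φ).subtypeL.comp
      ((ContinuousLinearMap.snd ℝ E E).comp (ContinuousLinearMap.snd ℝ E (E × E)))
    set U := ((projAtlas n μ).chart φ).target ×ˢ (univ : Set (E × E))
    have h0 : CkOn k (fun p : E × E × E => φ.1 + p.1.1) U := CkOn.affine k φ.1 p₀ U
    have h1 : CkOn k (fun p : E × E × E => p.2.1.1) U := by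
      simpa [p₁] using CkOn.affine k 0 p₁ U
    have h2 : CkOn k (fun p : E × E × E => p.2.2.1) U := by
      simpa [p₂] using CkOn.affine k 0 p₂ U
    have hm : CkOn k (fun _ : E × E × E => (-1 : ℝ)) U := by
      simpa using CkOn.affine k (-1 : ℝ) (0 : E × E × E →L[ℝ] ℝ) U
    have hi := CkOn.inv k (fun p (_ : p ∈ U) =>
      (ip_self_pos (ip_self_add_orth_ne_zero φ p.1)).ne') (CkOn.re_ip (μ := μ) h0 h0)
    have h := CkOn.add k (CkOn.mul k hi (CkOn.im_ip (μ := μ) h1 h2))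
      (CkOn.mul k hm (CkOn.mul k (CkOn.mul k hi hi) (CkOn.add k
        (CkOn.mul k (CkOn.re_ip (μ := μ) h1 h0) (CkOn.im_ip (μ := μ) h0 h2))
        (CkOn.mul k (CkOn.im_ip (μ := μ) h1 h0) (CkOn.re_ip (μ := μ) h0 h2)))))
    convert h using 1
    funext p
    exact fsHermitian_im _ _ _
  compat φ φ' χ hχ hχ' v w v' w' hv hw := by
    have hℓ : ip μ φ'.1 (φ.1 + χ.1) ≠ 0 := (notOrthogonal_affineCoordInv φ' φ χ).1 hχ'
    have := isFiniteMeasure n μ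
    set T : orth μ φ → orth μ φ' := fun y =>
      (projAtlas n μ).chart φ' (((projAtlas n μ).chart φ).symm y) with hT
    have hTy : ∀ y : orth μ φ, ip μ φ'.1 (φ.1 + y.1) ≠ 0 →
        cmul (ip μ φ'.1 (φ.1 + y.1)) (φ'.1 + (T y).1) = φ.1 + y.1 := by
      intro y hy
      have : T y = orthMul φ' (ip μ φ'.1 (φ.1 + y.1))⁻¹ (orthProj φ' (φ.1 + y.1)) :=
        affineCoord_affineCoordInv φ' φ y
      rw [this]
      ext x
      simp only [coe_orthMul, coe_orthProj, cmul_apply, ContMDiffMap.coe_add, Pi.add_apply]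
      field_simp
      ring
    let B : ℂ →ₗ[ℝ] SmoothFn n M ℂ →ₗ[ℝ] SmoothFn n M ℂ := LinearMap.mk₂ ℝ cmul
      (fun a b f => by ext x; simp [add_mul]) (fun r a f => by ext x; simp [mul_assoc])
      (fun a f g => by ext x; simp [mul_add]) (fun r a f => by ext x; simp [mul_left_comm])
    have key : ∀ (u : orth μ φ) (u' : orth μ φ'), HasDirDeriv T u' χ u →
        u.1 = cmul (ip μ φ'.1 u.1) (φ'.1 + (T χ).1) + cmul (ip μ φ'.1 (φ.1 + χ.1)) u'.1 := by
      intro u u' hu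
      have h1 : HasDirDeriv (fun y : orth μ φ => φ'.1 + (T y).1) u'.1 χ u := by
        have h := (hasDirDeriv_const φ'.1 χ u).add (hu.clm (orth μ φ').subtypeL)
        rw [zero_add] at h
        exact h
      have h2 : HasDirDeriv (fun y : orth μ φ => ip μ φ'.1 (φ.1 + y.1)) (ip μ φ'.1 u.1) χ u := by
        have h := hasDirDeriv_affine (ip μ φ'.1 φ.1)
          ((ipBilin μ φ'.1).comp (orth μ φ).subtype) χ u
        refine h.congr (ip_add_right μ _ _ _).symm (.of_forall fun t => ?_)
        exact (ip_add_right μ _ _ _).symm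
      have h3 := h2.bilin B continuous_cmul h1
      have h4 : HasDirDeriv (fun y : orth μ φ => φ.1 + y.1) u.1 χ u :=
        hasDirDeriv_affine φ.1 (orth μ φ).subtype χ u
      refine h4.unique (h3.congr (hTy χ hℓ) ?_)
      have hO : IsOpen {y : orth μ φ | ip μ φ'.1 (φ.1 + y.1) ≠ 0} :=
        isOpen_ne.preimage ((continuous_ip_right φ'.1).comp
          (continuous_const.add continuous_subtype_val))
      exact (eventually_mem_line hO hℓ u).mono fun t ht => hTy _ ht
    have hn : ip μ (φ'.1 + (T χ).1) (φ'.1 + (T χ).1) ≠ 0 := ip_self_add_orth_ne_zero φ' (T χ)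
    have := fsHermitian_invariant hn hℓ (ip μ φ'.1 v.1) (ip μ φ'.1 w.1) v'.1 w'.1
    rw [← key v v' hv, ← key w w' hw, hTy χ hℓ] at this
    exact congrArg Complex.im this.symm
  closed φ χ _ u v w a b c ha hb hc := by
    rw [hasDirDeriv_fsHermitian_im χ u v w ha, hasDirDeriv_fsHermitian_im χ v w u hb,
      hasDirDeriv_fsHermitian_im χ w u v hc, ← Complex.add_im, ← Complex.add_im,
      ← Complex.conj_eq_iff_im]
    simp only [map_add, map_sub, map_div₀, map_mul, map_neg, map_pow, ip_conj, Complex.conj_ofNat]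
    ring
  nondegenerate φ χ _ u h := by
    have := isFiniteMeasure n μ
    have := isOpenPosMeasure n μ
    have hA : ip μ (φ.1 + χ.1) (φ.1 + χ.1) ≠ 0 := ip_self_add_orth_ne_zero φ χ
    have hφ : ip μ φ.1 (φ.1 + χ.1) = 1 := ip_add_orth φ χ
    set ψ := φ.1 + χ.1
    have h1 : (fsHermitian μ ψ u.1 (cmul Complex.I u.1)).im = 0 := h (orthI φ u)
    set r := u.1 + cmul (-(ip μ ψ u.1 / ip μ ψ ψ)) ψ with hr
    have e : ip μ r r = ip μ ψ ψ * fsHermitian μ ψ u.1 u.1 := by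
      simp only [hr, fsHermitian, ip_add_left, ip_add_right, ip_cmul_left, ip_cmul_right, map_neg,
        map_div₀, ip_conj]
      field_simp
      ring
    have e2 : fsHermitian μ ψ u.1 (cmul Complex.I u.1) = Complex.I * fsHermitian μ ψ u.1 u.1 := by
      simp only [fsHermitian, ip_cmul_right]
      ring
    rw [e2, Complex.I_mul_im] at h1
    have e3 : fsHermitian μ ψ u.1 u.1 = 0 :=
      Complex.ext h1 (Complex.conj_eq_iff_im.1 (fsHermitian_conj ψ u.1 u.1))
    rw [e3, mul_zero] at e
    have h0 := eq_zero_of_ip_self μ e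
    have h2 : ip μ φ.1 r = 0 := by rw [h0, ip_zero_right]
    rw [hr, ip_add_right, ip_cmul_right, hφ, mem_orth.1 u.2, zero_add, mul_one] at h2
    rw [hr, h2] at h0
    ext x
    simpa using DFunLike.congr_fun h0 x

end FubiniStudy

/-! ### The Madelung transform -/

section MadelungTransform

set_option linter.unusedSectionVars false

variable (n : ℕ) {M : Type*} [TopologicalSpace M] [ChartedSpace (Euc n) M]
  [IsManifold (𝓡 n) ∞ M] [CompactSpace M] [MeasurableSpace M] [BorelSpace M]
  (μ : Measure M) [IsSmoothVolume n μ]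

variable {n} in
/-- The Madelung transform `(ρ, θ) ↦ √(ρ e^{iθ}) = √ρ e^{iθ/2}` of functions, `ρ > 0`. -/
def madelungFn (ρ θ : SmoothFn n M ℝ) (hρ : ∀ x, 0 < ρ x) : SmoothFn n M ℂ :=
  ⟨fun x => (√(ρ x) : ℂ) * Complex.exp (Complex.I * (θ x / 2 : ℝ)), by
    have h1 : ContMDiff (𝓡 n) 𝓘(ℝ, ℝ) ∞ fun x => √(ρ x) := fun x =>
      ((Real.contDiffAt_sqrt (hρ x).ne').contMDiffAt).comp x (ρ.contMDiff x)
    have h2 : ContDiff ℝ ∞ fun p : ℝ × ℝ => (p.1 : ℂ) * Complex.exp (Complex.I * (p.2 / 2 : ℝ)) := by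
      have := Complex.ofRealCLM.contDiff (n := ∞)
      exact (this.comp contDiff_fst).mul
        ((contDiff_const.mul (this.comp (contDiff_snd.div_const 2))).cexp)
    exact h2.contMDiff.comp (h1.prodMk_space θ.contMDiff)⟩

variable {n} in
theorem madelungFn_apply (ρ θ : SmoothFn n M ℝ) (hρ : ∀ x, 0 < ρ x) (x : M) :
    madelungFn ρ θ hρ x = (√(ρ x) : ℂ) * Complex.exp (Complex.I * (θ x / 2 : ℝ)) := rfl

theorem ip_madelungFn (ρ : Dens n μ) (θ : SmoothFn n M ℝ) :
    ip μ (madelungFn ρ.1 θ ρ.2.1) (madelungFn ρ.1 θ ρ.2.1) = 1 := by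
  have h : ∀ x, ‖madelungFn ρ.1 θ ρ.2.1 x‖ ^ 2 = ρ.1 x := fun x => by
    rw [madelungFn_apply, norm_mul, mul_comm Complex.I, Complex.norm_exp_ofReal_mul_I,
      Complex.norm_real, mul_one, Real.norm_eq_abs, sq_abs, Real.sq_sqrt (ρ.2.1 x).le]
  rw [ip_self]
  simp only [h, ρ.2.2, Complex.ofReal_one]

/-- The induced map `T*Dens(M) → PC^∞(M, ℂ)`, `(ρ, [θ]) ↦ [√ρ e^{iθ/2}]`. -/
def madelung (z : CotangentDens n μ) : Proj n μ :=
  Quotient.liftOn z.2 (fun θ => (⟦⟨madelungFn z.1.1 θ z.1.2.1, ip_madelungFn n μ z.1 θ⟩⟧ : Proj n μ)) <| by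
    intro θ θ' h
    obtain ⟨c, hc⟩ := (Submodule.quotientRel_def _).1 h
    refine Quotient.sound ⟨-c / 2, ?_⟩
    ext x
    have : θ' x = θ x - c := by
      rw [← hc x]
      exact (sub_sub_cancel (θ x) (θ' x)).symm
    rw [cmul_apply, madelungFn_apply, madelungFn_apply, this, mul_left_comm, ← Complex.exp_add]
    congr 2
    push_cast
    ring

/-- `PC^∞(M, ℂ ∖ {0})`: the classes of nowhere vanishing functions. -/
def nonvanishing : Set (Proj n μ) :=
  {p | ∃ ψ : Sphere n μ, ⟦ψ⟧ = p ∧ ∀ x, ψ.1 x ≠ 0}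

/-- A nowhere vanishing function as a continuous map into `ℂ ∖ {0}`. -/
def toPunctured {n : ℕ} {M : Type*} [TopologicalSpace M] [ChartedSpace (Euc n) M]
    (ψ : SmoothFn n M ℂ) (h : ∀ x, ψ x ≠ 0) : C(M, {z : ℂ // z ≠ 0}) :=
  ⟨fun x => ⟨ψ x, h x⟩, ψ.contMDiff.continuous.subtype_mk _⟩

/-- The classes of nowhere vanishing functions which are null-homotopic as maps into `ℂ ∖ {0}`. -/
def nullhomotopic : Set (Proj n μ) :=
  {p | ∃ (ψ : Sphere n μ) (h : ∀ x, ψ.1 x ≠ 0), ⟦ψ⟧ = p ∧ (toPunctured ψ.1 h).Nullhomotopic}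

end MadelungTransform

end Madelung

end

/-! Up to normalisation the Madelung transform is an exponential: `√ρ e^{iθ/2} = exp((log ρ +
iθ)/2)`. Its inverse is a logarithm: if `ψ = exp L` has norm one, then `ρ = |ψ|²` and `θ = 2 Im L`
modulo constants. Both directions are thus built from continuous linear and bilinear maps and from
pointwise composition `f ↦ g ∘ f` with a smooth `g`.

The analytic core is therefore `CkOn.smoothComp`: composition with `g`, smooth on a convex open set
`O`, is of class `C^k` on functions with values in `O`, with derivative `a ↦ Dg(f) a`. It rests on
the formula `t⁻¹ (g(f + t w) - g(f)) = ∫₀¹ Dg(f + s t w) w ds`, whose right side makes sense for `t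
= 0` and is continuous in `(t, w)` for the Fréchet topology (`continuousOn_diffQuot`). That topology
is handled through `continuous_iff_jointCk`: a family of functions is continuous in its parameter if
and only if all its chart derivatives are jointly continuous in parameter and point.

The image is governed by the covering `exp : ℂ → ℂ ∖ {0}`. A nowhere vanishing `ψ` is null-homotopic
if and only if it has a continuous logarithm (`nullhomotopic_iff_exists_log`), which is then smooth;
on a simply connected `M` a logarithm always exists. Functions close to `exp L` again have a
logarithm, depending smoothly on the function, which gives at once that the image is open and that
the inverse is smooth. Injectivity holds because `|ψ|` determines `ρ`, and two phases of the same
function differ by a continuous function with values in a discrete set, hence by a constant on the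
connected `M`.

For the pull-back, the derivative of the transform in the direction `(h, θ)` is `u = (h/(2ρ) + iθ/2)
ψ` (`exists_hasDirDeriv_madelungModel`). Since `|ψ|² = ρ`, the density cancels in `4 Im(ū u') = h θ'
- h' θ`, which is the canonical form after integration. The second term of the Fubini–Study form
drops out: `Re ⟨ψ, u⟩ = ½ ∫ h = 0`, so `⟨u, ψ⟩ ⟨ψ, u'⟩` is a product of two imaginary numbers. The
passage from affine charts to homogeneous coordinates is `fsHermitian_invariant`. -/

noncomputable section

namespace Madelung

/-! ### Families of smooth functions depending continuously on a parameter -/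

section JointCk

open scoped unitInterval

variable {Z : Type*} [TopologicalSpace Z] {E F G : Type} [NormedAddCommGroup E] [NormedSpace ℝ E]
  [NormedAddCommGroup F] [NormedSpace ℝ F] [NormedAddCommGroup G] [NormedSpace ℝ G]

/-- The derivatives of order at most `k` of `h z` are continuous on `U`, jointly in the point and
the parameter `z`. -/
def JointCk (k : ℕ) (h : Z → E → F) (U : Set E) : Prop :=
  ∀ j ≤ k, ContinuousOn (fun p : Z × E => iteratedFDeriv ℝ j (h p.1) p.2) (univ ×ˢ U)

theorem jointCk_zero {h : Z → E → F} {U : Set E} :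
    JointCk 0 h U ↔ ContinuousOn (fun p : Z × E => h p.1 p.2) (univ ×ˢ U) := by
  have e : (fun p : Z × E => iteratedFDeriv ℝ 0 (h p.1) p.2) =
      (continuousMultilinearCurryFin0 ℝ E F).symm ∘ fun p : Z × E => h p.1 p.2 := by
    funext p
    rw [iteratedFDeriv_zero_eq_comp]
    rfl
  simp only [JointCk, Nat.le_zero, forall_eq, e]
  exact (continuousMultilinearCurryFin0 ℝ E F).symm.toHomeomorph.comp_continuousOn_iff _ _

/-- Currying identifies `D^{j+1} h` with `D^j (Dh)` isometrically. This recursion is what the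
inductions below run on; the target space must vary in them, since it changes from `F` to `E →L[ℝ]
F`. -/
theorem jointCk_succ {k : ℕ} {h : Z → E → F} {U : Set E} :
    JointCk (k + 1) h U ↔ JointCk 0 h U ∧ JointCk k (fun z => fderiv ℝ (h z)) U := by
  have e : ∀ j, ContinuousOn (fun p : Z × E => iteratedFDeriv ℝ (j + 1) (h p.1) p.2) (univ ×ˢ U) ↔
      ContinuousOn (fun p : Z × E => iteratedFDeriv ℝ j (fderiv ℝ (h p.1)) p.2) (univ ×ˢ U) := by
    intro j
    have : (fun p : Z × E => iteratedFDeriv ℝ (j + 1) (h p.1) p.2) =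
        (continuousMultilinearCurryRightEquiv' ℝ j E F).symm ∘
          fun p : Z × E => iteratedFDeriv ℝ j (fderiv ℝ (h p.1)) p.2 := by
      funext p
      rw [iteratedFDeriv_succ_eq_comp_right]
      rfl
    rw [this]
    exact (continuousMultilinearCurryRightEquiv' ℝ j E F).symm.toHomeomorph.comp_continuousOn_iff
      _ _
  constructor
  · intro H
    refine ⟨fun j hj => H j (by omega), fun j hj => (e j).1 (H _ (by omega))⟩
  · rintro ⟨H0, H⟩ j hj
    cases j with
    | zero => exact H0 0 le_rfl
    | succ j => exact (e j).2 (H j (by omega))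

theorem JointCk.mono {k m : ℕ} {h : Z → E → F} {U : Set E} (H : JointCk k h U) (hm : m ≤ k) :
    JointCk m h U := fun j hj => H j (hj.trans hm)

theorem JointCk.congr {k : ℕ} {h h' : Z → E → F} {U : Set E} (hU : IsOpen U) (H : JointCk k h U)
    (e : ∀ z, EqOn (h' z) (h z) U) : JointCk k h' U := fun j hj =>
  (H j hj).congr fun p hp => by
    have : h' p.1 =ᶠ[𝓝 p.2] h p.1 := by
      filter_upwards [hU.mem_nhds hp.2] with y hy using e p.1 hy
    exact (this.iteratedFDeriv ℝ j).self_of_nhds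

theorem JointCk.clm {k : ℕ} {h : Z → E → F} {U : Set E} (hU : IsOpen U)
    (hs : ∀ z, ContDiffOn ℝ ∞ (h z) U) (L : F →L[ℝ] G) (H : JointCk k h U) :
    JointCk k (fun z y => L (h z y)) U := fun j hj => by
  refine ((ContinuousLinearMap.compContinuousMultilinearMapL ℝ (fun _ : Fin j => E) F G L
    ).continuous.comp_continuousOn (H j hj)).congr fun p hp => ?_
  exact L.iteratedFDeriv_comp_left ((hs p.1).contDiffAt (hU.mem_nhds hp.2)) (mod_cast le_top)

theorem differentiableAt_of_smooth {f : E → F} {U : Set E} (hU : IsOpen U)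
    (hs : ContDiffOn ℝ ∞ f U) {y : E} (hy : y ∈ U) : DifferentiableAt ℝ f y :=
  (hs.contDiffAt (hU.mem_nhds hy)).differentiableAt (by simp)

theorem contDiffOn_fderiv {f : E → F} {U : Set E} (hU : IsOpen U)
    (hs : ContDiffOn ℝ ∞ f U) : ContDiffOn ℝ ∞ (fderiv ℝ f) U :=
  hs.fderiv_of_isOpen hU (by simp)

theorem JointCk.prodMk {U : Set E} (hU : IsOpen U) : ∀ (k : ℕ) {F G : Type}
    [NormedAddCommGroup F] [NormedSpace ℝ F] [NormedAddCommGroup G] [NormedSpace ℝ G]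
    {h : Z → E → F} {h' : Z → E → G}, (∀ z, ContDiffOn ℝ ∞ (h z) U) →
    (∀ z, ContDiffOn ℝ ∞ (h' z) U) → JointCk k h U → JointCk k h' U →
    JointCk k (fun z y => (h z y, h' z y)) U
  | 0, _, _, _, _, _, _, _, _, _, _, H, H' => by
    rw [jointCk_zero] at *
    exact H.prodMk H'
  | k + 1, F, G, _, _, _, _, h, h', hs, hs', H, H' => by
    have H0 := JointCk.prodMk hU 0 hs hs' (H.mono (Nat.zero_le _)) (H'.mono (Nat.zero_le _))
    have H1 := JointCk.prodMk hU k (fun z => contDiffOn_fderiv hU (hs z))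
      (fun z => contDiffOn_fderiv hU (hs' z)) (jointCk_succ.1 H).2 (jointCk_succ.1 H').2
    refine jointCk_succ.2 ⟨H0, ?_⟩
    -- The derivative of a pair is the pair of derivatives, up to the linear isometry `(E →L F) × (E
    -- →L G) ≃ (E →L F × G)`.
    refine JointCk.congr hU (JointCk.clm hU
      (fun z => (contDiffOn_fderiv hU (hs z)).prodMk (contDiffOn_fderiv hU (hs' z)))
      (ContinuousLinearMap.prodₗᵢ (𝕜 := ℝ) (E := E) (F := F) (G := G) ℝ
        ).toContinuousLinearEquiv.toContinuousLinearMap H1) fun z y hy => ?_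
    exact (differentiableAt_of_smooth hU (hs z) hy).fderiv_prodMk
      (differentiableAt_of_smooth hU (hs' z) hy)

/-- By the chain rule the derivative is `(Dg ∘ h) · Dh`. The induction hypothesis is used twice: for
`Dg ∘ h`, and for the smooth bilinear map "composition of linear maps" applied to the pair `(Dg ∘ h,
Dh)`. -/
theorem JointCk.comp {U : Set E} (hU : IsOpen U) : ∀ (k : ℕ) {F G : Type}
    [NormedAddCommGroup F] [NormedSpace ℝ F] [NormedAddCommGroup G] [NormedSpace ℝ G]
    {g : F → G} {O : Set F} {h : Z → E → F}, IsOpen O → ContDiffOn ℝ ∞ g O →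
    (∀ z, ContDiffOn ℝ ∞ (h z) U) → (∀ z, MapsTo (h z) U O) → JointCk k h U →
    JointCk k (fun z y => g (h z y)) U
  | 0, _, _, _, _, _, _, _, _, _, _, hg, _, hm, H => by
    rw [jointCk_zero] at *
    exact hg.continuousOn.comp H fun p hp => hm p.1 hp.2
  | k + 1, F, G, _, _, _, _, g, O, h, hO, hg, hs, hm, H => by
    have H0 := JointCk.comp hU 0 hO hg hs hm (H.mono (Nat.zero_le _))
    have H1 := JointCk.comp hU k hO (contDiffOn_fderiv hO hg) hs hm (H.mono (Nat.le_succ k))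
    have s1 := fun z => (contDiffOn_fderiv hO hg).comp (hs z) (hm z)
    have s2 := fun z => contDiffOn_fderiv hU (hs z)
    have H2 := JointCk.prodMk hU k s1 s2 H1 (jointCk_succ.1 H).2
    have hB : ContDiff ℝ ∞ fun p : (F →L[ℝ] G) × (E →L[ℝ] F) => p.1.comp p.2 :=
      isBoundedBilinearMap_comp.contDiff
    refine jointCk_succ.2 ⟨H0, ?_⟩
    refine JointCk.congr hU (JointCk.comp hU k isOpen_univ hB.contDiffOn
      (fun z => (s1 z).prodMk (s2 z)) (fun z => mapsTo_univ _ _) H2) fun z y hy => ?_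
    exact fderiv_comp y (differentiableAt_of_smooth hO hg (hm z hy))
      (differentiableAt_of_smooth hU (hs z) hy)

/-- Currying turns `f` into a continuous map to `C(I, F)`, on which integration is continuous
because `I` is compact; no condition on `X` is needed. -/
theorem continuous_integral_unitInterval {X : Type*} [TopologicalSpace X] {f : X × I → F}
    (hf : Continuous f) : Continuous fun x => ∫ s : I, f (x, s) :=
  (integralCLM (volume : Measure I)).continuous.comp (ContinuousMap.curry ⟨f, hf⟩).continuous

/-- Differentiation under the integral sign: the derivative is continuous on the compact set `I ×
K`, with `K` a compact neighbourhood of `y`, so a constant dominates it. -/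
theorem JointCk.hasFDerivAt_integral [LocallyCompactSpace E] {h : Z × I → E → F} {U : Set E}
    (hU : IsOpen U) (hs : ∀ z, ContDiffOn ℝ ∞ (h z) U) (H : JointCk 1 h U) (z : Z) {y : E}
    (hy : y ∈ U) :
    HasFDerivAt (fun y => ∫ s, h (z, s) y) (∫ s, fderiv ℝ (h (z, s)) y) y := by
  obtain ⟨K, hK, hKU, hKc⟩ := local_compact_nhds (hU.mem_nhds hy)
  have c0 := jointCk_zero.1 (H.mono zero_le_one)
  have c1 := jointCk_zero.1 (jointCk_succ.1 H).2
  have c0' : ∀ y ∈ U, Continuous fun s : I => h (z, s) y := fun y hy =>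
    c0.comp_continuous (f := fun s : I => ((z, s), y)) (by fun_prop) fun s => ⟨trivial, hy⟩
  have c1' : Continuous fun s : I => fderiv ℝ (h (z, s)) y :=
    c1.comp_continuous (f := fun s : I => ((z, s), y)) (by fun_prop) fun s => ⟨trivial, hy⟩
  have c2 : ContinuousOn (fun p : I × E => fderiv ℝ (h (z, p.1)) p.2) (univ ×ˢ K) :=
    c1.comp (f := fun p : I × E => ((z, p.1), p.2)) (by fun_prop) fun p hp => ⟨trivial, hKU hp.2⟩
  obtain ⟨C, hC⟩ := ((isCompact_univ (X := I)).prod hKc).exists_bound_of_continuousOn c2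
  refine hasFDerivAt_integral_of_dominated_of_fderiv_le (μ := (volume : Measure I)) (𝕜 := ℝ)
    (F := fun y s => h (z, s) y) (F' := fun y s => fderiv ℝ (h (z, s)) y)
    (bound := fun _ => C) hK ?_ ?_ ?_ ?_
    (integrable_const C) ?_
  · filter_upwards [hU.mem_nhds hy] with y hy
    exact (c0' y hy).aestronglyMeasurable_of_compactSpace
  · exact integrable_cont volume ⟨_, c0' y hy⟩
  · exact (integrable_cont volume ⟨_, c1'⟩).aestronglyMeasurable
  · exact .of_forall fun s y hy => hC (s, y) ⟨trivial, hy⟩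
  · exact .of_forall fun s y hy => (differentiableAt_of_smooth hU (hs (z, s)) (hKU hy)).hasFDerivAt

theorem JointCk.integral [LocallyCompactSpace E] {U : Set E} (hU : IsOpen U) : ∀ (k : ℕ) {F : Type}
    [NormedAddCommGroup F] [NormedSpace ℝ F] {h : Z × I → E → F},
    (∀ z, ContDiffOn ℝ ∞ (h z) U) → JointCk k h U → JointCk k (fun z y => ∫ s, h (z, s) y) U
  | 0, F, _, _, h, hs, H => by
    rw [jointCk_zero, continuousOn_iff_continuous_domRestrict] at *
    let q : ((univ ×ˢ U : Set (Z × E)) × I) → (univ ×ˢ U : Set ((Z × I) × E)) :=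
      fun p => ⟨((p.1.1.1, p.2), p.1.1.2), trivial, p.1.2.2⟩
    have hq : Continuous q := by fun_prop
    exact continuous_integral_unitInterval (H.comp hq)
  | k + 1, F, _, _, h, hs, H => by
    have H0 := JointCk.integral hU 0 hs (H.mono (Nat.zero_le _))
    have H1 := JointCk.integral hU k (fun z => contDiffOn_fderiv hU (hs z)) (jointCk_succ.1 H).2
    refine jointCk_succ.2 ⟨H0, H1.congr hU fun z y hy => ?_⟩
    exact (JointCk.hasFDerivAt_integral hU hs (H.mono (by omega)) z hy).fderiv

end JointCk

/-! ### Composition with smooth functions as a smooth map of function spaces -/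

section SmoothComp

set_option linter.unusedSectionVars false

open scoped unitInterval

variable {n : ℕ} {M : Type*} [TopologicalSpace M] [ChartedSpace (Euc n) M]
  [IsManifold (𝓡 n) ∞ M] {Z : Type*} [TopologicalSpace Z]
  {F G H : Type} [NormedAddCommGroup F] [NormedSpace ℝ F]
  [NormedAddCommGroup G] [NormedSpace ℝ G] [NormedAddCommGroup H] [NormedSpace ℝ H]

theorem contDiffOn_chart (f : SmoothFn n M F) (x : M) :
    ContDiffOn ℝ ∞ (f ∘ (extChartAt (𝓡 n) x).symm) (extChartAt (𝓡 n) x).target := fun _ hy =>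
  (contDiffAt_chart f x hy).contDiffWithinAt

/-- The target of a chart is locally compact, so continuity into the space of continuous functions
with the compact-open topology is the same as joint continuity. This removes the Fréchet topology
from all later arguments. -/
theorem continuous_iff_jointCk {f : Z → SmoothFn n M F} :
    Continuous f ↔ ∀ (x : M) (k : ℕ),
      JointCk k (fun z => f z ∘ (extChartAt (𝓡 n) x).symm) (extChartAt (𝓡 n) x).target := by
  rw [continuous_iff_chartDeriv]
  have key : ∀ (x : M) (k : ℕ), Continuous (fun z => chartDeriv F x k (f z)) ↔
      ContinuousOn (fun p : Z × Euc n =>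
        iteratedFDeriv ℝ k (f p.1 ∘ (extChartAt (𝓡 n) x).symm) p.2)
        (univ ×ˢ (extChartAt (𝓡 n) x).target) := by
    intro x k
    have : LocallyCompactSpace (extChartAt (𝓡 n) x).target :=
      (isOpen_extChartAt_target x).locallyCompactSpace
    rw [continuousOn_iff_continuous_domRestrict]
    constructor
    · intro h
      have h1 := ContinuousMap.continuous_uncurry_of_continuous ⟨_, h⟩
      let q : (univ ×ˢ (extChartAt (𝓡 n) x).target : Set (Z × Euc n)) →
        Z × (extChartAt (𝓡 n) x).target := fun p => (p.1.1, ⟨p.1.2, p.2.2⟩)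
      have hq : Continuous q := by fun_prop
      exact h1.comp hq
    · intro h
      refine ContinuousMap.continuous_of_continuous_uncurry _ ?_
      let q : Z × (extChartAt (𝓡 n) x).target →
        (univ ×ˢ (extChartAt (𝓡 n) x).target : Set (Z × Euc n)) := fun p =>
          ⟨(p.1, p.2.1), trivial, p.2.2⟩
      have hq : Continuous q := by fun_prop
      exact h.comp hq
  simp only [key]
  exact ⟨fun h x k j _ => h x j, fun h x k => h x k k le_rfl⟩

theorem continuous_of_comp {g : F → G} {O : Set F} (hO : IsOpen O) (hg : ContDiffOn ℝ ∞ g O)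
    {f : Z → SmoothFn n M F} {h : Z → SmoothFn n M G} (hf : Continuous f)
    (hm : ∀ z x, f z x ∈ O) (e : ∀ z x, h z x = g (f z x)) : Continuous h := by
  rw [continuous_iff_jointCk] at hf ⊢
  intro x k
  refine (JointCk.comp (isOpen_extChartAt_target x) k hO hg
    (fun z => contDiffOn_chart (f z) x) (fun z y _ => hm z _) (hf x k)).congr
    (isOpen_extChartAt_target x) fun z y _ => e z _

theorem continuous_of_integral {K : Z × I → SmoothFn n M F} {J : Z → SmoothFn n M F}
    (hK : Continuous K) (e : ∀ z x, J z x = ∫ s, K (z, s) x) : Continuous J := by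
  rw [continuous_iff_jointCk] at hK ⊢
  intro x k
  refine (JointCk.integral (isOpen_extChartAt_target x) k
    (fun z => contDiffOn_chart (K z) x) (hK x k)).congr
    (isOpen_extChartAt_target x) fun z y _ => e z _

/-- The function `x ↦ (f x, g x)`. -/
def pairFn (f : SmoothFn n M F) (g : SmoothFn n M G) : SmoothFn n M (F × G) :=
  postcomp (.inl ℝ F G) f + postcomp (.inr ℝ F G) g

theorem pairFn_apply (f : SmoothFn n M F) (g : SmoothFn n M G) (x : M) :
    pairFn f g x = (f x, g x) := by
  simp [pairFn]

theorem continuous_pairFn :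
    Continuous fun p : SmoothFn n M F × SmoothFn n M G => pairFn p.1 p.2 :=
  ((postcomp _).continuous.comp continuous_fst).add ((postcomp _).continuous.comp continuous_snd)

/-- The bilinear map `(f, g) ↦ B(f, g)` of function spaces, taken pointwise. -/
def bilinFn (B : F →L[ℝ] G →L[ℝ] H) : SmoothFn n M F →ₗ[ℝ] SmoothFn n M G →ₗ[ℝ] SmoothFn n M H :=
  LinearMap.mk₂ ℝ (fun f g => ⟨fun x => B (f x) (g x),
      (B.isBoundedBilinearMap.contDiff (n := ∞)).contMDiff.comp
        (f.contMDiff.prodMk_space g.contMDiff)⟩)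
    (fun _ _ _ => ContMDiffMap.ext fun _ => B.map_add₂ _ _ _)
    (fun _ _ _ => ContMDiffMap.ext fun _ => B.map_smul₂ _ _ _)
    (fun _ _ _ => ContMDiffMap.ext fun _ => (B _).map_add _ _)
    (fun _ _ _ => ContMDiffMap.ext fun _ => (B _).map_smul _ _)

@[simp] theorem bilinFn_apply (B : F →L[ℝ] G →L[ℝ] H) (f : SmoothFn n M F) (g : SmoothFn n M G)
    (x : M) : bilinFn B f g x = B (f x) (g x) := rfl

theorem continuous_bilinFn (B : F →L[ℝ] G →L[ℝ] H) :
    Continuous fun p : SmoothFn n M F × SmoothFn n M G => bilinFn B p.1 p.2 :=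
  continuous_of_comp (g := fun q : F × G => B q.1 q.2) isOpen_univ
    B.isBoundedBilinearMap.contDiff.contDiffOn continuous_pairFn (fun _ _ => trivial)
    fun p x => by rw [pairFn_apply, bilinFn_apply]

open Classical in
/-- The composition `g ∘ f` if it is smooth. -/
def smoothComp (g : F → G) (f : SmoothFn n M F) : SmoothFn n M G :=
  if h : ContMDiff (𝓡 n) 𝓘(ℝ, G) ∞ (fun x => g (f x)) then ⟨_, h⟩ else 0

theorem smoothComp_apply {g : F → G} {O : Set F} (hO : IsOpen O) (hg : ContDiffOn ℝ ∞ g O)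
    {f : SmoothFn n M F} (hf : ∀ x, f x ∈ O) (x : M) : smoothComp g f x = g (f x) := by
  have h : ContMDiff (𝓡 n) 𝓘(ℝ, G) ∞ (fun x => g (f x)) := fun x =>
    ((hg.contDiffAt (hO.mem_nhds (hf x))).contMDiffAt).comp x (f.contMDiff x)
  have e : smoothComp g f = (⟨_, h⟩ : SmoothFn n M G) := dif_pos h
  rw [e]
  rfl

theorem continuousOn_smoothComp {g : F → G} {O : Set F} (hO : IsOpen O) (hg : ContDiffOn ℝ ∞ g O)
    {f : Z → SmoothFn n M F} {S : Set Z} (hf : ContinuousOn f S) (hm : ∀ z ∈ S, ∀ x, f z x ∈ O) :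
    ContinuousOn (fun z => smoothComp g (f z)) S := by
  rw [continuousOn_iff_continuous_domRestrict] at *
  exact continuous_of_comp hO hg hf (fun z => hm z.1 z.2)
    fun z x => smoothComp_apply hO hg (hm z.1 z.2) x

theorem isOpen_mapsTo [CompactSpace M] {O : Set F} (hO : IsOpen O) :
    IsOpen {f : SmoothFn n M F | ∀ x, f x ∈ O} := by
  have h := (ContinuousMap.isOpen_setOfPred_mapsTo (X := M) isCompact_univ hO).preimage
    (continuous_toCont (n := n) (F := F))
  convert h using 1
  ext f
  exact ⟨fun hf x _ => hf x, fun hf x => hf (mem_univ x)⟩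

/-- The fundamental theorem of calculus along the segment from `a` to `a + b`, which stays in `O` by
convexity. The integral is taken over the type `I` to match `continuous_of_integral`. -/
theorem sub_eq_integral_fderiv [CompleteSpace G] {g : F → G} {O : Set F} (hO : IsOpen O)
    (hc : Convex ℝ O) (hg : ContDiffOn ℝ ∞ g O) {a b : F} (ha : a ∈ O) (hb : a + b ∈ O) :
    g (a + b) - g a = ∫ s : I, fderiv ℝ g (a + (s : ℝ) • b) b := by
  have hs : ∀ s ∈ Icc (0 : ℝ) 1, a + s • b ∈ O := fun s hs => hc.add_smul_mem ha hb hs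
  have hc' : ContinuousOn (fun s : ℝ => fderiv ℝ g (a + s • b) b) (Icc 0 1) :=
    ((contDiffOn_fderiv hO hg).continuousOn.comp (by fun_prop) hs).clm_apply continuousOn_const
  have h := intervalIntegral.integral_eq_sub_of_hasDerivAt (a := 0) (b := 1)
    (f := fun s : ℝ => g (a + s • b)) (f' := fun s : ℝ => fderiv ℝ g (a + s • b) b)
    (fun s h => by
      rw [uIcc_of_le zero_le_one] at h
      have h1 : HasDerivAt (fun s : ℝ => a + s • b) b s := by
        simpa using ((hasDerivAt_id s).smul_const b).const_add a
      exact ((differentiableAt_of_smooth hO hg (hs s h)).hasFDerivAt).comp_hasDerivAt s h1)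
    (by
      rw [← uIcc_of_le zero_le_one] at hc'
      exact hc'.intervalIntegrable)
  simp only [one_smul, zero_smul, add_zero] at h
  rw [← h, intervalIntegral.integral_of_le zero_le_one, ← integral_Icc_eq_integral_Ioc]
  exact (integral_subtype measurableSet_Icc fun s : ℝ => fderiv ℝ g (a + s • b) b).symm

/-- The evaluation map `(A, v) ↦ A v` as a continuous bilinear map. -/
abbrev evalBilin (F G : Type) [NormedAddCommGroup F] [NormedSpace ℝ F]
    [NormedAddCommGroup G] [NormedSpace ℝ G] : (F →L[ℝ] G) →L[ℝ] F →L[ℝ] G :=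
  ContinuousLinearMap.id ℝ (F →L[ℝ] G)

open Classical in
/-- The difference quotient `t⁻¹ (g(f + t w) - g(f))`, extended by `Dg(f) w` to `t = 0`. -/
def diffQuot (g : F → G) (f : SmoothFn n M F) (p : ℝ × SmoothFn n M F) : SmoothFn n M G :=
  if p.1 = 0 then bilinFn (evalBilin F G) (smoothComp (fderiv ℝ g) f) p.2
  else p.1⁻¹ • (smoothComp g (f + p.1 • p.2) - smoothComp g f)

/-- Both branches of the definition equal `∫₀¹ Dg(f + s t w) w ds`. The integrand is a continuous
family of smooth functions of `(t, w, s)`, so the integral is continuous in `(t, w)`, including `t =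
0`. -/
theorem continuousOn_diffQuot [CompleteSpace G] {g : F → G} {O : Set F} (hO : IsOpen O)
    (hc : Convex ℝ O) (hg : ContDiffOn ℝ ∞ g O) {f : SmoothFn n M F} (hf : ∀ x, f x ∈ O) :
    ContinuousOn (diffQuot g f) {p | ∀ x, (f + p.1 • p.2) x ∈ O} := by
  rw [continuousOn_iff_continuous_domRestrict]
  set S := {p : ℝ × SmoothFn n M F | ∀ x, (f + p.1 • p.2) x ∈ O}
  have hm : ∀ (z : S × I) (x : M), (f + (z.2 : ℝ) • (z.1.1.1 • z.1.1.2)) x ∈ O := fun z x =>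
    hc.add_smul_mem (hf x) (z.1.2 x) z.2.2
  have hg' := contDiffOn_fderiv hO hg
  have c1 : Continuous fun z : S × I => f + (z.2 : ℝ) • (z.1.1.1 • z.1.1.2) := by fun_prop
  have c2 : Continuous fun z : S × I =>
      smoothComp (fderiv ℝ g) (f + (z.2 : ℝ) • (z.1.1.1 • z.1.1.2)) :=
    continuous_of_comp hO hg' c1 hm fun z x => smoothComp_apply hO hg' (hm z) x
  have c3 : Continuous fun z : S × I => bilinFn (evalBilin F G)
      (smoothComp (fderiv ℝ g) (f + (z.2 : ℝ) • (z.1.1.1 • z.1.1.2))) z.1.1.2 :=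
    (continuous_bilinFn _).comp (c2.prodMk (by fun_prop))
  refine continuous_of_integral c3 fun z x => ?_
  have e : ∀ s : I, bilinFn (evalBilin F G) (smoothComp (fderiv ℝ g)
      (f + (s : ℝ) • (z.1.1 • z.1.2))) z.1.2 x =
      fderiv ℝ g (f x + (s : ℝ) • (z.1.1 • z.1.2 x)) (z.1.2 x) := fun s => by
    rw [bilinFn_apply, smoothComp_apply hO hg' (hm (z, s))]
    rfl
  simp only [e, domRestrict_apply, diffQuot]
  split_ifs with h0
  -- For `t = 0` the integrand does not depend on `s`, and `I` has volume one.
  · simp only [h0, zero_smul, smul_zero, add_zero, integral_const, bilinFn_apply,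
      smoothComp_apply hO hg' hf]
    simp
  · have hz : f x + z.1.1 • z.1.2 x ∈ O := z.2 x
    have h1 := sub_eq_integral_fderiv hO hc hg (hf x) hz
    have h2 : (z.1.1⁻¹ • (smoothComp g (f + z.1.1 • z.1.2) - smoothComp g f)) x =
        z.1.1⁻¹ • (g (f x + z.1.1 • z.1.2 x) - g (f x)) := by
      rw [← smoothComp_apply hO hg hf]
      change z.1.1⁻¹ • (smoothComp g (f + z.1.1 • z.1.2) x - smoothComp g f x) = _
      rw [smoothComp_apply hO hg z.2]
      rfl
    have h3 : ∀ s : I, fderiv ℝ g (f x + (s : ℝ) • (z.1.1 • z.1.2 x)) (z.1.1 • z.1.2 x) =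
        z.1.1 • fderiv ℝ g (f x + (s : ℝ) • (z.1.1 • z.1.2 x)) (z.1.2 x) := fun s => map_smul _ _ _
    simp only [h3, integral_smul] at h1
    rw [h2, h1, inv_smul_smul₀ h0]

/-- With `w_t = t⁻¹ (f(x + t v) - f(x))` one has `f(x + t v) = f(x) + t w_t`, so the difference
quotient of `g ∘ f` is `diffQuot` at `(t, w_t)`. This point tends to `(0, a)`, where `diffQuot` is
continuous. Compactness of `M` keeps `f(x + t v)` in `O` for small `t`. -/
theorem HasDirDeriv.smoothComp [CompactSpace M] [CompleteSpace G] {V : Type*} [AddCommGroup V]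
    [Module ℝ V] [TopologicalSpace V] {g : F → G} {O : Set F} (hO : IsOpen O) (hc : Convex ℝ O)
    (hg : ContDiffOn ℝ ∞ g O) {f : V → SmoothFn n M F} {a : SmoothFn n M F} {x v : V}
    (hx : ∀ y, f x y ∈ O) (hf : HasDirDeriv f a x v) :
    HasDirDeriv (fun y => smoothComp g (f y))
      (bilinFn (evalBilin F G) (Madelung.smoothComp (fderiv ℝ g) (f x)) a) x v := by
  have h1 : Tendsto (fun t : ℝ => (t, t⁻¹ • (f (x + t • v) - f x))) (𝓝[≠] 0) (𝓝 (0, a)) :=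
    (tendsto_nhdsWithin_of_tendsto_nhds tendsto_id).prodMk_nhds hf
  have e : ∀ t : ℝ, t ≠ 0 → f x + t • (t⁻¹ • (f (x + t • v) - f x)) = f (x + t • v) := fun t ht => by
    rw [smul_inv_smul₀ ht, add_sub_cancel]
  have h2 : ∀ᶠ t : ℝ in 𝓝[≠] 0, ∀ y, f (x + t • v) y ∈ O :=
    hf.tendsto ((isOpen_mapsTo hO).mem_nhds hx)
  have h3 := continuousOn_diffQuot hO hc hg hx (0, a) (by simpa using hx)
  have h4 := h3.tendsto.comp (tendsto_nhdsWithin_iff.2 ⟨h1, by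
    filter_upwards [h2, self_mem_nhdsWithin] with t ht ht0
    change ∀ y, (f x + t • (t⁻¹ • (f (x + t • v) - f x))) y ∈ O
    rwa [e t ht0]⟩)
  have h5 : diffQuot g (f x) (0, a) =
      bilinFn (evalBilin F G) (Madelung.smoothComp (fderiv ℝ g) (f x)) a := if_pos rfl
  rw [h5] at h4
  refine h4.congr' ?_
  filter_upwards [self_mem_nhdsWithin] with t ht
  simp only [Function.comp, diffQuot, if_neg (show ¬t = 0 from ht), e t ht]

/-- The derivative `(x, v) ↦ Dg(f x) · f'(x, v)` is a continuous bilinear expression in `f'` and in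
the composition of `f` with `Dg`, which is again smooth on `O`; the induction applies it with target
`F →L[ℝ] G`. -/
theorem CkOn.smoothComp [CompactSpace M] : ∀ (k : ℕ) {F G : Type} [NormedAddCommGroup F]
    [NormedSpace ℝ F] [NormedAddCommGroup G] [NormedSpace ℝ G] [CompleteSpace G]
    {V : Type*} [AddCommGroup V] [Module ℝ V] [TopologicalSpace V] {g : F → G} {O : Set F}
    {f : V → SmoothFn n M F} {U : Set V}, IsOpen O → Convex ℝ O → ContDiffOn ℝ ∞ g O →
    (∀ y ∈ U, ∀ x, f y x ∈ O) → CkOn k f U → CkOn k (fun y => smoothComp g (f y)) U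
  | 0, _, _, _, _, _, _, _, _, _, _, _, _, _, _, _, hO, _, hg, hm, hf =>
    continuousOn_smoothComp hO hg hf hm
  | k + 1, F, G, _, _, _, _, _, V, _, _, _, g, O, f, U, hO, hc, hg, hm, hf => by
    have hf0 := CkOn.pred k hf
    obtain ⟨cf, f', hf1, hf2⟩ := hf
    have m : MapsTo (ContinuousLinearMap.fst ℝ V V) (U ×ˢ univ) U := fun p hp => hp.1
    refine ⟨continuousOn_smoothComp hO hg cf hm, fun p => bilinFn (evalBilin F G)
      (Madelung.smoothComp (fderiv ℝ g) (f p.1)) (f' p), fun x hx v =>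
      (hf1 x hx v).smoothComp hO hc hg (hm x hx), ?_⟩
    exact CkOn.bilin (bilinFn (evalBilin F G)) (continuous_bilinFn _) k
      (CkOn.smoothComp k hO hc (contDiffOn_fderiv hO hg) (fun p hp => hm p.1 hp.1)
        (CkOn.comp_clm k (.fst ℝ V V) m hf0)) hf2

end SmoothComp

/-! ### Further rules of the `C^k` calculus: linear images, pairs, locality -/

section LocalCk

theorem CkOn.clm {W W₁ : Type*} [AddCommGroup W] [Module ℝ W] [TopologicalSpace W]
    [AddCommGroup W₁] [Module ℝ W₁] [TopologicalSpace W₁] (L : W₁ →L[ℝ] W) :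
    ∀ (k : ℕ) {V : Type*} [AddCommGroup V] [Module ℝ V] [TopologicalSpace V]
      {f : V → W₁} {U : Set V}, CkOn k f U → CkOn k (fun y => L (f y)) U
  | 0, _, _, _, _, _, _, hf => L.continuous.comp_continuousOn hf
  | k + 1, _, _, _, _, _, _, ⟨hf, f', h1, h2⟩ =>
    ⟨L.continuous.comp_continuousOn hf, fun p => L (f' p), fun x hx v => (h1 x hx v).clm L,
      CkOn.clm L k h2⟩

theorem CkOn.const {W : Type*} [AddCommGroup W] [Module ℝ W] [TopologicalSpace W] [ContinuousAdd W]
    (k : ℕ) {V : Type*} [AddCommGroup V] [Module ℝ V] [TopologicalSpace V] (b : W) (U : Set V) :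
    CkOn k (fun _ => b) U := by
  simpa using CkOn.affine k b (0 : V →L[ℝ] W) U

theorem CkOn.prodMk {W W₁ : Type*} [AddCommGroup W] [Module ℝ W] [TopologicalSpace W]
    [AddCommGroup W₁] [Module ℝ W₁] [TopologicalSpace W₁] :
    ∀ (k : ℕ) {V : Type*} [AddCommGroup V] [Module ℝ V] [TopologicalSpace V]
      {f : V → W} {g : V → W₁} {U : Set V}, CkOn k f U → CkOn k g U →
      CkOn k (fun y => (f y, g y)) U
  | 0, _, _, _, _, _, _, _, hf, hg => ContinuousOn.prodMk hf hg
  | k + 1, _, _, _, _, _, _, _, ⟨hf, f', hf1, hf2⟩, ⟨hg, g', hg1, hg2⟩ =>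
    ⟨hf.prodMk hg, fun p => (f' p, g' p), fun x hx v => (hf1 x hx v).prodMk_nhds (hg1 x hx v),
      CkOn.prodMk k hf2 hg2⟩

/-- Being of class `C^k` is a local property. -/
theorem CkOn.of_local {W : Type*} [AddCommGroup W] [Module ℝ W] [TopologicalSpace W] [T2Space W] :
    ∀ (k : ℕ) {V : Type*} [AddCommGroup V] [Module ℝ V] [TopologicalSpace V]
      [ContinuousAdd V] [ContinuousSMul ℝ V] {f : V → W} {U : Set V},
      (∀ x ∈ U, ∃ N, IsOpen N ∧ x ∈ N ∧ CkOn k f N) → CkOn k f U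
  | 0, _, _, _, _, _, _, f, U, h => fun x hx => by
    obtain ⟨N, hN, hxN, hf⟩ := h x hx
    exact (ContinuousOn.continuousAt hf (hN.mem_nhds hxN)).continuousWithinAt
  | k + 1, V, _, _, _, _, _, f, U, h => by
    classical
    -- Each neighbourhood brings its own derivative `f'`. A single global one is chosen pointwise;
    -- uniqueness of limits in the Hausdorff space `W` identifies it with the local ones, and the
    -- default 0 never occurs on `U`.
    refine ⟨fun x hx => ?_, fun p => if h : ∃ a, HasDirDeriv f a p.1 p.2 then h.choose else 0,
      fun x hx v => ?_, CkOn.of_local k fun p hp => ?_⟩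
    · obtain ⟨N, hN, hxN, hf⟩ := h x hx
      exact (hf.1.continuousAt (hN.mem_nhds hxN)).continuousWithinAt
    · obtain ⟨N, hN, hxN, hf, f', h1, h2⟩ := h x hx
      have e : ∃ a, HasDirDeriv f a x v := ⟨_, h1 x hxN v⟩
      simp only [dif_pos e]
      exact e.choose_spec
    · obtain ⟨N, hN, hxN, hf, f', h1, h2⟩ := h p.1 hp.1
      refine ⟨N ×ˢ univ, hN.prod isOpen_univ, ⟨hxN, trivial⟩, h2.congr (hN.prod isOpen_univ) ?_⟩
      intro q hq
      have e : ∃ a, HasDirDeriv f a q.1 q.2 := ⟨_, h1 q.1 hq.1 q.2⟩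
      simp only [dif_pos e]
      exact (h1 q.1 hq.1 q.2).unique e.choose_spec

end LocalCk

/-! ### Continuous linear projections and sections for functions modulo constants and of mean zero
-/

section Linear

set_option linter.unusedSectionVars false

variable (n : ℕ) {M : Type*} [TopologicalSpace M] [ChartedSpace (Euc n) M]
  [IsManifold (𝓡 n) ∞ M] [CompactSpace M] [ConnectedSpace M] [MeasurableSpace M] [BorelSpace M]
  (μ : Measure M) [IsSmoothVolume n μ]

theorem continuous_eval (x : M) {F : Type*} [NormedAddCommGroup F] [NormedSpace ℝ F] :
    Continuous fun f : SmoothFn n M F => f x :=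
  (continuous_eval_const (F := C(M, F)) x).comp (continuous_toCont (n := n) (F := F))

/-- `c` as the constant function, depending linearly on `c`. -/
def constCLM (M : Type*) [TopologicalSpace M] [ChartedSpace (Euc n) M]
    [IsManifold (𝓡 n) ∞ M] : ℝ →L[ℝ] SmoothFn n M ℝ :=
  ContinuousLinearMap.toSpanSingleton ℝ (constFn n M 1)

theorem constCLM_apply (c : ℝ) (x : M) : constCLM n M c x = c := by
  change c • (1 : ℝ) = c
  simp

/-- Evaluation at `x` as a continuous linear form. -/
def evalCLM (x : M) : SmoothFn n M ℝ →L[ℝ] ℝ where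
  toFun f := f x
  map_add' _ _ := rfl
  map_smul' _ _ := rfl
  cont := continuous_eval n x

/-- The function `θ - θ(x₀)`, for a fixed base point `x₀`. -/
def subBase : SmoothFn n M ℝ →L[ℝ] SmoothFn n M ℝ :=
  ContinuousLinearMap.id ℝ _ - (constCLM n M).comp (evalCLM n (Classical.arbitrary M))

theorem subBase_apply (f : SmoothFn n M ℝ) (x : M) :
    subBase n f x = f x - f (Classical.arbitrary M) := by
  change f x - constCLM n M (f (Classical.arbitrary M)) x = _
  rw [constCLM_apply]

/-- The representative of a class of functions modulo constants which vanishes at the base point. -/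
def cotangentSection : Cotangent n M →L[ℝ] SmoothFn n M ℝ where
  toLinearMap := (constants n M).liftQ (subBase n).toLinearMap <| by
    rintro f ⟨c, hc⟩
    ext x
    change subBase n f x = 0
    rw [subBase_apply, hc, hc, sub_self]
  cont := isQuotientMap_quot_mk.continuous_iff.2 (subBase n).continuous

theorem mk_cotangentSection (q : Cotangent n M) :
    Submodule.Quotient.mk (cotangentSection n q) = q := by
  obtain ⟨θ, rfl⟩ := Submodule.Quotient.mk_surjective _ q
  rw [Submodule.Quotient.eq]
  refine ⟨-θ (Classical.arbitrary M), fun x => ?_⟩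
  change subBase n θ x - θ x = _
  rw [subBase_apply]
  ring

instance : T2Space (Cotangent n M) := by
  have : IsClosed (constants n M : Set (SmoothFn n M ℝ)) := isClosed_constants n
  infer_instance

/-- The quotient map as a continuous linear map. -/
def cotangentMk : SmoothFn n M ℝ →L[ℝ] Cotangent n M where
  toLinearMap := (constants n M).mkQ
  cont := continuous_quot_mk

/-- The function `f` minus its mean. -/
def zeroMeanProj : SmoothFn n M ℝ →L[ℝ] zeroMean n μ :=
  have := isFiniteMeasure n μ
  (ContinuousLinearMap.id ℝ _ - (constCLM n M).comp ((μ.real univ)⁻¹ •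
    (integralCLM μ).comp (⟨toCont, continuous_toCont⟩ : SmoothFn n M ℝ →L[ℝ] C(M, ℝ)))).codRestrict
    (zeroMean n μ) fun f => by
      have h := integral_sub (integrable_smooth μ f) (integrable_smooth μ
        (constCLM n M ((μ.real univ)⁻¹ • ∫ x, f x ∂μ)))
      have h2 : ∫ x, constCLM n M ((μ.real univ)⁻¹ • ∫ x, f x ∂μ) x ∂μ = ∫ x, f x ∂μ := by
        simp [constCLM_apply, (measure_univ_pos n μ inferInstance).ne']
      rw [h2, sub_self] at h
      exact h

theorem zeroMeanProj_apply (f : SmoothFn n M ℝ) (x : M) :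
    (zeroMeanProj n μ f).1 x = f x - (μ.real univ)⁻¹ * ∫ x, f x ∂μ := by
  change f x - constCLM n M _ x = _
  rw [constCLM_apply]
  rfl

/-- Since `∫ ρ dμ = 1`, the mean of `ρ` is the constant value of the uniform density. So the chart
is the restriction of a continuous linear map defined on all functions. -/
theorem cotangentCoord_fst (z : CotangentDens n μ) :
    (cotangentCoord n μ z).1 = zeroMeanProj n μ z.1.1 := by
  ext x
  rw [zeroMeanProj_apply, z.1.2.2, mul_one]
  rfl

end Linear

/-! ### The Madelung transform in the global chart -/

section MadelungModel

set_option linter.unusedSectionVars false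

variable (n : ℕ) {M : Type*} [TopologicalSpace M] [ChartedSpace (Euc n) M]
  [IsManifold (𝓡 n) ∞ M] [CompactSpace M] [ConnectedSpace M] [MeasurableSpace M] [BorelSpace M]
  (μ : Measure M) [IsSmoothVolume n μ]

theorem contDiffOn_log_Ioi : ContDiffOn ℝ ∞ Real.log (Ioi 0) :=
  Real.contDiffOn_log.mono fun _ hx => ne_of_gt hx

theorem contDiffOn_cexp : ContDiffOn ℝ ∞ Complex.exp univ :=
  Complex.contDiff_exp.contDiffOn

/-- The density of the point with coordinate `z`. -/
def modelDens (z : CotangentDensModel n μ) : SmoothFn n M ℝ := (uniformDens n μ).1 + z.1.1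

theorem modelDens_cotangentCoord (z : CotangentDens n μ) :
    modelDens n μ (cotangentCoord n μ z) = z.1.1 :=
  add_sub_cancel (uniformDens n μ).1 z.1.1

/-- The logarithm `(log ρ + iθ) / 2` of the Madelung transform. -/
def madelungLog (z : CotangentDensModel n μ) : SmoothFn n M ℂ :=
  postcomp (ContinuousLinearMap.toSpanSingleton ℝ (1 / 2 : ℂ))
      (smoothComp Real.log (modelDens n μ z)) +
    postcomp (ContinuousLinearMap.toSpanSingleton ℝ (Complex.I / 2)) (cotangentSection n z.2)

/-- The Madelung transform in the global chart, with values in functions. -/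
def madelungModel (z : CotangentDensModel n μ) : SmoothFn n M ℂ :=
  smoothComp Complex.exp (madelungLog n μ z)

theorem madelungModel_apply (z : CotangentDensModel n μ) (x : M) :
    madelungModel n μ z x = Complex.exp (madelungLog n μ z x) :=
  smoothComp_apply isOpen_univ contDiffOn_cexp (fun _ => trivial) x

theorem madelungLog_apply {z : CotangentDensModel n μ} (hz : ∀ x, 0 < modelDens n μ z x) (x : M) :
    madelungLog n μ z x = (Real.log (modelDens n μ z x) / 2 : ℝ) +
      Complex.I * (cotangentSection n z.2 x / 2 : ℝ) := by
  rw [madelungLog, ContMDiffMap.coe_add, Pi.add_apply, postcomp_apply, postcomp_apply,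
    smoothComp_apply isOpen_Ioi contDiffOn_log_Ioi hz]
  simp only [ContinuousLinearMap.toSpanSingleton_apply, Complex.real_smul]
  push_cast
  ring

/-- Here `√ρ = exp(½ log ρ)`, so modulus and phase are treated by one exponential. The
representative of `[θ]` vanishing at the base point makes the transform a function of the coordinate
alone. -/
theorem madelungModel_cotangentCoord (z : CotangentDens n μ) :
    madelungModel n μ (cotangentCoord n μ z) =
      madelungFn z.1.1 (cotangentSection n z.2) z.1.2.1 := by
  have hz : ∀ x, 0 < modelDens n μ (cotangentCoord n μ z) x := by
    rw [modelDens_cotangentCoord]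
    exact z.1.2.1
  ext x
  rw [madelungModel_apply, madelungLog_apply n μ hz, modelDens_cotangentCoord, madelungFn_apply,
    Complex.exp_add, ← Complex.ofReal_exp, Real.sqrt_eq_rpow, Real.rpow_def_of_pos (z.1.2.1 x),
    mul_one_div]
  rfl

theorem ckOn_modelDens (k : ℕ) (U : Set (CotangentDensModel n μ)) :
    CkOn k (modelDens n μ) U :=
  CkOn.affine k (uniformDens n μ).1
    ((zeroMean n μ).subtypeL.comp (.fst ℝ (zeroMean n μ) (Cotangent n M))) U

theorem ckOn_madelungModel (k : ℕ) :
    CkOn k (madelungModel n μ) {z | ∀ x, 0 < modelDens n μ z x} := by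
  refine CkOn.smoothComp k isOpen_univ convex_univ contDiffOn_cexp (fun _ _ _ => trivial)
    (CkOn.add k (CkOn.clm _ k (CkOn.smoothComp k isOpen_Ioi (convex_Ioi 0) contDiffOn_log_Ioi
      (fun y hy x => hy x) (ckOn_modelDens n μ k _))) (CkOn.clm _ k ?_))
  simpa using CkOn.affine k 0 ((cotangentSection n).comp
    (.snd ℝ (zeroMean n μ) (Cotangent n M))) _

/-- Logarithmic differentiation of `ψ = exp((log ρ + iθ)/2)`: the derivative of the exponent, times
`ψ`. -/
theorem exists_hasDirDeriv_madelungModel {z : CotangentDensModel n μ}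
    (hz : ∀ x, 0 < modelDens n μ z x) (v : CotangentDensModel n μ) :
    ∃ u, HasDirDeriv (madelungModel n μ) u z v ∧ ∀ x, u x =
      ((v.1.1 x / (2 * modelDens n μ z x) : ℝ) + Complex.I * (cotangentSection n v.2 x / 2 : ℝ)) *
        madelungModel n μ z x := by
  have h1 : HasDirDeriv (modelDens n μ) v.1.1 z v :=
    hasDirDeriv_affine (uniformDens n μ).1 ((zeroMean n μ).subtypeL.comp
      (.fst ℝ (zeroMean n μ) (Cotangent n M))).toLinearMap z v
  have h2 := h1.smoothComp isOpen_Ioi (convex_Ioi 0) contDiffOn_log_Ioi hz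
  have h3 : HasDirDeriv (fun z : CotangentDensModel n μ => cotangentSection n z.2)
      (cotangentSection n v.2) z v := by
    simpa using hasDirDeriv_affine 0 ((cotangentSection n).comp
      (.snd ℝ (zeroMean n μ) (Cotangent n M))).toLinearMap z v
  have h4 : HasDirDeriv (madelungLog n μ) _ z v :=
    (h2.clm (postcomp (ContinuousLinearMap.toSpanSingleton ℝ (1 / 2 : ℂ)))).add
      (h3.clm (postcomp (ContinuousLinearMap.toSpanSingleton ℝ (Complex.I / 2))))
  have h5 : HasDirDeriv (madelungModel n μ) _ z v :=
    h4.smoothComp isOpen_univ convex_univ contDiffOn_cexp fun _ => trivial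
  refine ⟨_, h5, fun x => ?_⟩
  -- The calculus is real, so the complex derivative of `exp` enters as a real linear map.
  have e1 : fderiv ℝ Complex.exp (madelungLog n μ z x) =
      ContinuousLinearMap.restrictScalars ℝ (ContinuousLinearMap.toSpanSingleton ℂ
        (Complex.exp (madelungLog n μ z x))) :=
    ((Complex.hasDerivAt_exp _).hasFDerivAt.restrictScalars ℝ).fderiv
  have e2 : fderiv ℝ Real.log (modelDens n μ z x) =
      ContinuousLinearMap.toSpanSingleton ℝ (modelDens n μ z x)⁻¹ :=
    (Real.hasDerivAt_log (hz x).ne').hasFDerivAt.fderiv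
  rw [bilinFn_apply, smoothComp_apply isOpen_univ (contDiffOn_fderiv isOpen_univ contDiffOn_cexp)
    (fun _ => trivial), e1, madelungModel_apply, ContMDiffMap.coe_add, Pi.add_apply, postcomp_apply,
    postcomp_apply, bilinFn_apply, smoothComp_apply isOpen_Ioi
    (contDiffOn_fderiv isOpen_Ioi contDiffOn_log_Ioi) hz, e2]
  simp only [ContinuousLinearMap.coe_restrictScalars', ContinuousLinearMap.id_apply,
    ContinuousLinearMap.toSpanSingleton_apply, Complex.real_smul, smul_eq_mul]
  push_cast
  ring

theorem madelung_eq (z : CotangentDens n μ) :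
    madelung n μ z = ⟦⟨madelungFn z.1.1 (cotangentSection n z.2) z.1.2.1,
      ip_madelungFn n μ z.1 _⟩⟧ := by
  obtain ⟨ρ, q⟩ := z
  conv_lhs => rw [← mk_cotangentSection n q]
  rfl

theorem mem_cotangentAtlas_target {i : Unit} {y : CotangentDensModel n μ}
    (hy : y ∈ ((cotangentAtlas n μ).chart i).target) (x : M) : 0 < modelDens n μ y x := by
  have h := ((cotangentAtlas n μ).chart i).right_inv hy
  have e : cotangentCoord n μ (((cotangentAtlas n μ).chart i).symm y) = y := h
  rw [← e, modelDens_cotangentCoord]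
  exact (((cotangentAtlas n μ).chart i).symm y).1.2.1 x

theorem madelungModel_of_mem {i : Unit} {y : CotangentDensModel n μ}
    (hy : y ∈ ((cotangentAtlas n μ).chart i).target) :
    madelungModel n μ y = madelungFn (((cotangentAtlas n μ).chart i).symm y).1.1
      (cotangentSection n (((cotangentAtlas n μ).chart i).symm y).2)
      (((cotangentAtlas n μ).chart i).symm y).1.2.1 := by
  rw [← madelungModel_cotangentCoord]
  exact congrArg _ (((cotangentAtlas n μ).chart i).right_inv hy).symm

end MadelungModel

/-! ### Smooth maps into the affine charts of the projective space -/

section AffineChart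

set_option linter.unusedSectionVars false

variable {n : ℕ} {M : Type*} [TopologicalSpace M] [ChartedSpace (Euc n) M]
  [IsManifold (𝓡 n) ∞ M] [CompactSpace M] [MeasurableSpace M] [BorelSpace M]
  {μ : Measure M} [IsSmoothVolume n μ]

/-- The affine coordinate of `[ψ]`, for a function `ψ` of arbitrary norm. -/
def homogCoord (φ : Sphere n μ) (ψ : SmoothFn n M ℂ) : orth μ φ :=
  orthMul φ (ip μ φ.1 ψ)⁻¹ (orthProj φ ψ)

theorem cmul_add_homogCoord (φ : Sphere n μ) {ψ : SmoothFn n M ℂ} (h : ip μ φ.1 ψ ≠ 0) :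
    cmul (ip μ φ.1 ψ) (φ.1 + (homogCoord φ ψ).1) = ψ := by
  ext x
  simp only [homogCoord, coe_orthMul, coe_orthProj, cmul_apply, ContMDiffMap.coe_add, Pi.add_apply]
  field_simp
  ring

/-- `CkOn.inv` concerns real functions, so `⟨φ, ψ⟩⁻¹` is written as conjugate over squared modulus,
with real and imaginary parts acting separately on the projection and on its multiple by `i`. -/
theorem CkOn.homogCoord {V : Type*} [AddCommGroup V] [Module ℝ V] [TopologicalSpace V] (k : ℕ)
    {f : V → SmoothFn n M ℂ} {U : Set V} (φ : Sphere n μ) (h0 : CkOn k f U)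
    (hne : ∀ y ∈ U, ip μ φ.1 (f y) ≠ 0) : CkOn k (fun y => homogCoord φ (f y)) U := by
  have hc : CkOn k (fun _ : V => φ.1) U := CkOn.const k _ U
  have h1 : CkOn k (fun y => orthProj φ (f y)) U := CkOn.clm _ k h0
  have h2 : CkOn k (fun y => orthI φ (orthProj φ (f y))) U := CkOn.clm _ k h1
  have hre := CkOn.re_ip (μ := μ) hc h0
  have him := CkOn.im_ip (μ := μ) hc h0
  have hn := CkOn.inv k (fun y hy => by
    have := Complex.normSq_pos.2 (hne y hy)
    rw [Complex.normSq_apply] at this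
    exact this.ne') (CkOn.add k (CkOn.mul k hre hre) (CkOn.mul k him him))
  have hm : CkOn k (fun _ : V => (-1 : ℝ)) U := CkOn.const k _ U
  have h3 := CkOn.add k (CkOn.smul k (CkOn.mul k hre hn) h1)
    (CkOn.smul k (CkOn.mul k (CkOn.mul k hm him) hn) h2)
  convert h3 using 1
  funext y
  simp only [Madelung.homogCoord, orthMul, Complex.inv_re, Complex.inv_im, Complex.normSq_apply,
    div_eq_mul_inv, neg_one_mul]

/-- The product rule for `ψ = ⟨φ, ψ⟩ (φ + χ)`, where `χ` is the affine coordinate. The result has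
the form required by `fsHermitian_invariant`: a fibre direction plus a multiple of the tangent
vector in the chart. -/
theorem hasDirDeriv_of_homogCoord {V : Type*} [AddCommGroup V] [Module ℝ V] [TopologicalSpace V]
    {f : V → SmoothFn n M ℂ} {φ : Sphere n μ} {x v : V} {u : SmoothFn n M ℂ} {w : orth μ φ}
    (hne : ip μ φ.1 (f x) ≠ 0) (hf : HasDirDeriv f u x v)
    (hw : HasDirDeriv (fun y => homogCoord φ (f y)) w x v) :
    u = cmul (ip μ φ.1 u) (φ.1 + (homogCoord φ (f x)).1) + cmul (ip μ φ.1 (f x)) w.1 := by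
  have := isFiniteMeasure n μ
  let B : ℂ →ₗ[ℝ] SmoothFn n M ℂ →ₗ[ℝ] SmoothFn n M ℂ := LinearMap.mk₂ ℝ cmul
    (fun a b f => by ext x; simp [add_mul]) (fun r a f => by ext x; simp [mul_assoc])
    (fun a f g => by ext x; simp [mul_add]) (fun r a f => by ext x; simp [mul_left_comm])
  let L : SmoothFn n M ℂ →L[ℝ] ℂ :=
    { ipBilin μ φ.1 with cont := continuous_ip_right φ.1 }
  have h1 : HasDirDeriv (fun y => φ.1 + (homogCoord φ (f y)).1) w.1 x v := by
    have h := (hasDirDeriv_const φ.1 x v).add (hw.clm (orth μ φ).subtypeL)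
    rw [zero_add] at h
    exact h
  have h2 : HasDirDeriv (fun y => ip μ φ.1 (f y)) (ip μ φ.1 u) x v := hf.clm L
  have h3 := h2.bilin B continuous_cmul h1
  refine hf.unique (h3.congr (cmul_add_homogCoord φ hne) ?_)
  filter_upwards [h2.tendsto.eventually_ne hne] with t ht using cmul_add_homogCoord φ ht

end AffineChart

/-! ### Logarithms of nowhere vanishing functions -/

section Logarithm

set_option linter.unusedSectionVars false

variable {n : ℕ} {M : Type*} [TopologicalSpace M] [ChartedSpace (Euc n) M]
  [IsManifold (𝓡 n) ∞ M]

/-- Near `x₀` the imaginary part of `f - f x₀` stays within `(-π, π)`, so there `f = f x₀ + Log(ψ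
e^{-f x₀})` with the principal branch, evaluated near 1 where it is smooth. -/
theorem contMDiff_of_exp {f : M → ℂ} (hf : Continuous f) (ψ : SmoothFn n M ℂ)
    (h : ∀ x, Complex.exp (f x) = ψ x) : ContMDiff (𝓡 n) 𝓘(ℝ, ℂ) ∞ f := fun x₀ => by
  have h1 : ContDiffAt ℝ ∞ (fun w : ℂ => f x₀ + Complex.log (w * Complex.exp (-f x₀))) (ψ x₀) := by
    have h2 : ψ x₀ * Complex.exp (-f x₀) = 1 := by rw [← h, ← Complex.exp_add]; simp
    have h3 : ContDiffAt ℝ ∞ (fun w : ℂ => w * Complex.exp (-f x₀)) (ψ x₀) :=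
      contDiffAt_id.mul contDiffAt_const
    have h4 : ContDiffAt ℝ ∞ Complex.log (ψ x₀ * Complex.exp (-f x₀)) := by
      rw [h2]
      exact (Complex.contDiffAt_log Complex.one_mem_slitPlane).restrict_scalars ℝ
    exact contDiffAt_const.add (ContDiffAt.comp (g := Complex.log) (ψ x₀) h4 h3)
  refine (h1.contMDiffAt.comp x₀ (ψ.contMDiff x₀)).congr_of_eventuallyEq ?_
  have h3 : ContinuousAt (fun x => |(f x - f x₀).im|) x₀ := by fun_prop
  have h4 : ∀ᶠ x in 𝓝 x₀, |(f x - f x₀).im| < Real.pi :=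
    h3.eventually_lt_const (by simp [Real.pi_pos])
  filter_upwards [h4] with x hx
  rw [abs_lt] at hx
  simp only [Function.comp]
  rw [← h, ← Complex.exp_add, ← sub_eq_add_neg, Complex.log_exp hx.1 hx.2.le, add_sub_cancel]

/-- The exponential function as a map into `ℂ ∖ {0}`. -/
def expPunctured : C(ℂ, {z : ℂ // z ≠ 0}) :=
  ⟨fun z => ⟨_, z.exp_ne_zero⟩, Complex.continuous_exp.subtype_mk _⟩

/-- Homotopy lifting for the covering `exp`: a homotopy starting at a constant `c` lifts from the
constant `log c`, and its end is a logarithm of `ψ`. Conversely, `exp ∘ L` factors through the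
contractible space `ℂ`. -/
theorem nullhomotopic_iff_exists_log (ψ : SmoothFn n M ℂ) (h : ∀ x, ψ x ≠ 0) :
    (toPunctured ψ h).Nullhomotopic ↔
      ∃ L : SmoothFn n M ℂ, ∀ x, Complex.exp (L x) = ψ x := by
  constructor
  · rintro ⟨c, ⟨H⟩⟩
    -- The homotopy is reversed because the lift is prescribed at time 0, where the map has to be
    -- the constant one.
    have H0 : ∀ x, H.symm.toContinuousMap (0, x) =
        (fun z : ℂ => (⟨_, z.exp_ne_zero⟩ : {z : ℂ // z ≠ 0}))
          (ContinuousMap.const M (Complex.log c) x) := fun x => by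
      refine Subtype.ext ?_
      have : H.symm (0, x) = c := H.symm.apply_zero x
      exact (congrArg Subtype.val this).trans (Complex.exp_log c.2).symm
    have H1 := Complex.isCoveringMap_exp.liftHomotopy_lifts H.symm.toContinuousMap _ H0
    set K := Complex.isCoveringMap_exp.liftHomotopy H.symm.toContinuousMap _ H0
    have H2 : ∀ x, Complex.exp (K (1, x)) = ψ x := fun x => by
      have e : H.symm (1, x) = toPunctured ψ h x := H.symm.apply_one x
      exact (congrArg Subtype.val (congrFun H1 (1, x))).trans (congrArg Subtype.val e)
    exact ⟨⟨fun x => K (1, x), contMDiff_of_exp (by fun_prop) ψ H2⟩, H2⟩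
  · rintro ⟨L, hL⟩
    have e : toPunctured ψ h = (expPunctured.comp (ContinuousMap.id ℂ)).comp (toCont L) := by
      ext x
      exact (hL x).symm
    rw [e]
    exact ((id_nullhomotopic ℂ).comp_right expPunctured).comp_left (toCont L)

/-- The lifting criterion for the covering `exp`; local path connectedness comes from the charts. -/
theorem exists_log_of_simplyConnected [SimplyConnectedSpace M] (ψ : SmoothFn n M ℂ)
    (h : ∀ x, ψ x ≠ 0) : ∃ L : SmoothFn n M ℂ, ∀ x, Complex.exp (L x) = ψ x := by
  have := ChartedSpace.locallyPathConnectedSpace (Euc n) M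
  obtain ⟨x₀⟩ : Nonempty M := inferInstance
  obtain ⟨L, ⟨-, hL⟩, -⟩ := Complex.isCoveringMap_exp.existsUnique_continuousMap_lifts
    (toPunctured ψ h) x₀ (Complex.log (ψ x₀)) (Subtype.ext (Complex.exp_log (h x₀)))
  have hL' : ∀ x, Complex.exp (L x) = ψ x := fun x => congrArg Subtype.val (congrFun hL x)
  exact ⟨⟨L, contMDiff_of_exp L.continuous ψ hL'⟩, hL'⟩

/-- The functions `ψ` for which `ψ e^{-L}` takes its values in the right half plane. -/
def logNhd (L : SmoothFn n M ℂ) : Set (SmoothFn n M ℂ) :=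
  {ψ | ∀ x, 0 < (ψ x * Complex.exp (-L x)).re}

/-- Multiplication by `e^{-L}`. -/
def mulExpNeg (L : SmoothFn n M ℂ) : SmoothFn n M ℂ →L[ℝ] SmoothFn n M ℂ where
  toLinearMap := (bilinFn (ContinuousLinearMap.mul ℝ ℂ)).flip (smoothComp Complex.exp (-L))
  cont := (continuous_bilinFn _).comp (continuous_id.prodMk continuous_const)

theorem mulExpNeg_apply (L ψ : SmoothFn n M ℂ) (x : M) :
    mulExpNeg L ψ x = ψ x * Complex.exp (-L x) := by
  change ψ x * smoothComp Complex.exp (-L) x = _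
  rw [smoothComp_apply isOpen_univ contDiffOn_cexp (fun _ => trivial)]
  rfl

theorem isOpen_re_pos : IsOpen {z : ℂ | 0 < z.re} := isOpen_lt continuous_const Complex.continuous_re

theorem contDiffOn_clog : ContDiffOn ℝ ∞ Complex.log {z : ℂ | 0 < z.re} := fun _ hz =>
  ((Complex.contDiffAt_log (Or.inl hz)).restrict_scalars ℝ).contDiffWithinAt

theorem mulExpNeg_re_pos {L ψ : SmoothFn n M ℂ} (h : ψ ∈ logNhd L) (x : M) :
    mulExpNeg L ψ x ∈ {z : ℂ | 0 < z.re} := by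
  rw [mulExpNeg_apply]
  exact h x

theorem isOpen_logNhd [CompactSpace M] (L : SmoothFn n M ℂ) : IsOpen (logNhd L) := by
  convert (isOpen_mapsTo (n := n) (M := M) isOpen_re_pos).preimage (mulExpNeg L).continuous using 1
  ext ψ
  simp only [mem_preimage, mem_ofPred_eq, mulExpNeg_apply, logNhd]

theorem mem_logNhd {L ψ : SmoothFn n M ℂ} (h : ∀ x, Complex.exp (L x) = ψ x) : ψ ∈ logNhd L :=
  fun x => by
    rw [← h, ← Complex.exp_add]
    simp

/-- The logarithm of `ψ` which is close to `L`. -/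
def logNear (L ψ : SmoothFn n M ℂ) : SmoothFn n M ℂ := L + smoothComp Complex.log (mulExpNeg L ψ)

theorem exp_logNear {L ψ : SmoothFn n M ℂ} (h : ψ ∈ logNhd L) (x : M) :
    Complex.exp (logNear L ψ x) = ψ x := by
  have h0 : ψ x * Complex.exp (-L x) ≠ 0 := fun e => by
    have := h x
    rw [e] at this
    exact lt_irrefl _ this
  rw [logNear, ContMDiffMap.coe_add, Pi.add_apply, smoothComp_apply isOpen_re_pos contDiffOn_clog
    (mulExpNeg_re_pos h), mulExpNeg_apply, Complex.exp_add, Complex.exp_log h0, mul_comm, mul_assoc,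
    ← Complex.exp_add]
  simp

/-- The right half plane serves here in place of the larger slit plane because `CkOn.smoothComp`
needs a convex domain. -/
theorem CkOn.logNear [CompactSpace M] {V : Type*} [AddCommGroup V] [Module ℝ V]
    [TopologicalSpace V] (k : ℕ) {f : V → SmoothFn n M ℂ} {U : Set V} (L : SmoothFn n M ℂ)
    (hf : CkOn k f U) (hm : MapsTo f U (logNhd L)) : CkOn k (fun y => logNear L (f y)) U :=
  CkOn.add k (CkOn.const k L _) (CkOn.smoothComp k isOpen_re_pos (convex_halfSpace_re_gt 0)
    contDiffOn_clog (fun _ hy => mulExpNeg_re_pos (hm hy)) (CkOn.clm _ k hf))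

/-- The function `|ψ|²`. -/
def absSq (ψ : SmoothFn n M ℂ) : SmoothFn n M ℝ :=
  postcomp Complex.reCLM (bilinFn (ContinuousLinearMap.mul ℝ ℂ)
    (postcomp (Complex.conjCLE : ℂ →L[ℝ] ℂ) ψ) ψ)

theorem absSq_apply (ψ : SmoothFn n M ℂ) (x : M) : absSq ψ x = ‖ψ x‖ ^ 2 := by
  change (conj (ψ x) * ψ x).re = _
  rw [mul_comm, Complex.mul_conj, Complex.normSq_eq_norm_sq, Complex.ofReal_re]

theorem CkOn.absSq {V : Type*} [AddCommGroup V] [Module ℝ V] [TopologicalSpace V] (k : ℕ)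
    {f : V → SmoothFn n M ℂ} {U : Set V} (hf : CkOn k f U) : CkOn k (fun y => absSq (f y)) U :=
  CkOn.clm _ k (CkOn.bilin (bilinFn (ContinuousLinearMap.mul ℝ ℂ)) (continuous_bilinFn _) k
    (CkOn.clm _ k hf) hf)

end Logarithm

/-! ### Injectivity and image of the Madelung transform -/

section Image

set_option linter.unusedSectionVars false

variable {n : ℕ} {M : Type*} [TopologicalSpace M] [ChartedSpace (Euc n) M]
  [IsManifold (𝓡 n) ∞ M] [CompactSpace M] [MeasurableSpace M] [BorelSpace M]
  {μ : Measure M} [IsSmoothVolume n μ]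

theorem mk_mem_nonvanishing {ψ : Sphere n μ} : (⟦ψ⟧ : Proj n μ) ∈ nonvanishing n μ ↔
    ∀ x, ψ.1 x ≠ 0 := by
  refine ⟨?_, fun h => ⟨ψ, rfl, h⟩⟩
  rintro ⟨ψ', e, h⟩ x
  obtain ⟨α, hα⟩ := Quotient.exact e
  rw [hα, cmul_apply]
  exact mul_ne_zero (exp_mul_I_ne_zero α) (h x)

/-- The condition does not depend on the representative: changing the phase by `e^{iα}` adds the
constant `iα` to the logarithm. -/
theorem mk_mem_nullhomotopic {ψ : Sphere n μ} : (⟦ψ⟧ : Proj n μ) ∈ nullhomotopic n μ ↔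
    ∃ L : SmoothFn n M ℂ, ∀ x, Complex.exp (L x) = ψ.1 x := by
  constructor
  · rintro ⟨ψ', h, e, hn⟩
    obtain ⟨α, hα⟩ := Quotient.exact e
    obtain ⟨L, hL⟩ := (nullhomotopic_iff_exists_log _ h).1 hn
    refine ⟨⟨fun x => α * Complex.I + L x, contMDiff_const.add L.contMDiff⟩, fun x => ?_⟩
    rw [hα, cmul_apply, ← hL, ← Complex.exp_add]
    rfl
  · rintro ⟨L, hL⟩
    have h : ∀ x, ψ.1 x ≠ 0 := fun x => hL x ▸ Complex.exp_ne_zero _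
    exact ⟨ψ, h, rfl, (nullhomotopic_iff_exists_log _ h).2 ⟨L, hL⟩⟩

variable (n μ) in
theorem nullhomotopic_subset_nonvanishing : nullhomotopic n μ ⊆ nonvanishing n μ := by
  rintro _ ⟨ψ, h, rfl, -⟩
  exact ⟨ψ, rfl, h⟩

variable (n μ) in
theorem nullhomotopic_eq_nonvanishing [SimplyConnectedSpace M] :
    nullhomotopic n μ = nonvanishing n μ := by
  refine (nullhomotopic_subset_nonvanishing n μ).antisymm ?_
  rintro _ ⟨ψ, rfl, h⟩
  exact mk_mem_nullhomotopic.2 (exists_log_of_simplyConnected ψ.1 h)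

variable (n μ) in
theorem isOpen_nonvanishing : IsOpen (nonvanishing n μ) := by
  refine (isQuotientMap_quot_mk.isOpen_preimage).1 ?_
  have h := (isOpen_mapsTo (n := n) (M := M) (isOpen_ne (x := (0 : ℂ)))).preimage
    (continuous_subtype_val (p := fun ψ : SmoothFn n M ℂ => ip μ ψ ψ = 1))
  convert h using 1
  ext ψ
  exact mk_mem_nonvanishing

-- The preimage in the sphere is its intersection with the union of the open sets `logNhd L`: every
-- function in `logNhd L` has the logarithm `logNear L ψ`.
variable (n μ) in
theorem isOpen_nullhomotopic : IsOpen (nullhomotopic n μ) := by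
  refine (isQuotientMap_quot_mk.isOpen_preimage).1 ?_
  have h : IsOpen (⋃ L : SmoothFn n M ℂ, logNhd L) := isOpen_iUnion isOpen_logNhd
  convert h.preimage (continuous_subtype_val (p := fun ψ : SmoothFn n M ℂ => ip μ ψ ψ = 1)) using 1
  ext ψ
  refine (mk_mem_nullhomotopic (ψ := ψ)).trans ?_
  simp only [mem_preimage, mem_iUnion]
  exact ⟨fun ⟨L, hL⟩ => ⟨L, mem_logNhd hL⟩, fun ⟨L, hL⟩ => ⟨_, exp_logNear hL⟩⟩

variable [ConnectedSpace M]

/-- The explicit preimage, from `ψ = |ψ| e^{i Im L}`. Its two components are recorded because they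
yield the coordinates of the inverse map. -/
theorem madelung_eq_of_exp {ψ : Sphere n μ} {L : SmoothFn n M ℂ}
    (hL : ∀ x, Complex.exp (L x) = ψ.1 x) : ∃ z : CotangentDens n μ, madelung n μ z = ⟦ψ⟧ ∧
      z.1.1 = absSq ψ.1 ∧ z.2 = cotangentMk n (postcomp ((2 : ℝ) • Complex.imCLM) L) := by
  have h0 : ∀ x, 0 < absSq ψ.1 x := fun x => by
    have : ψ.1 x ≠ 0 := hL x ▸ Complex.exp_ne_zero _
    rw [absSq_apply]
    positivity
  have h1 : ∫ x, absSq ψ.1 x ∂μ = 1 := by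
    have := ψ.2
    rw [ip_self] at this
    simp only [absSq_apply]
    exact_mod_cast this
  set θ := postcomp ((2 : ℝ) • Complex.imCLM) L with hθ
  have e : madelungFn (absSq ψ.1) θ h0 = ψ.1 := by
    ext x
    have e : θ x = 2 * (L x).im := rfl
    rw [madelungFn_apply, absSq_apply, Real.sqrt_sq (norm_nonneg _), ← hL, Complex.norm_exp, e,
      Complex.ofReal_exp, ← Complex.exp_add, mul_div_cancel_left₀ _ two_ne_zero, mul_comm,
      Complex.re_add_im]
  have e' : (⟨madelungFn (absSq ψ.1) θ h0, ip_madelungFn n μ ⟨absSq ψ.1, h0, h1⟩ θ⟩ :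
      Sphere n μ) = ψ := Subtype.ext e
  refine ⟨(⟨absSq ψ.1, h0, h1⟩, cotangentMk n θ), ?_, rfl, rfl⟩
  conv_rhs => rw [← e']
  rfl

variable (n μ) in
theorem range_madelung : range (madelung n μ) = nullhomotopic n μ := by
  ext p
  constructor
  · rintro ⟨z, rfl⟩
    rw [madelung_eq, mk_mem_nullhomotopic]
    refine ⟨madelungLog n μ (cotangentCoord n μ z), fun x => ?_⟩
    rw [← madelungModel_apply, madelungModel_cotangentCoord]
  · induction p using Quotient.inductionOn with
    | _ ψ =>
    intro h
    obtain ⟨L, hL⟩ := mk_mem_nullhomotopic.1 h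
    obtain ⟨z, hz, -⟩ := madelung_eq_of_exp hL
    exact ⟨z, hz⟩

/-- The values of `f` lie in the discrete group `2πℤ`, and `M` is connected. -/
theorem eq_const_of_cexp_eq_one {f : M → ℝ} (hf : Continuous f)
    (h : ∀ x, Complex.exp (Complex.I * f x) = 1) (x y : M) : f x = f y := by
  have h1 : MapsTo f univ (AddSubgroup.zmultiples (2 * Real.pi)) := fun x _ => by
    obtain ⟨k, hk⟩ := Complex.exp_eq_one_iff.1 (h x)
    refine ⟨k, ?_⟩
    have := congrArg Complex.im hk
    simpa using this.symm
  have h2 : IsDiscrete (AddSubgroup.zmultiples (2 * Real.pi) : Set ℝ) :=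
    SetLike.isDiscrete_iff_discreteTopology.mpr inferInstance
  exact isPreconnected_univ.constant_of_mapsTo h2 hf.continuousOn h1 trivial trivial

-- If two images agree up to the phase `e^{iα}`, comparing moduli gives `ρ = ρ'`. After cancelling
-- `√ρ`, the function `(θ' - θ)/2 - α` takes values in `2πℤ`, hence is constant.
variable (n μ) in
theorem madelung_injective : Function.Injective (madelung n μ) := by
  rintro ⟨ρ, q⟩ ⟨ρ', q'⟩ h
  obtain ⟨θ, rfl⟩ := Submodule.Quotient.mk_surjective _ q
  obtain ⟨θ', rfl⟩ := Submodule.Quotient.mk_surjective _ q'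
  obtain ⟨α, hα⟩ := Quotient.exact h
  have hx : ∀ x, (√(ρ'.1 x) : ℂ) * Complex.exp (Complex.I * (θ' x / 2 : ℝ)) =
      Complex.exp (α * Complex.I) * ((√(ρ.1 x) : ℂ) * Complex.exp (Complex.I * (θ x / 2 : ℝ))) :=
    fun x => DFunLike.congr_fun hα x
  have h1 : ∀ x, √(ρ'.1 x) = √(ρ.1 x) := fun x => by
    have := congrArg norm (hx x)
    simpa [mul_comm Complex.I, Complex.norm_exp_ofReal_mul_I, -Complex.ofReal_div,
      abs_of_nonneg (Real.sqrt_nonneg _)] using this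
  have h2 : ρ = ρ' := Subtype.ext (ContMDiffMap.ext fun x =>
    ((Real.sqrt_inj (ρ'.2.1 x).le (ρ.2.1 x).le).1 (h1 x)).symm)
  have h3 : ∀ x, Complex.exp (Complex.I * ((θ' x - θ x) / 2 - α : ℝ)) = 1 := fun x => by
    have h4 := hx x
    have h5 : (√(ρ.1 x) : ℂ) ≠ 0 := by
      rw [Complex.ofReal_ne_zero]
      exact (Real.sqrt_pos.2 (ρ.2.1 x)).ne'
    rw [h1, mul_left_comm, ← Complex.exp_add] at h4
    have h6 := mul_left_cancel₀ h5 h4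
    have e : Complex.I * ((θ' x - θ x) / 2 - α : ℝ) = Complex.I * (θ' x / 2 : ℝ) -
        (α * Complex.I + Complex.I * (θ x / 2 : ℝ)) := by
      push_cast
      ring
    rw [e, Complex.exp_sub, h6, div_self (Complex.exp_ne_zero _)]
  obtain ⟨x₀⟩ : Nonempty M := inferInstance
  have h4 := fun x => eq_const_of_cexp_eq_one (f := fun x => (θ' x - θ x) / 2 - α)
    (((θ'.contMDiff.continuous.sub θ.contMDiff.continuous).div_const 2).sub continuous_const)
    h3 x x₀
  refine Prod.ext h2 ((Submodule.Quotient.eq _).2 ⟨θ x₀ - θ' x₀, fun x => ?_⟩)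
  have := h4 x
  change θ x - θ' x = _
  linarith

end Image

/-! ### The Madelung transform is a symplectomorphism -/

section Symplectomorphism

set_option linter.unusedSectionVars false

variable {n : ℕ} {M : Type*} [TopologicalSpace M] [ChartedSpace (Euc n) M]
  [IsManifold (𝓡 n) ∞ M] [CompactSpace M] [ConnectedSpace M] [MeasurableSpace M] [BorelSpace M]
  {μ : Measure M} [IsSmoothVolume n μ]

variable (μ) in
/-- The coordinate of the preimage of `[ψ]` under the Madelung transform, for `ψ` close to `e^L`. -/
def logCoord (L ψ : SmoothFn n M ℂ) : CotangentDensModel n μ :=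
  ((ip μ ψ ψ).re⁻¹ • zeroMeanProj n μ (absSq ψ),
    cotangentMk n (postcomp ((2 : ℝ) • Complex.imCLM) (logNear L ψ)))

theorem ip_self_ne_zero_of_mem_logNhd {L ψ : SmoothFn n M ℂ} (h : ψ ∈ logNhd L) :
    ip μ ψ ψ ≠ 0 := fun h0 => by
  have := isFiniteMeasure n μ
  have := isOpenPosMeasure n μ
  obtain ⟨x⟩ : Nonempty M := inferInstance
  have h1 := h x
  rw [eq_zero_of_ip_self μ h0] at h1
  simp at h1

theorem CkOn.logCoord {V : Type*} [AddCommGroup V] [Module ℝ V] [TopologicalSpace V] (k : ℕ)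
    {f : V → SmoothFn n M ℂ} {U : Set V} (L : SmoothFn n M ℂ) (hf : CkOn k f U)
    (hm : MapsTo f U (logNhd L)) : CkOn k (fun y => logCoord μ L (f y)) U :=
  CkOn.prodMk k (CkOn.smul k (CkOn.inv k (fun _ hy =>
      (ip_self_pos (ip_self_ne_zero_of_mem_logNhd (hm hy))).ne') (CkOn.re_ip hf hf))
      (CkOn.clm _ k (CkOn.absSq k hf)))
    (CkOn.clm _ k (CkOn.clm _ k (CkOn.logNear k L hf hm)))

/-- Normalising multiplies `ψ` by a constant `c > 0`: this adds the real number `log c` to the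
logarithm, leaving the phase unchanged, and divides `|ψ|²` by `⟨ψ, ψ⟩`. So the coordinates can be
read off a function of any norm, such as `φ + χ` in an affine chart. -/
theorem exists_madelung_eq_normalize {L ψ : SmoothFn n M ℂ} (h : ψ ∈ logNhd L)
    (hn : ip μ ψ ψ ≠ 0) : ∃ z : CotangentDens n μ, madelung n μ z = ⟦normalize μ ψ hn⟧ ∧
      cotangentCoord n μ z = logCoord μ L ψ := by
  have hp := ip_self_pos hn
  set c : ℝ := (√(ip μ ψ ψ).re)⁻¹ with hc
  have hc0 : 0 < c := inv_pos.2 (Real.sqrt_pos.2 hp)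
  let L' : SmoothFn n M ℂ :=
    ⟨fun x => (Real.log c : ℂ) + logNear L ψ x, contMDiff_const.add (logNear L ψ).contMDiff⟩
  have hL' : ∀ x, Complex.exp (L' x) = (normalize μ ψ hn).1 x := fun x => by
    change Complex.exp ((Real.log c : ℂ) + logNear L ψ x) = (c : ℂ) * ψ x
    rw [Complex.exp_add, exp_logNear h, ← Complex.ofReal_exp, Real.exp_log hc0]
  obtain ⟨z, hz, h1, h2⟩ := madelung_eq_of_exp hL'
  refine ⟨z, hz, Prod.ext ?_ ?_⟩
  · have e : absSq (normalize μ ψ hn).1 = (ip μ ψ ψ).re⁻¹ • absSq ψ := by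
      ext x
      change _ = (ip μ ψ ψ).re⁻¹ * absSq ψ x
      rw [absSq_apply, absSq_apply]
      change ‖(c : ℂ) * ψ x‖ ^ 2 = _
      rw [norm_mul, mul_pow, Complex.norm_real, Real.norm_eq_abs, sq_abs, hc, inv_pow,
        Real.sq_sqrt hp.le]
    rw [cotangentCoord_fst, h1, e, map_smul]
    rfl
  · change z.2 = _
    rw [h2]
    refine congrArg (cotangentMk n) (ContMDiffMap.ext fun x => ?_)
    change (2 : ℝ) • ((Real.log c : ℂ) + logNear L ψ x).im = (2 : ℝ) • (logNear L ψ x).im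
    rw [Complex.add_im, Complex.ofReal_im, zero_add]

theorem normalize_coe (ψ : Sphere n μ) (h : ip μ ψ.1 ψ.1 ≠ 0) : normalize μ ψ.1 h = ψ := by
  refine Subtype.ext (ContMDiffMap.ext fun x => ?_)
  simp [normalize, ψ.2]

variable (n μ) in
/-- The inverse of the Madelung transform. -/
def madelungInv : Proj n μ → CotangentDens n μ :=
  have : Nonempty (CotangentDens n μ) := ⟨(uniformDens n μ, 0)⟩
  Function.invFun (madelung n μ)

theorem madelungInv_madelung (z : CotangentDens n μ) : madelungInv n μ (madelung n μ z) = z :=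
  have : Nonempty (CotangentDens n μ) := ⟨z⟩
  Function.leftInverse_invFun (madelung_injective n μ) z

/-- By injectivity the inverse, although obtained by choice, is given near `e^L` by the explicit
formula `logCoord`; its continuity and smoothness are read off from this. -/
theorem cotangentCoord_madelungInv {L ψ : SmoothFn n M ℂ} (h : ψ ∈ logNhd L)
    (hn : ip μ ψ ψ ≠ 0) :
    cotangentCoord n μ (madelungInv n μ ⟦normalize μ ψ hn⟧) = logCoord μ L ψ := by
  obtain ⟨z, hz, hz'⟩ := exists_madelung_eq_normalize h hn
  rw [← hz, madelungInv_madelung, hz']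

-- Continuity can be tested on the sphere, by the quotient topology, and for the coordinate of the
-- value, as the chart is an embedding. There the map is locally `logCoord`.
variable (n μ) in
theorem continuousOn_madelungInv : ContinuousOn (madelungInv n μ) (nullhomotopic n μ) := by
  rw [(isOpenEmbedding_cotangentCoord n μ).isInducing.continuousOn_iff]
  refine (isQuotientMap_quot_mk.continuousOn_isOpen_iff (isOpen_nullhomotopic n μ)).2 ?_
  intro ψ hψ
  obtain ⟨L, hL⟩ := mk_mem_nullhomotopic.1 hψ
  have hN := (isOpen_logNhd L).preimage
    (continuous_subtype_val (p := fun ψ : SmoothFn n M ℂ => ip μ ψ ψ = 1))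
  have c : ContinuousOn (logCoord μ L) (logNhd L) :=
    CkOn.logCoord 0 L continuousOn_id (mapsTo_id _)
  have c' : ContinuousAt (fun ψ : Sphere n μ => logCoord μ L ψ.1) ψ :=
    (c.comp continuous_subtype_val.continuousOn fun _ h => h).continuousAt
      (hN.mem_nhds (mem_logNhd hL))
  refine (c'.congr ?_).continuousWithinAt
  filter_upwards [hN.mem_nhds (mem_logNhd hL)] with ψ' h
  have h0 : ip μ ψ'.1 ψ'.1 ≠ 0 := ip_self_ne_zero_of_mem_logNhd h
  have e := cotangentCoord_madelungInv h h0
  rw [normalize_coe] at e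
  exact e.symm

variable (n μ) in
theorem smoothMapOn_madelungInv : SmoothMapOn (projAtlas n μ) (cotangentAtlas n μ)
    (madelungInv n μ) (nullhomotopic n μ) := by
  -- The logarithm `L` used in the formula for the inverse depends on the point, so smoothness is
  -- checked locally.
  refine ⟨continuousOn_madelungInv n μ, fun φ _ k => CkOn.of_local k ?_⟩
  rintro χ ⟨-, hχ, -⟩
  obtain ⟨L, hL⟩ := mk_mem_nullhomotopic.1 hχ
  -- `L` is a logarithm of the normalised function; the positive factor does not affect the sign of
  -- the real part.
  have hχL : φ.1 + χ.1 ∈ logNhd L := fun x => by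
    have h := mem_logNhd hL x
    set c : ℝ := (√(ip μ (φ.1 + χ.1) (φ.1 + χ.1)).re)⁻¹
    have hc0 : 0 < c :=
      inv_pos.2 (Real.sqrt_pos.2 (ip_self_pos (ip_self_add_orth_ne_zero φ χ)))
    change 0 < ((c : ℂ) * (φ.1 + χ.1) x * Complex.exp (-L x)).re at h
    rw [mul_assoc, Complex.re_ofReal_mul] at h
    exact pos_of_mul_pos_right h hc0.le
  have hN : IsOpen {χ : orth μ φ | φ.1 + χ.1 ∈ logNhd L} :=
    (isOpen_logNhd L).preimage (continuous_const.add continuous_subtype_val)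
  refine ⟨_, hN, hχL, CkOn.congr hN (CkOn.logCoord (μ := μ) k L
    (CkOn.affine k φ.1 (orth μ φ).subtypeL _) fun y hy => hy) fun y hy => ?_⟩
  exact (cotangentCoord_madelungInv hy (ip_self_add_orth_ne_zero φ y)).symm

theorem ip_madelungModel_ne_zero {φ : Sphere n μ} {i : Unit} {y : CotangentDensModel n μ}
    (hy : y ∈ ((cotangentAtlas n μ).chart i).target)
    (h : madelung n μ (((cotangentAtlas n μ).chart i).symm y) ∈
      ((projAtlas n μ).chart φ).source) : ip μ φ.1 (madelungModel n μ y) ≠ 0 := by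
  rw [madelung_eq] at h
  rw [madelungModel_of_mem n μ hy]
  exact h

theorem chart_madelung {φ : Sphere n μ} {i : Unit} {y : CotangentDensModel n μ}
    (hy : y ∈ ((cotangentAtlas n μ).chart i).target) :
    (projAtlas n μ).chart φ (madelung n μ (((cotangentAtlas n μ).chart i).symm y)) =
      homogCoord φ (madelungModel n μ y) := by
  rw [madelung_eq, madelungModel_of_mem n μ hy]
  rfl

variable (n μ) in
theorem continuous_madelung : Continuous (madelung n μ) := by
  have h1 : Continuous fun z : CotangentDens n μ => madelungModel n μ (cotangentCoord n μ z) := by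
    refine ContinuousOn.comp_continuous (g := madelungModel n μ) (CkOn.continuousOn (ckOn_madelungModel n μ 0))
      (isOpenEmbedding_cotangentCoord n μ).continuous fun z => ?_
    simp only [mem_ofPred_eq, modelDens_cotangentCoord]
    exact z.1.2.1
  simp only [madelungModel_cotangentCoord] at h1
  rw [funext (madelung_eq n μ)]
  exact continuous_quot_mk.comp (h1.subtype_mk _)

variable (n μ) in
theorem smoothMapOn_madelung : SmoothMapOn (cotangentAtlas n μ) (projAtlas n μ)
    (madelung n μ) univ := by
  refine ⟨(continuous_madelung n μ).continuousOn, fun i φ k => ?_⟩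
  set A := (cotangentAtlas n μ).chart i
  set U := {y | y ∈ A.target ∧ A.symm y ∈ univ ∧
    madelung n μ (A.symm y) ∈ ((projAtlas n μ).chart φ).source} with hU
  have hUo : IsOpen U := by
    have h := (A.continuousOn_symm.isOpen_inter_preimage A.open_target
      (((projAtlas n μ).chart φ).open_source.preimage (continuous_madelung n μ)))
    convert h using 1
    ext y
    simp [hU]
  refine CkOn.congr hUo (CkOn.homogCoord k φ ((ckOn_madelungModel n μ k).mono fun y hy =>
    mem_cotangentAtlas_target n μ hy.1) fun y hy => ip_madelungModel_ne_zero hy.1 hy.2.2) ?_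
  exact fun y hy => (chart_madelung hy.1).symm

theorem re_add_I_mul (a b : ℝ) : ((a : ℂ) + Complex.I * b).re = a := by simp

theorem im_add_I_mul (a b : ℝ) : ((a : ℂ) + Complex.I * b).im = b := by simp

/-- Pointwise `ψ̄ u = ρ (h/(2ρ) + iθ/2)`, with real part `h/2`. For `h` of mean zero this vanishes,
so `u` is tangent to the sphere. -/
theorem ip_re_eq_integral {ψ u : SmoothFn n M ℂ} {ρ h θ : SmoothFn n M ℝ}
    (hψ : ∀ x, ‖ψ x‖ ^ 2 = ρ x) (hρ : ∀ x, 0 < ρ x)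
    (hu : ∀ x, u x = ((h x / (2 * ρ x) : ℝ) + Complex.I * (θ x / 2 : ℝ)) * ψ x) :
    (ip μ ψ u).re = 1 / 2 * ∫ x, h x ∂μ := by
  have := isFiniteMeasure n μ
  rw [← integral_const_mul, ← Complex.reCLM_apply, ip,
    ← Complex.reCLM.integral_comp_comm (integrable_ip μ ψ u)]
  congr 1
  funext x
  have e : conj (ψ x) * u x =
      (ρ x : ℝ) * ((h x / (2 * ρ x) : ℝ) + Complex.I * (θ x / 2 : ℝ)) := by
    rw [hu, ← hψ, ← Complex.normSq_eq_norm_sq, Complex.normSq_eq_conj_mul_self]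
    ring
  rw [e, Complex.reCLM_apply, Complex.re_ofReal_mul, re_add_I_mul]
  have := (hρ x).ne'
  field_simp

/-- The imaginary part of `ρ (h/(2ρ) - iθ/2)(h'/(2ρ) + iθ'/2)` is `(h θ' - h' θ)/4`: the density
cancels, and the two halves produce the factor 4. -/
theorem ip_im_eq_integral {ψ u u' : SmoothFn n M ℂ} {ρ h θ h' θ' : SmoothFn n M ℝ}
    (hψ : ∀ x, ‖ψ x‖ ^ 2 = ρ x) (hρ : ∀ x, 0 < ρ x)
    (hu : ∀ x, u x = ((h x / (2 * ρ x) : ℝ) + Complex.I * (θ x / 2 : ℝ)) * ψ x)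
    (hu' : ∀ x, u' x = ((h' x / (2 * ρ x) : ℝ) + Complex.I * (θ' x / 2 : ℝ)) * ψ x) :
    4 * (ip μ u u').im = mulIntegral n μ θ' h - mulIntegral n μ θ h' := by
  have := isFiniteMeasure n μ
  have i1 : Integrable (fun x => θ' x * h x) μ := integrable_cont μ (toCont θ' * toCont h)
  have i2 : Integrable (fun x => θ x * h' x) μ := integrable_cont μ (toCont θ * toCont h')
  rw [mulIntegral_apply, mulIntegral_apply, ← integral_sub i1 i2, ← Complex.imCLM_apply, ip,
    ← Complex.imCLM.integral_comp_comm (integrable_ip μ u u'), ← integral_const_mul]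
  congr 1
  funext x
  have e : conj (u x) * u' x = (ρ x : ℝ) *
      (conj ((h x / (2 * ρ x) : ℝ) + Complex.I * (θ x / 2 : ℝ) : ℂ) *
        ((h' x / (2 * ρ x) : ℝ) + Complex.I * (θ' x / 2 : ℝ))) := by
    rw [hu, hu', ← hψ, ← Complex.normSq_eq_norm_sq, Complex.normSq_eq_conj_mul_self, map_mul]
    ring
  rw [e, Complex.imCLM_apply, Complex.im_ofReal_mul, Complex.mul_im, Complex.conj_re,
    Complex.conj_im, re_add_I_mul, re_add_I_mul, im_add_I_mul, im_add_I_mul]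
  have := (hρ x).ne'
  field_simp
  ring

/-- The Fubini–Study form is evaluated in homogeneous coordinates at the unit vector `ψ` on the
derivatives `a`, `b` of the function-valued transform, where the form reduces to `Im ⟨a, b⟩`. -/
theorem pullback_madelung (i : Unit) (φ : Sphere n μ) {x : CotangentDensModel n μ}
    (hx : x ∈ ((cotangentAtlas n μ).chart i).target)
    (hφ : madelung n μ (((cotangentAtlas n μ).chart i).symm x) ∈ ((projAtlas n μ).chart φ).source)
    {v w : CotangentDensModel n μ} {v' w' : orth μ φ}
    (hv : HasDirDeriv (fun y => (projAtlas n μ).chart φ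
      (madelung n μ (((cotangentAtlas n μ).chart i).symm y))) v' x v)
    (hw : HasDirDeriv (fun y => (projAtlas n μ).chart φ
      (madelung n μ (((cotangentAtlas n μ).chart i).symm y))) w' x w) :
    4 * (fsHermitian μ (φ.1 + ((projAtlas n μ).chart φ
      (madelung n μ (((cotangentAtlas n μ).chart i).symm x))).1) v'.1 w'.1).im =
      pairing n μ w.2 v.1 - pairing n μ v.2 w.1 := by
  have hne := ip_madelungModel_ne_zero hx hφ
  have key : ∀ {u : CotangentDensModel n μ} {u' : orth μ φ},
      HasDirDeriv (fun y => (projAtlas n μ).chart φ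
        (madelung n μ (((cotangentAtlas n μ).chart i).symm y))) u' x u →
      HasDirDeriv (fun y => homogCoord φ (madelungModel n μ y)) u' x u := fun {u u'} hu =>
    hu.congr (chart_madelung hx) ((eventually_mem_line
      ((cotangentAtlas n μ).chart i).open_target hx u).mono fun t ht => chart_madelung ht)
  have hρ := mem_cotangentAtlas_target n μ hx
  obtain ⟨a, ha, ha'⟩ := exists_hasDirDeriv_madelungModel n μ hρ v
  obtain ⟨b, hb, hb'⟩ := exists_hasDirDeriv_madelungModel n μ hρ w
  have ea := hasDirDeriv_of_homogCoord hne ha (key hv)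
  have eb := hasDirDeriv_of_homogCoord hne hb (key hw)
  have eψ := cmul_add_homogCoord φ hne
  set ψ := madelungModel n μ x with hψ
  have h1 : ip μ ψ ψ = 1 := by
    rw [hψ, madelungModel_of_mem n μ hx]
    exact ip_madelungFn n μ _ _
  have h2 : ∀ y, ‖ψ y‖ ^ 2 = modelDens n μ x y := fun y => by
    rw [hψ, madelungModel_apply, madelungLog_apply n μ hρ, Complex.norm_exp,
      re_add_I_mul, ← Real.exp_nat_mul, Nat.cast_ofNat, mul_div_cancel₀ _ two_ne_zero,
      Real.exp_log (hρ y)]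
  -- Invariance with scaling factor `⟨φ, ψ⟩` and fibre components `⟨φ, a⟩`, `⟨φ, b⟩` moves the form
  -- from the chart to `ψ`, `a`, `b`.
  have h3 := fsHermitian_invariant (ip_self_add_orth_ne_zero φ (homogCoord φ ψ)) hne
    (ip μ φ.1 a) (ip μ φ.1 b) v'.1 w'.1
  rw [← ea, ← eb, eψ] at h3
  rw [chart_madelung hx, ← h3, fsHermitian_im, h1]
  have h4 : (ip μ ψ a).re = 0 := by
    rw [ip_re_eq_integral h2 hρ ha']
    have : ∫ y, v.1.1 y ∂μ = 0 := v.1.2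
    rw [this, mul_zero]
  have h5 : (ip μ ψ b).re = 0 := by
    rw [ip_re_eq_integral h2 hρ hb']
    have : ∫ y, w.1.1 y ∂μ = 0 := w.1.2
    rw [this, mul_zero]
  -- With `h5` this kills both products in the imaginary part of `⟨a, ψ⟩ ⟨ψ, b⟩`.
  have h6 : (ip μ a ψ).re = 0 := by
    rw [← ip_conj, Complex.conj_re, h4]
  have h7 := ip_im_eq_integral (μ := μ) h2 hρ ha' hb'
  have h8 : ∀ (q : Cotangent n M) (h : zeroMean n μ),
      pairing n μ q h = mulIntegral n μ (cotangentSection n q) h.1 := fun q h => by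
    conv_lhs => rw [← mk_cotangentSection n q]
    rfl
  rw [h8, h8, ← h7, h5, h6]
  simp

variable (n μ) in
theorem isSymplectomorphismOnto_madelung :
    IsSymplectomorphismOnto (canonicalForm n μ) ((fubiniStudyForm n μ).scale 4 four_ne_zero)
      (madelung n μ) (nullhomotopic n μ) where
  isOpen := isOpen_nullhomotopic n μ
  range_eq := range_madelung n μ
  smooth := smoothMapOn_madelung n μ
  smooth_inverse := ⟨madelungInv n μ, madelungInv_madelung, smoothMapOn_madelungInv n μ⟩
  pullback i φ _ hx hφ _ _ _ _ hv hw := pullback_madelung i φ hx hφ hv hw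

end Symplectomorphism

end Madelung

end

theorem mainTheorem3 {n : ℕ} {M : Type*} [TopologicalSpace M] [T2Space M] [CompactSpace M]
    [ConnectedSpace M] [ChartedSpace (Madelung.Euc n) M] [IsManifold (𝓡 n) ∞ M]
    [MeasurableSpace M] [BorelSpace M] (μ : Measure M) [Madelung.IsSmoothVolume n μ] :
    -- the Madelung transform of functions induces a map `T*Dens(M) → PC^∞(M, ℂ ∖ {0})`
    (∀ (ρ : Madelung.Dens n μ) (θ : Madelung.SmoothFn n M ℝ),
      Madelung.madelung n μ (ρ, Submodule.Quotient.mk θ) =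
        ⟦⟨Madelung.madelungFn ρ.1 θ ρ.2.1, Madelung.ip_madelungFn n μ ρ θ⟩⟧) ∧
    IsOpen (Madelung.nonvanishing n μ) ∧
    (∀ z, Madelung.madelung n μ z ∈ Madelung.nonvanishing n μ) ∧
    -- it is a symplectomorphism onto its image, an open subset which is identified here
    Madelung.IsSymplectomorphismOnto (Madelung.canonicalForm n μ)
      ((Madelung.fubiniStudyForm n μ).scale 4 four_ne_zero)
      (Madelung.madelung n μ) (Madelung.nullhomotopic n μ) ∧
    -- the image is all of `PC^∞(M, ℂ ∖ {0})` if `M` is simply connected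
    (SimplyConnectedSpace M →
      Madelung.IsSymplectomorphismOnto (Madelung.canonicalForm n μ)
        ((Madelung.fubiniStudyForm n μ).scale 4 four_ne_zero)
        (Madelung.madelung n μ) (Madelung.nonvanishing n μ)) := by
  refine ⟨fun ρ θ => rfl, Madelung.isOpen_nonvanishing n μ, fun z => ?_,
    Madelung.isSymplectomorphismOnto_madelung n μ, fun _ => ?_⟩
  · exact Madelung.nullhomotopic_subset_nonvanishing n μ
      (Madelung.range_madelung n μ ▸ mem_range_self z)
  · rw [← Madelung.nullhomotopic_eq_nonvanishing n μ]
    exact Madelung.isSymplectomorphismOnto_madelung n μ
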